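/- Let $G$ be a Lie group, $K\subset G$ a closed subgroup such that $M=G/K$ (with its standard manifold structure, for which $G\to G/K$ is a smooth submersion) is connected, and let $o=eK$. Let $\mathfrak g=\mathfrak k\oplus\mathfrak p$ be a reductive decomposition, i.e. $\mathfrak k=\mathrm{Lie}(K)$ and $\mathrm{Ad}(K)\mathfrak p\subset\mathfrak p$, identify $T_oM\equiv\mathfrak p$, and put $\mathfrak p_0=\{X\in\mathfrak p:[\mathfrak k,X]=0\}$ and $\mathrm{ad}_{\mathfrak p}X=\mathrm{pr}_{\mathfrak p}\circ\mathrm{ad}X|_{\mathfrak p}$. Let $g$ be a $G$-invariant Riemannian metric on $M$, and let $S(A)=\frac12(A+A^t)$ be the symmetric part of $A:\mathfrak p\to\mathfrak p$ with respect to $g_o$. Let $\mathcal S^2(M)^G$ be the space of $G$-invariant symmetric 2-tensors (the tangent space at $g$ of the space of $G$-invariant metrics), with the inner product $\langle T_1,T_2\rangle_g=\mathrm{tr}(A_1A_2)$, where $(T_i)_o=g_o(A_i\cdot,\cdot)$. Let $\delta_g(T)=-\sum_i(\nabla_{X_i}T)(X_i,\cdot)$ be the divergence ($\{X_i\}$ a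 local orthonormal frame, $\nabla$ the Levi-Civita connection), and let $\mathcal{TT}_g^G=\mathcal S^2(M)^G\cap\ker\delta_g\cap\ker\mathrm{tr}_g$. Write $$\mathcal P_g=\{T\in\mathcal S^2(M)^G:\ T_o=g_o(S(\mathrm{ad}_{\mathfrak p}X)\cdot,\cdot)\ \text{for some }X\in\mathfrak p_0\}.$$ (0) If $K$ is connected, then for every $X\in\mathfrak p_0$ the form $g_o(S(\mathrm{ad}_{\mathfrak p}X)\cdot,\cdot)$ is the value at $o$ of some $T\in\mathcal S^2(M)^G$, so that $\mathcal P_g=g_o(S(\mathrm{ad}_{\mathfrak p}\mathfrak p_0)\cdot,\cdot)$. (1) If $\mathrm{tr}\,\mathrm{ad}X=0$ for all $X\in\mathfrak g$ (in particular, if $G$ is unimodular), then $\mathcal S^2(M)^G=\mathcal P_g\oplus(\ker\delta_g\cap\mathcal S^2(M)^G)$ is a $\langle\cdot,\cdot\rangle_g$-orthogonal direct sum; a tensor $T\in\mathcal S^2(M)^G$ is divergence-free if and only if $T\perp_g\mathcal P_g$. (2) If $G$ is compact, let $\mathrm{Aut}(G/K)$ be the Lie group of Lie group automorphisms of $G$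 taking $K$ onto $K$, acting on $M$ by $\varphi(aK)=\varphi(a)K$ and on $G$-invariant metrics by pullback. Then the tangent space at $g$ of its orbit, i.e. the set of all velocities $\frac{d}{dt}\big|_0\varphi_t^*g$ with $t\mapsto\varphi_t$ a smooth one-parameter subgroup of $\mathrm{Aut}(G/K)$, is $$T_g(\mathrm{Aut}(G/K)\cdot g)=\mathcal P_g,$$ and $$\mathcal S^2(M)^G=\mathbb R g\oplus T_g(\mathrm{Aut}(G/K)\cdot g)\oplus\mathcal{TT}_g^G$$ is a direct sum of pairwise $\langle\cdot,\cdot\rangle_g$-orthogonal subspaces. -/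

import Mathlib

open Bundle Set Filter Topology
open scoped Manifold ContDiff Topology

noncomputable section

namespace HomTT

/-! ## Tensors of type (0,2), metrics, Levi-Civita connection and divergence on a manifold -/

section Manifold

variable (F : Type*) [NormedAddCommGroup F] [NormedSpace ℝ F]
  (M : Type*) [TopologicalSpace M] [ChartedSpace F M]

/-- A (not necessarily smooth) field of bilinear forms on the tangent spaces of `M`. -/
abbrev BilinField : Type _ :=
  ∀ x : M, TangentSpace 𝓘(ℝ, F) x →L[ℝ] TangentSpace 𝓘(ℝ, F) x →L[ℝ] ℝ

/-- Smooth tensor fields of type (0,2) on `M`, i.e. smooth sections of `Hom(TM, Hom(TM, ℝ))`. -/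
abbrev Tensor2 [IsManifold 𝓘(ℝ, F) ∞ M] : Type _ :=
  ContMDiffSection 𝓘(ℝ, F) (F →L[ℝ] F →L[ℝ] ℝ) ∞
    (fun x : M ↦ TangentSpace 𝓘(ℝ, F) x →L[ℝ] TangentSpace 𝓘(ℝ, F) x →L[ℝ] ℝ)

/-- Smooth Riemannian metrics on `M`. -/
abbrev Metric [IsManifold 𝓘(ℝ, F) ∞ M] : Type _ :=
  ContMDiffRiemannianMetric 𝓘(ℝ, F) ∞ F (fun x : M ↦ TangentSpace 𝓘(ℝ, F) x)

variable {F M}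

/-- The pullback `f^* T` of a field of bilinear forms under a self-map `f` of `M`:
`(f^* T)_x (u, v) = T_{f x} (df u, df v)`. -/
def pullback (f : M → M) (T : BilinField F M) : BilinField F M := fun x ↦
  (mfderiv 𝓘(ℝ, F) 𝓘(ℝ, F) f x).precomp ℝ ∘L T (f x) ∘L mfderiv 𝓘(ℝ, F) 𝓘(ℝ, F) f x

/-- The component `T_uv : y ↦ T (dφ⁻¹_y u, dφ⁻¹_y v)` of `T` in the preferred chart `φ` around `x`,
for constant vectors `u`, `v` of the model space. -/
def component (T : BilinField F M) (x : M) (u v : F) : F → ℝ := fun y ↦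
  T ((extChartAt 𝓘(ℝ, F) x).symm y)
    (mfderiv 𝓘(ℝ, F) 𝓘(ℝ, F) (extChartAt 𝓘(ℝ, F) x).symm y u)
    (mfderiv 𝓘(ℝ, F) 𝓘(ℝ, F) (extChartAt 𝓘(ℝ, F) x).symm y v)

/-- The partial derivative `∂_u T_vw` at `x` in the preferred chart around `x`.  (The tangent space
at `x` is identified with the model space through this chart, which is how `TangentSpace` is
defined.) -/
def partialDeriv (T : BilinField F M) (x : M) (u v w : F) : ℝ :=
  fderiv ℝ (component T x v w) (extChartAt 𝓘(ℝ, F) x x) u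

lemma partialDeriv_add_left (T : BilinField F M) (x : M) (u u' v w : F) :
    partialDeriv T x (u + u') v w = partialDeriv T x u v w + partialDeriv T x u' v w :=
  map_add _ _ _

lemma partialDeriv_smul_left (T : BilinField F M) (x : M) (c : ℝ) (u v w : F) :
    partialDeriv T x (c • u) v w = c * partialDeriv T x u v w :=
  map_smul _ _ _

variable [IsManifold 𝓘(ℝ, F) ∞ M]

set_option synthInstance.maxHeartbeats 200000 in
instance : AddCommGroup (Tensor2 F M) := ContMDiffSection.instAddCommGroup

set_option synthInstance.maxHeartbeats 200000 in
instance : Module ℝ (Tensor2 F M) := ContMDiffSection.instModule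

set_option synthInstance.maxHeartbeats 200000 in
instance : Zero (Tensor2 F M) := ContMDiffSection.instZero

set_option synthInstance.maxHeartbeats 200000 in
instance : Add (Tensor2 F M) := ContMDiffSection.instAdd

set_option synthInstance.maxHeartbeats 200000 in
instance : SMul ℝ (Tensor2 F M) := ContMDiffSection.instSMul

lemma symm_trivializationAt_eq (x : M) {y : F} (hy : y ∈ (extChartAt 𝓘(ℝ, F) x).target) (u : F) :
    (trivializationAt F (fun x : M ↦ TangentSpace 𝓘(ℝ, F) x) x).symm
      ((extChartAt 𝓘(ℝ, F) x).symm y) u =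
        mfderiv 𝓘(ℝ, F) 𝓘(ℝ, F) (extChartAt 𝓘(ℝ, F) x).symm y u := by
  have hs := (extChartAt 𝓘(ℝ, F) x).map_target hy
  rw [extChartAt_source] at hs
  have h1 := TangentBundle.symmL_trivializationAt (I := 𝓘(ℝ, F)) hs
  have h2 : (extChartAt 𝓘(ℝ, F) x) ((extChartAt 𝓘(ℝ, F) x).symm y) = y :=
    (extChartAt 𝓘(ℝ, F) x).right_inv hy
  rw [h2] at h1
  simp only [modelWithCornersSelf_coe, range_id, mfderivWithin_univ] at h1
  have h4 := congrArg
    (fun L : F →L[ℝ] TangentSpace 𝓘(ℝ, F) ((extChartAt 𝓘(ℝ, F) x).symm y) ↦ L u) h1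
  exact ((Trivialization.symmL_apply (R := ℝ) _ hs u).symm).trans h4

lemma component_eq (T : BilinField F M) (x : M) {y : F} (hy : y ∈ (extChartAt 𝓘(ℝ, F) x).target)
    (u v : F) :
    component T x u v y =
      (trivializationAt (F →L[ℝ] F →L[ℝ] ℝ)
        (fun x : M ↦ TangentSpace 𝓘(ℝ, F) x →L[ℝ] TangentSpace 𝓘(ℝ, F) x →L[ℝ] ℝ) x
        ⟨(extChartAt 𝓘(ℝ, F) x).symm y, T ((extChartAt 𝓘(ℝ, F) x).symm y)⟩).2 u v := by
  have hs := (extChartAt 𝓘(ℝ, F) x).map_target hy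
  rw [extChartAt_source] at hs
  rw [hom_trivializationAt_apply]
  dsimp only
  rw [inCoordinates_apply_eq₂ (F₁ := F) (F₂ := F) (F₃ := ℝ)
    (E₁ := fun x : M ↦ TangentSpace 𝓘(ℝ, F) x) (E₂ := fun x : M ↦ TangentSpace 𝓘(ℝ, F) x)
    (E₃ := fun _ : M ↦ ℝ) hs hs (by simp)]
  rw [symm_trivializationAt_eq x hy, symm_trivializationAt_eq x hy]
  simp
  rfl

lemma component_self (T : BilinField F M) (x : M) (u v : F) :
    component T x u v (extChartAt 𝓘(ℝ, F) x x) = T x u v := by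
  rw [component_eq T x (mem_extChartAt_target x)]
  refine (congrArg (fun p ↦ (trivializationAt (F →L[ℝ] F →L[ℝ] ℝ)
        (fun x : M ↦ TangentSpace 𝓘(ℝ, F) x →L[ℝ] TangentSpace 𝓘(ℝ, F) x →L[ℝ] ℝ) x
        ⟨p, T p⟩).2 u v) (extChartAt_to_inv (I := 𝓘(ℝ, F)) x)).trans ?_
  have hs : x ∈ (chartAt F x).source := mem_chart_source F x
  have h : ∀ u : F, (trivializationAt F (fun x : M ↦ TangentSpace 𝓘(ℝ, F) x) x).symm x u = u := by
    intro u
    refine (Trivialization.symmL_apply (R := ℝ) _ hs u).symm.trans ?_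
    have h1 := TangentBundle.symmL_trivializationAt_eq_core (I := 𝓘(ℝ, F)) hs
    refine (congrArg (fun L : F →L[ℝ] F ↦ L u) h1).trans ?_
    exact (tangentBundleCore 𝓘(ℝ, F) M).coordChange_self _ _ hs _
  rw [hom_trivializationAt_apply]
  dsimp only
  rw [inCoordinates_apply_eq₂ (F₁ := F) (F₂ := F) (F₃ := ℝ)
    (E₁ := fun x : M ↦ TangentSpace 𝓘(ℝ, F) x) (E₂ := fun x : M ↦ TangentSpace 𝓘(ℝ, F) x)
    (E₃ := fun _ : M ↦ ℝ) hs hs (by simp), h, h]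
  simp

set_option synthInstance.maxHeartbeats 200000 in
lemma differentiableAt_component (T : Tensor2 F M) (x : M) (u v : F) :
    DifferentiableAt ℝ (component T x u v) (extChartAt 𝓘(ℝ, F) x x) := by
  have h1 := (contMDiffAt_section (s := T.toFun) x).1 (T.contMDiff x)
  have h2 : ContMDiffAt 𝓘(ℝ, F) 𝓘(ℝ, F) ∞ (extChartAt 𝓘(ℝ, F) x).symm
      (extChartAt 𝓘(ℝ, F) x x) :=
    (contMDiffOn_extChartAt_symm x).contMDiffAt (extChartAt_target_mem_nhds x)
  have h3 := (ContMDiffAt.comp_of_eq h1 h2 (extChartAt_to_inv x)).contDiffAt.differentiableAt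
    (by simp)
  have h4 := (h3.clm_apply (differentiableAt_const u)).clm_apply (differentiableAt_const v)
  refine DifferentiableAt.congr_of_eventuallyEq h4 ?_
  filter_upwards [extChartAt_target_mem_nhds x] with y hy
  exact component_eq (fun y ↦ T y) x hy u v

/-- The value of `T` at `x`, as a bilinear form on the tangent space at `x` (which is, by definition
of `TangentSpace`, the model space `F` through the preferred chart around `x`). -/
def formAt (T : BilinField F M) (x : M) : LinearMap.BilinForm ℝ F :=
  LinearMap.mk₂ ℝ (fun u v : F ↦ T x u v)
    (fun u u' v ↦ by
      have := congrArg (fun L : TangentSpace 𝓘(ℝ, F) x →L[ℝ] ℝ ↦ L v) ((T x).map_add u u')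
      exact this)
    (fun c u v ↦ by
      have := congrArg (fun L : TangentSpace 𝓘(ℝ, F) x →L[ℝ] ℝ ↦ L v) ((T x).map_smul c u)
      exact this)
    (fun u v v' ↦ (T x u).map_add v v')
    (fun c u v ↦ (T x u).map_smul c v)

lemma formAt_add (S T : Tensor2 F M) (x : M) :
    formAt (S + T) x = formAt S x + formAt T x := by
  ext u v; rfl

lemma formAt_smul (c : ℝ) (T : Tensor2 F M) (x : M) : formAt (c • T) x = c • formAt T x := by
  ext u v; rfl

lemma partialDeriv_add_mid (T : Tensor2 F M) (x : M) (u v v' w : F) :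
    partialDeriv T x u (v + v') w = partialDeriv T x u v w + partialDeriv T x u v' w := by
  have h : component T x (v + v') w = component T x v w + component T x v' w := by
    funext y
    simp only [component, Pi.add_apply]
    exact (congrArg (fun L : TangentSpace 𝓘(ℝ, F) _ →L[ℝ] ℝ ↦ L _) (((T _).congr_arg (map_add _ v v')).trans (map_add _ _ _)))
  rw [partialDeriv, h, fderiv_add (differentiableAt_component T x v w)
    (differentiableAt_component T x v' w)]
  rfl

lemma partialDeriv_smul_mid (T : Tensor2 F M) (x : M) (c : ℝ) (u v w : F) :
    partialDeriv T x u (c • v) w = c * partialDeriv T x u v w := by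
  have h : component T x (c • v) w = c • component T x v w := by
    funext y
    simp only [component, Pi.smul_apply]
    rw [← smul_apply, ← map_smul]
    congr 2
    exact map_smul _ _ _
  rw [partialDeriv, h, fderiv_const_smul (differentiableAt_component T x v w)]
  rfl

lemma partialDeriv_add_right (T : Tensor2 F M) (x : M) (u v w w' : F) :
    partialDeriv T x u v (w + w') = partialDeriv T x u v w + partialDeriv T x u v w' := by
  have h : component T x v (w + w') = component T x v w + component T x v w' := by
    funext y
    simp only [component, Pi.add_apply]
    rw [← map_add]
    congr 1
    exact map_add _ _ _
  rw [partialDeriv, h, fderiv_add (differentiableAt_component T x v w)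
    (differentiableAt_component T x v w')]
  rfl

lemma partialDeriv_smul_right (T : Tensor2 F M) (x : M) (c : ℝ) (u v w : F) :
    partialDeriv T x u v (c • w) = c * partialDeriv T x u v w := by
  have h : component T x v (c • w) = c • component T x v w := by
    funext y
    simp only [component, Pi.smul_apply]
    rw [← map_smul]
    congr 1
    exact map_smul _ _ _
  rw [partialDeriv, h, fderiv_const_smul (differentiableAt_component T x v w)]
  rfl

lemma partialDeriv_add (S T : Tensor2 F M) (x : M) (u v w : F) :
    partialDeriv (S + T : Tensor2 F M) x u v w =
      partialDeriv S x u v w + partialDeriv T x u v w := by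
  have h : component (S + T : Tensor2 F M) x v w = component S x v w + component T x v w := rfl
  rw [partialDeriv, h, fderiv_add (differentiableAt_component S x v w)
    (differentiableAt_component T x v w)]
  rfl

lemma partialDeriv_smul (c : ℝ) (T : Tensor2 F M) (x : M) (u v w : F) :
    partialDeriv (c • T : Tensor2 F M) x u v w = c * partialDeriv T x u v w := by
  have h : component (c • T : Tensor2 F M) x v w = c • component T x v w := rfl
  rw [partialDeriv, h, fderiv_const_smul (differentiableAt_component T x v w)]
  rfl

/-- A Riemannian metric, seen as a smooth tensor of type (0,2). -/
def metricTensor (g : Metric F M) : Tensor2 F M := ⟨g.inner, g.contMDiff⟩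

lemma formAt_nondegenerate (g : Metric F M) (x : M) : (formAt g.inner x).Nondegenerate := by
  have h : ∀ v : F, formAt g.inner x v v = 0 → v = 0 := by
    intro v hv
    by_contra hne
    exact (g.pos x v hne).ne' hv
  exact ⟨fun v hv ↦ h v (hv v), fun v hv ↦ h v (hv v)⟩

variable [FiniteDimensional ℝ F]

/-- The endomorphism `A` of the tangent space at `x` with `B = g_x(A ·, ·)`. -/
def endo (g : Metric F M) (x : M) (B : LinearMap.BilinForm ℝ F) : F →ₗ[ℝ] F :=
  B.symmCompOfNondegenerate (formAt g.inner x) (formAt_nondegenerate g x)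

/-- The trace of a bilinear form with respect to `g_x`, i.e. `∑ B(X_i, X_i)` for any
`g_x`-orthonormal basis `X_i`. -/
def trace (g : Metric F M) (x : M) : LinearMap.BilinForm ℝ F →ₗ[ℝ] ℝ where
  toFun B := LinearMap.trace ℝ F (endo g x B)
  map_add' B C := by
    rw [← map_add]; congr 1; ext v
    simp [endo, LinearMap.BilinForm.symmCompOfNondegenerate]
  map_smul' c B := by
    rw [RingHom.id_apply, ← map_smul]; congr 1; ext v
    simp [endo, LinearMap.BilinForm.symmCompOfNondegenerate]

/-- The 1-form `w ↦ g(∇_u v, w) = ½ (∂_u g_vw + ∂_v g_uw - ∂_w g_uv)` at `x`, where `u`, `v` are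
extended as vector fields with constant coefficients in the preferred chart around `x`. -/
def koszulForm (g : Metric F M) (x : M) (u v : F) : Module.Dual ℝ F where
  toFun w := (partialDeriv (metricTensor g) x u v w + partialDeriv (metricTensor g) x v u w
    - partialDeriv (metricTensor g) x w u v) / 2
  map_add' w w' := by simp only [partialDeriv_add_left, partialDeriv_add_right]; ring
  map_smul' c w := by
    simp only [partialDeriv_smul_left, partialDeriv_smul_right, smul_eq_mul, RingHom.id_apply]; ring

/-- The Christoffel symbols `Γ(u, v) = ∇_u v` at `x` of the Levi-Civita connection of `g` in the
preferred chart around `x`, where `v` is extended with constant coefficients. -/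
def christoffel (g : Metric F M) (x : M) : F →ₗ[ℝ] F →ₗ[ℝ] F :=
  LinearMap.mk₂ ℝ
    (fun u v ↦ ((formAt g.inner x).toDual (formAt_nondegenerate g x)).symm (koszulForm g x u v))
    (fun u u' v ↦ by
      rw [← map_add]; congr 1; ext w
      simp only [koszulForm, LinearMap.coe_mk, AddHom.coe_mk, LinearMap.add_apply,
        partialDeriv_add_left, partialDeriv_add_mid]; ring)
    (fun c u v ↦ by
      rw [← map_smul]; congr 1; ext w
      simp only [koszulForm, LinearMap.coe_mk, AddHom.coe_mk, LinearMap.smul_apply,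
        partialDeriv_smul_left, partialDeriv_smul_mid, smul_eq_mul]; ring)
    (fun u v v' ↦ by
      rw [← map_add]; congr 1; ext w
      simp only [koszulForm, LinearMap.coe_mk, AddHom.coe_mk, LinearMap.add_apply,
        partialDeriv_add_left, partialDeriv_add_mid, partialDeriv_add_right]; ring)
    (fun c u v ↦ by
      rw [← map_smul]; congr 1; ext w
      simp only [koszulForm, LinearMap.coe_mk, AddHom.coe_mk, LinearMap.smul_apply,
        partialDeriv_smul_left, partialDeriv_smul_mid, partialDeriv_smul_right, smul_eq_mul]; ring)

/-- For fixed `w`, the bilinear form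
`(u, v) ↦ (∇_u T)(v, w) = ∂_u T_vw - T(∇_u v, w) - T(v, ∇_u w)` at `x`, where `∇` is the
Levi-Civita connection of `g`. -/
def covDeriv (g : Metric F M) (T : Tensor2 F M) (x : M) (w : F) : LinearMap.BilinForm ℝ F :=
  LinearMap.mk₂ ℝ
    (fun u v ↦ partialDeriv T x u v w - formAt T x (christoffel g x u v) w
      - formAt T x v (christoffel g x u w))
    (fun u u' v ↦ by
      simp only [map_add, partialDeriv_add_left, LinearMap.add_apply]; ring)
    (fun c u v ↦ by
      simp only [map_smul, partialDeriv_smul_left, LinearMap.smul_apply, smul_eq_mul]; ring)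
    (fun u v v' ↦ by
      simp only [map_add, partialDeriv_add_mid, LinearMap.add_apply]; ring)
    (fun c u v ↦ by
      simp only [map_smul, partialDeriv_smul_mid, LinearMap.smul_apply, smul_eq_mul]; ring)

/-- The divergence `δ_g(T)_x(w) = -∑ (∇_{X_i} T)(X_i, w)`, with `X_i` a `g_x`-orthonormal basis. -/
def divergence (g : Metric F M) (T : Tensor2 F M) (x : M) (w : F) : ℝ :=
  - trace g x (covDeriv g T x w)

lemma divergence_add (g : Metric F M) (S T : Tensor2 F M) (x : M) (w : F) :
    divergence g (S + T) x w = divergence g S x w + divergence g T x w := by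
  have h : covDeriv g (S + T) x w = covDeriv g S x w + covDeriv g T x w := by
    ext u v
    simp only [covDeriv, LinearMap.mk₂_apply, LinearMap.add_apply, formAt_add, partialDeriv_add]
    ring
  simp only [divergence, h, map_add]; ring

lemma divergence_smul (g : Metric F M) (c : ℝ) (T : Tensor2 F M) (x : M) (w : F) :
    divergence g (c • T) x w = c * divergence g T x w := by
  have h : covDeriv g (c • T) x w = c • covDeriv g T x w := by
    ext u v
    simp only [covDeriv, LinearMap.mk₂_apply, LinearMap.smul_apply, formAt_smul, partialDeriv_smul,
      smul_eq_mul]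
    ring
  simp only [divergence, h, map_smul, smul_eq_mul]; ring

end Manifold

/-! ## Homogeneous spaces -/

section Homogeneous

variable {E : Type*} [NormedAddCommGroup E] [NormedSpace ℝ E]
  {F : Type*} [NormedAddCommGroup F] [NormedSpace ℝ F]
  {G : Type*} [Group G] [TopologicalSpace G] [ChartedSpace E G]

/-- The adjoint representation: `Ad a` is the differential at `1` of `b ↦ a b a⁻¹`. -/
def Ad (a : G) : GroupLieAlgebra 𝓘(ℝ, E) G →L[ℝ] GroupLieAlgebra 𝓘(ℝ, E) G :=
  mfderiv 𝓘(ℝ, E) 𝓘(ℝ, E) (fun b : G ↦ a * b * a⁻¹) 1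

instance instLieGroupMinSmoothness [LieGroup 𝓘(ℝ, E) ∞ G] :
    LieGroup 𝓘(ℝ, E) (minSmoothness ℝ 3) G :=
  LieGroup.of_le (n := ∞) (by
    rw [minSmoothness_of_isRCLikeNormedField]
    exact WithTop.coe_le_coe.2 le_top)

variable (E G) in
/-- The Lie algebra of `G` is unimodular: `tr ad X = 0` for every `X`. -/
def IsUnimodular [CompleteSpace E] [LieGroup 𝓘(ℝ, E) ∞ G] : Prop :=
  ∀ X : GroupLieAlgebra 𝓘(ℝ, E) G,
    LinearMap.trace ℝ _ (LieAlgebra.ad ℝ (GroupLieAlgebra 𝓘(ℝ, E) G) X) = 0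

variable (K : Subgroup G)

/-! ### The automorphisms of `G` preserving `K` -/

/-- `Aut(G/K)`: the automorphisms `φ` of the Lie group `G` with `φ(K) = K`. -/
def autGK : Subgroup (MulAut G) where
  carrier := {φ | ContMDiff 𝓘(ℝ, E) 𝓘(ℝ, E) ∞ φ ∧ ContMDiff 𝓘(ℝ, E) 𝓘(ℝ, E) ∞ φ.symm ∧
    ∀ a : G, φ a ∈ K ↔ a ∈ K}
  one_mem' := ⟨contMDiff_id, contMDiff_id, fun _ ↦ Iff.rfl⟩
  mul_mem' := by
    rintro φ ψ ⟨h1, h2, h3⟩ ⟨k1, k2, k3⟩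
    exact ⟨h1.comp k1, k2.comp h2, fun a ↦ (h3 _).trans (k3 a)⟩
  inv_mem' := by
    rintro φ ⟨h1, h2, h3⟩
    refine ⟨h2, h1, fun a ↦ ?_⟩
    rw [← h3]
    simp

variable {K} in
/-- The diffeomorphism of `G/K` induced by an automorphism `φ ∈ Aut(G/K)`: `aK ↦ φ(a)K`. -/
def autMap (φ : autGK (E := E) K) : G ⧸ K → G ⧸ K :=
  Quotient.map' φ.1 (by
    intro a b h
    rw [QuotientGroup.leftRel_apply] at h ⊢
    rw [← map_inv, ← map_mul]
    exact (φ.2.2.2 _).2 h)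

lemma autMap_mk (φ : autGK (E := E) K) (a : G) :
    autMap φ (a : G ⧸ K) = ((φ.1 a : G) : G ⧸ K) := rfl

/-! ### The quotient manifold and reductive decompositions -/

variable [ChartedSpace F (G ⧸ K)]

variable (E F) in
/-- The manifold structure on `G/K` is the standard one, i.e. the (unique) one for which the
projection `G → G/K` is a smooth submersion. -/
structure IsQuotientManifold : Prop where
  contMDiff_mk : ContMDiff 𝓘(ℝ, E) 𝓘(ℝ, F) ∞ (QuotientGroup.mk : G → G ⧸ K)
  mfderiv_surjective : ∀ a : G,
    Function.Surjective (mfderiv 𝓘(ℝ, E) 𝓘(ℝ, F) (QuotientGroup.mk : G → G ⧸ K) a)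

variable (E F) in
/-- The differential at `1` of the projection `G → G/K`, from the Lie algebra of `G` to the tangent
space at the origin `o = 1K` (which is the model space `F` by definition of `TangentSpace`). -/
def dproj : GroupLieAlgebra 𝓘(ℝ, E) G →L[ℝ] F :=
  mfderiv 𝓘(ℝ, E) 𝓘(ℝ, F) (QuotientGroup.mk : G → G ⧸ K) (1 : G)

variable (E F) in
/-- The Lie algebra `𝔨` of `K`, i.e. the tangent space at `1` of the fibre `K` of the projection
`G → G/K`. -/
def isotropyAlgebra : Submodule ℝ (GroupLieAlgebra 𝓘(ℝ, E) G) := 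
  LinearMap.ker (dproj E F K).toLinearMap

variable (E F) in
/-- `𝔤 = 𝔨 ⊕ 𝔭` is a reductive decomposition: `Ad(K) 𝔭 ⊆ 𝔭`. -/
structure IsReductive (𝔭 : Submodule ℝ (GroupLieAlgebra 𝓘(ℝ, E) G)) : Prop where
  isCompl : IsCompl 𝔭 (isotropyAlgebra E F K)
  ad_mem : ∀ k ∈ K, ∀ X ∈ 𝔭, Ad k X ∈ 𝔭

variable {K} in
/-- `ad_𝔭 X = pr_𝔭 ∘ ad X |_𝔭 : 𝔭 → 𝔭`. -/
def adP [CompleteSpace E] [LieGroup 𝓘(ℝ, E) ∞ G] {𝔭 : Submodule ℝ (GroupLieAlgebra 𝓘(ℝ, E) G)}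
    (h : IsReductive E F K 𝔭) (X : GroupLieAlgebra 𝓘(ℝ, E) G) : 𝔭 →ₗ[ℝ] 𝔭 :=
  𝔭.projectionOnto (isotropyAlgebra E F K) h.isCompl ∘ₗ
    LieAlgebra.ad ℝ (GroupLieAlgebra 𝓘(ℝ, E) G) X ∘ₗ 𝔭.subtype

variable (F) in
/-- `𝔭₀ = {X ∈ 𝔭 : [𝔨, X] = 0}`. -/
def pZero [CompleteSpace E] [LieGroup 𝓘(ℝ, E) ∞ G]
    (𝔭 : Submodule ℝ (GroupLieAlgebra 𝓘(ℝ, E) G)) :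
    Submodule ℝ (GroupLieAlgebra 𝓘(ℝ, E) G) where
  carrier := {X | X ∈ 𝔭 ∧ ∀ Z ∈ isotropyAlgebra E F K, ⁅Z, X⁆ = 0}
  zero_mem' := ⟨𝔭.zero_mem, fun Z _ ↦ lie_zero Z⟩
  add_mem' := by
    rintro X Y ⟨h1, h2⟩ ⟨k1, k2⟩
    exact ⟨𝔭.add_mem h1 k1, fun Z hZ ↦ by rw [lie_add, h2 Z hZ, k2 Z hZ, add_zero]⟩
  smul_mem' := by
    rintro c X ⟨h1, h2⟩
    exact ⟨𝔭.smul_mem c h1, fun Z hZ ↦ by rw [lie_smul, h2 Z hZ, smul_zero]⟩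

/-! ### Invariant tensors -/

variable [IsManifold 𝓘(ℝ, F) ∞ (G ⧸ K)]

variable (F) in
/-- `S²(M)^G`: the `G`-invariant symmetric 2-tensors on `M = G/K`. -/
def invTensors : Submodule ℝ (Tensor2 F (G ⧸ K)) where
  carrier := {T | (∀ x, ∀ u v : TangentSpace 𝓘(ℝ, F) x, T x u v = T x v u) ∧
    ∀ (a : G) (x : G ⧸ K), pullback (fun y : G ⧸ K ↦ a • y) T x = T x}
  zero_mem' := ⟨fun _ _ _ ↦ rfl, fun a x ↦ by ext u v; rfl⟩
  add_mem' := by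
    rintro S T ⟨h1, h2⟩ ⟨k1, k2⟩
    refine ⟨fun x u v ↦ congrArg₂ (· + ·) (h1 x u v) (k1 x u v), fun a x ↦ ?_⟩
    ext u v
    exact congrArg₂ (· + ·) (DFunLike.congr_fun (DFunLike.congr_fun (h2 a x) u) v)
      (DFunLike.congr_fun (DFunLike.congr_fun (k2 a x) u) v)
  smul_mem' := by
    rintro c T ⟨h1, h2⟩
    refine ⟨fun x u v ↦ congrArg (c * ·) (h1 x u v), fun a x ↦ ?_⟩
    ext u v
    exact congrArg (c * ·) (DFunLike.congr_fun (DFunLike.congr_fun (h2 a x) u) v)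

variable {K}

/-- The Riemannian metric `g` on `G/K` is `G`-invariant. -/
def IsInvariantMetric (g : Metric F (G ⧸ K)) : Prop :=
  ∀ (a : G) (x : G ⧸ K), pullback (fun y : G ⧸ K ↦ a • y) g.inner x = g.inner x

/-- The line `ℝ g` in `S²(M)^G`. -/
def metricLine (g : Metric F (G ⧸ K)) (hg : IsInvariantMetric g) : Submodule ℝ (invTensors F K) :=
  Submodule.span ℝ {⟨metricTensor g, g.symm, hg⟩}

/-- The infinitesimal trivial variations of `g`: the velocities `d/dt|₀ φ_t^* g`, where `t ↦ φ_t`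
runs over the smooth one-parameter subgroups of `Aut(G/K)`, i.e. over its Lie algebra. -/
def trivialVariations (g : Metric F (G ⧸ K)) : Set (invTensors F K) :=
  {T | ∃ φ : Multiplicative ℝ →* autGK (E := E) K,
    ContMDiff (𝓘(ℝ, ℝ).prod 𝓘(ℝ, E)) 𝓘(ℝ, E) ∞
      (fun p : ℝ × G ↦ (φ (Multiplicative.ofAdd p.1)).1 p.2) ∧
    ∀ (x : G ⧸ K) (u v : TangentSpace 𝓘(ℝ, F) x),
      HasDerivAt (fun t : ℝ ↦ pullback (autMap (φ (Multiplicative.ofAdd t))) g.inner x u v)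
        (T.1 x u v) 0}

/-- `T_o = g_o(S(ad_𝔭 X) ·, ·)`, where `S(A) = ½ (A + Aᵗ)` is the symmetric part with respect to
`g_o` and `𝔭` is identified with the tangent space at `o` through the differential of the
projection; here `g_o(Aᵗ Y, Z) = g_o(Y, A Z)`. -/
def IsSymmAdAt [CompleteSpace E] [LieGroup 𝓘(ℝ, E) ∞ G] (g : Metric F (G ⧸ K))
    {𝔭 : Submodule ℝ (GroupLieAlgebra 𝓘(ℝ, E) G)} (h : IsReductive E F K 𝔭)
    (X : GroupLieAlgebra 𝓘(ℝ, E) G) (T : BilinField F (G ⧸ K)) : Prop :=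
  ∀ Y Z : 𝔭, formAt T ((1 : G) : G ⧸ K) (dproj E F K Y) (dproj E F K Z) =
    (1 / 2) * (formAt g.inner ((1 : G) : G ⧸ K) (dproj E F K (adP h X Y)) (dproj E F K Z) +
      formAt g.inner ((1 : G) : G ⧸ K) (dproj E F K Y) (dproj E F K (adP h X Z)))

/-- `g_o(S(ad_𝔭 𝔭₀) ·, ·)`: the tensors in `S²(M)^G` whose value at `o` is `g_o(S(ad_𝔭 X) ·, ·)` for
some `X ∈ 𝔭₀`. -/
def adTensors [CompleteSpace E] [LieGroup 𝓘(ℝ, E) ∞ G] (g : Metric F (G ⧸ K))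
    {𝔭 : Submodule ℝ (GroupLieAlgebra 𝓘(ℝ, E) G)} (h : IsReductive E F K 𝔭) :
    Submodule ℝ (invTensors F K) where
  carrier := {T | ∃ X ∈ pZero F K 𝔭, IsSymmAdAt g h X T.1}
  zero_mem' := ⟨0, Submodule.zero_mem _, fun Y Z ↦ by
    have h1 : formAt ((0 : invTensors F K).1 : Tensor2 F (G ⧸ K)) ((1 : G) : G ⧸ K) = 0 := by
      ext u v; rfl
    rw [h1]
    simp [adP]⟩
  add_mem' := by
    rintro S T ⟨X, hX, hS⟩ ⟨X', hX', hT⟩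
    refine ⟨X + X', Submodule.add_mem _ hX hX', fun Y Z ↦ ?_⟩
    have h1 : formAt ((S + T).1 : Tensor2 F (G ⧸ K)) ((1 : G) : G ⧸ K) =
      formAt S.1 ((1 : G) : G ⧸ K) + formAt T.1 ((1 : G) : G ⧸ K) := formAt_add _ _ _
    rw [h1, LinearMap.add_apply, LinearMap.add_apply, hS Y Z, hT Y Z]
    have h2 : ∀ W : 𝔭, adP h (X + X') W = adP h X W + adP h X' W := fun W ↦ by simp [adP]
    simp only [h2, Submodule.coe_add, map_add, LinearMap.add_apply]
    ring
  smul_mem' := by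
    rintro c T ⟨X, hX, hT⟩
    refine ⟨c • X, Submodule.smul_mem _ c hX, fun Y Z ↦ ?_⟩
    have h1 : formAt ((c • T).1 : Tensor2 F (G ⧸ K)) ((1 : G) : G ⧸ K) =
      c • formAt T.1 ((1 : G) : G ⧸ K) := formAt_smul _ _ _
    rw [h1, LinearMap.smul_apply, LinearMap.smul_apply, hT Y Z]
    have h2 : ∀ W : 𝔭, adP h (c • X) W = c • adP h X W := fun W ↦ by simp [adP]
    simp only [h2, Submodule.coe_smul, map_smul, LinearMap.smul_apply, smul_eq_mul]
    ring

variable [FiniteDimensional ℝ F]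

/-- The inner product `⟨S, T⟩_g = tr (A B)` on `S²(M)^G`, where `S_o = g_o(A ·, ·)` and
`T_o = g_o(B ·, ·)`. -/
def innerG (g : Metric F (G ⧸ K)) (S T : invTensors F K) : ℝ :=
  LinearMap.trace ℝ F (endo g ((1 : G) : G ⧸ K) (formAt S.1 ((1 : G) : G ⧸ K)) ∘ₗ
    endo g ((1 : G) : G ⧸ K) (formAt T.1 ((1 : G) : G ⧸ K)))

/-- `Ker δ_g ∩ S²(M)^G`: the divergence-free `G`-invariant symmetric 2-tensors. -/
def divFree (g : Metric F (G ⧸ K)) : Submodule ℝ (invTensors F K) where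
  carrier := {T | ∀ (x : G ⧸ K) (w : F), divergence g T.1 x w = 0}
  zero_mem' x w := by simpa using divergence_smul g 0 (0 : Tensor2 F (G ⧸ K)) x w
  add_mem' := by
    intro S T hS hT x w
    exact (divergence_add g S.1 T.1 x w).trans (by rw [hS x w, hT x w, add_zero])
  smul_mem' := by
    intro c T hT x w
    exact (divergence_smul g c T.1 x w).trans (by rw [hT x w, mul_zero])

/-- `Ker tr_g ∩ S²(M)^G`: the traceless `G`-invariant symmetric 2-tensors. -/
def traceless (g : Metric F (G ⧸ K)) : Submodule ℝ (invTensors F K) where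
  carrier := {T | ∀ x : G ⧸ K, trace g x (formAt T.1 x) = 0}
  zero_mem' x := map_zero (trace g x)
  add_mem' := by
    intro S T hS hT x
    exact (map_add (trace g x) (formAt S.1 x) (formAt T.1 x)).trans (by rw [hS x, hT x, add_zero])
  smul_mem' := by
    intro c T hT x
    exact (map_smul (trace g x) c (formAt T.1 x)).trans (by rw [hT x, smul_zero])

/-- `TT_g^G`: the `G`-invariant TT-tensors. -/
def ttTensors (g : Metric F (G ⧸ K)) : Submodule ℝ (invTensors F K) := divFree g ⊓ traceless g

/-- The vector space `V` is the direct sum of the subspaces `W i`, which are pairwise orthogonal with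
respect to `B`. -/
structure IsOrthogonalDirectSum {V : Type*} [AddCommGroup V] [Module ℝ V] (B : V → V → ℝ)
    {n : ℕ} (W : Fin n → Submodule ℝ V) : Prop where
  isInternal : DirectSum.IsInternal W
  orthogonal : ∀ i j, i ≠ j → ∀ S ∈ W i, ∀ T ∈ W j, B S T = 0

end Homogeneous

end HomTT

end

/-! Everything is reduced to linear algebra at `o`. The complement `𝔭` gives a `K`-equivariant
section `σ : T_oM → 𝔤` of the projection (`IsReductive.exists_section`), and invariant symmetric
tensors correspond to isotropy-invariant symmetric forms at `o` (`exists_invTensor`,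
`invTensors_ext`).

Divergence. In a chart around `aK`, invariance of `T` expresses its partial derivatives through the
Jacobians `b` of the vector fields of the action (`partialDeriv_invariant`), and the
antisymmetrisation of `b` is the projected bracket `c` (`actJac_sub`). Hence `∇_u T` is minus the
action on `T` of `Λ u`, where `Λ = Γ + b`, and Koszul's formula writes `Λ` in terms of `g` and `c`
alone. Tracing (`trace_connection`) gives `δ_g T(X) = -tr(A ∘ ad_𝔭 X)` for `T_o = g_o(A ·, ·)`,
provided `tr ad_𝔭 X = 0` on `𝔭`. That condition follows from `tr ad X = 0`, because `ad X` maps `𝔨`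
into `𝔭` (`trace_adF`).

Orthogonality. Since `A` is symmetric, the trace only sees `S(ad_𝔭 X)`. The formula involves every
`X ∈ 𝔭`, whereas `𝒫_g` uses only `𝔭₀`. But `X ↦ tr(A ∘ ad_𝔭 X)` is `K`-invariant, so its metric dual
is an `Ad(K)`-fixed vector, which lies in `𝔭₀` and detects whether the functional vanishes
(`exists_fixed_of_trace_ne_zero`). So `ker δ_g` is the orthogonal complement of `𝒫_g` for a positive
definite form on a finite-dimensional space. As `g` is itself divergence-free and its orthogonal
complement consists of the traceless tensors, the three-term splitting follows.

Existence of the tensors. A vector fixed by `Ad(K)` has an isotropy-equivariant `ad_𝔭`, hence an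
invariant symmetric part. If `K` is connected, commuting with `𝔨` already forces `Ad(K)`-invariance
(`AdE_eq_of_isConnected`).

Compact groups. An `Ad`-invariant inner product makes every `ad X` traceless. For a family `φ_t` of
automorphisms, the velocity of `φ_t(a) a⁻¹` is a cocycle in `a`; averaging it over Haar measure
makes it a coboundary, and exchanging two derivatives shows that `dφ_t` has velocity `ad X` for some
`X` (`IsAutFamily.exists_inner`). The `𝔨`-part of `X` acts skew and contributes nothing, and the
`𝔭`-part lies in `𝔭₀` because `φ_t` preserves `K`. Conversely, an invariant `T` given by `S(ad_𝔭 X)`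
is also given by an `Ad(K)`-fixed vector (`exists_fixed_symmAd`), and conjugation by the
one-parameter subgroup of half that vector commutes with `K` and has velocity `T`. -/

noncomputable section

namespace HomTT

set_option linter.unusedSectionVars false

/-! ### Mixed partial derivatives of functions of two variables -/

section Calculus

variable {A B C : Type*} [NormedAddCommGroup A] [NormedSpace ℝ A] [NormedAddCommGroup B]
  [NormedSpace ℝ B] [NormedAddCommGroup C] [NormedSpace ℝ C]

lemma fderiv_partial_snd {f : A × B → C} {p : A × B} (hf : DifferentiableAt ℝ f p) (v : B) :
    fderiv ℝ (fun b ↦ f (p.1, b)) p.2 v = fderiv ℝ f p (0, v) := by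
  have h : HasFDerivAt (fun b ↦ f (p.1, b)) _ p.2 :=
    HasFDerivAt.comp (f := fun b ↦ (p.1, b)) p.2 hf.hasFDerivAt
    ((hasFDerivAt_const p.1 p.2).prodMk (hasFDerivAt_id p.2))
  rw [h.fderiv]
  simp

lemma fderiv_partial_fst {f : A × B → C} {p : A × B} (hf : DifferentiableAt ℝ f p) (v : A) :
    fderiv ℝ (fun a ↦ f (a, p.2)) p.1 v = fderiv ℝ f p (v, 0) := by
  have h : HasFDerivAt (fun a ↦ f (a, p.2)) _ p.1 :=
    HasFDerivAt.comp (f := fun a ↦ (a, p.2)) p.1 hf.hasFDerivAt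
    ((hasFDerivAt_id p.1).prodMk (hasFDerivAt_const p.2 p.1))
  rw [h.fderiv]
  simp

/-- Smoothness of order `∞` at a point need not persist on a neighbourhood, but each finite order
does; order one suffices here. -/
lemma eventually_differentiableAt {f : A → C} {p : A} (hf : ContDiffAt ℝ ∞ f p) :
    ∀ᶠ x in 𝓝 p, DifferentiableAt ℝ f x := by
  have := (hf.of_le (m := 1) (WithTop.coe_le_coe.2 le_top)).eventually
    (WithTop.coe_injective.ne (by simp : (1 : ℕ∞) ≠ ⊤))
  filter_upwards [this] with x hx
  exact hx.differentiableAt (by simp)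

lemma contDiffAt_fderiv_partial_snd {f : A × B → C} {a : A} {b : B}
    (hf : ContDiffAt ℝ ∞ f (a, b)) :
    ContDiffAt ℝ ∞ (fun x ↦ fderiv ℝ (fun y ↦ f (x, y)) b) a :=
  ContDiffAt.fderiv (f := fun x y ↦ f (x, y)) (g := fun _ ↦ b) (n := ∞) hf contDiffAt_const
    (by simp)

lemma contDiffAt_fderiv_partial_fst {f : A × B → C} {a : A} {b : B}
    (hf : ContDiffAt ℝ ∞ f (a, b)) :
    ContDiffAt ℝ ∞ (fun y ↦ fderiv ℝ (fun x ↦ f (x, y)) a) b :=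
  contDiffAt_fderiv_partial_snd (f := fun p : B × A ↦ f (p.2, p.1)) (a := b) (b := a)
    (ContDiffAt.comp (b, a) (g := f) hf (contDiffAt_snd.prodMk contDiffAt_fst))

/-- Equality of the two mixed partial derivatives of a function of two variables. -/
lemma fderiv_fderiv_partial_comm {f : A × B → C} {a : A} {b : B} (hf : ContDiffAt ℝ ∞ f (a, b))
    (X : A) (Y : B) :
    fderiv ℝ (fun x ↦ fderiv ℝ (fun y ↦ f (x, y)) b) a X Y =
      fderiv ℝ (fun y ↦ fderiv ℝ (fun x ↦ f (x, y)) a) b Y X := by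
  -- Both iterated partials are the second derivative of `f` at the pair `(X, 0)`, `(0, Y)`, in the
  -- two possible orders; the rest is its symmetry.
  have hd : DifferentiableAt ℝ (fderiv ℝ f) (a, b) :=
    (hf.fderiv_right (m := ∞) (by simp)).differentiableAt (by simp)
  have hev := eventually_differentiableAt hf
  have h1 : (fun x ↦ fderiv ℝ (fun y ↦ f (x, y)) b Y) =ᶠ[𝓝 a]
      fun x ↦ fderiv ℝ f (x, b) (0, Y) := by
    have : Tendsto (fun x : A ↦ (x, b)) (𝓝 a) (𝓝 (a, b)) :=
      Continuous.tendsto (by fun_prop) a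
    filter_upwards [this.eventually hev] with x hx
    exact fderiv_partial_snd (p := (x, b)) hx Y
  have h2 : (fun y ↦ fderiv ℝ (fun x ↦ f (x, y)) a X) =ᶠ[𝓝 b]
      fun y ↦ fderiv ℝ f (a, y) (X, 0) := by
    have : Tendsto (fun y : B ↦ (a, y)) (𝓝 b) (𝓝 (a, b)) :=
      Continuous.tendsto (by fun_prop) b
    filter_upwards [this.eventually hev] with y hy
    exact fderiv_partial_fst (p := (a, y)) hy X
  have e1 : fderiv ℝ (fun x ↦ fderiv ℝ (fun y ↦ f (x, y)) b) a X Y =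
      fderiv ℝ (fun x ↦ fderiv ℝ (fun y ↦ f (x, y)) b Y) a X := by
    rw [fderiv_clm_apply ((contDiffAt_fderiv_partial_snd hf).differentiableAt (by simp))
      (differentiableAt_const Y)]
    simp
  have e2 : fderiv ℝ (fun y ↦ fderiv ℝ (fun x ↦ f (x, y)) a) b Y X =
      fderiv ℝ (fun y ↦ fderiv ℝ (fun x ↦ f (x, y)) a X) b Y := by
    rw [fderiv_clm_apply ((contDiffAt_fderiv_partial_fst hf).differentiableAt (by simp))
      (differentiableAt_const X)]
    simp
  have hd1 : HasFDerivAt (fun x ↦ fderiv ℝ f (x, b) (0, Y)) _ a :=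
    (HasFDerivAt.comp (f := fun x ↦ (x, b)) a hd.hasFDerivAt
    ((hasFDerivAt_id a).prodMk (hasFDerivAt_const b a))).clm_apply (hasFDerivAt_const (0, Y) a)
  have hd2 : HasFDerivAt (fun y ↦ fderiv ℝ f (a, y) (X, 0)) _ b :=
    (HasFDerivAt.comp (f := fun y ↦ (a, y)) b hd.hasFDerivAt
    ((hasFDerivAt_const a b).prodMk (hasFDerivAt_id b))).clm_apply (hasFDerivAt_const (X, 0) b)
  rw [e1, e2, h1.fderiv_eq, h2.fderiv_eq, hd1.fderiv, hd2.fderiv]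
  have h2 : minSmoothness ℝ 2 ≤ ∞ := by
    rw [minSmoothness_of_isRCLikeNormedField]
    exact WithTop.coe_le_coe.2 le_top
  simpa using (hf.isSymmSndFDerivAt h2).eq (X, (0 : B)) ((0 : A), Y)

end Calculus

/-! ### Differentials as maps of model spaces -/

section TDeriv

variable {F : Type*} [NormedAddCommGroup F] [NormedSpace ℝ F]
  {F' : Type*} [NormedAddCommGroup F'] [NormedSpace ℝ F']
  {F'' : Type*} [NormedAddCommGroup F''] [NormedSpace ℝ F'']
  {M : Type*} [TopologicalSpace M] [ChartedSpace F M]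
  {M' : Type*} [TopologicalSpace M'] [ChartedSpace F' M']
  {M'' : Type*} [TopologicalSpace M''] [ChartedSpace F'' M'']

/-- The differential of a map between manifolds, as a map between the model spaces. -/
def tderiv (f : M → M') (x : M) : F →L[ℝ] F' := mfderiv 𝓘(ℝ, F) 𝓘(ℝ, F') f x

/-- The intermediate point is a variable with an equation, so that points equal only
propositionally, such as `a * 1` and `a`, cause no transport between tangent spaces. -/
lemma tderiv_comp {g : M' → M''} {f : M → M'} {x : M} {y : M'} (hy : f x = y)
    (hg : MDifferentiableAt 𝓘(ℝ, F') 𝓘(ℝ, F'') g y)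
    (hf : MDifferentiableAt 𝓘(ℝ, F) 𝓘(ℝ, F') f x) :
    tderiv (F := F) (F' := F'') (fun z ↦ g (f z)) x =
      (tderiv (F := F') (F' := F'') g y).comp (tderiv f x) := by
  subst hy
  exact mfderiv_comp x hg hf

lemma tderiv_id (x : M) : tderiv (F := F) (F' := F) (fun y : M ↦ y) x = .id ℝ F :=
  mfderiv_id

lemma tderiv_const (x : M) (c : M') : tderiv (F := F) (F' := F') (fun _ : M ↦ c) x = 0 :=
  mfderiv_const

lemma tderiv_congr {f g : M → M'} {x : M} (h : f =ᶠ[𝓝 x] g) :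
    tderiv (F := F) (F' := F') f x = tderiv g x :=
  h.mfderiv_eq

lemma tderiv_eq_fderiv (f : F → F') (x : F) : tderiv (F := F) (F' := F') f x = fderiv ℝ f x :=
  mfderiv_eq_fderiv

lemma tderiv_eq_fderiv_chart {f : M → M'} {x : M} {y : M'} (hy : f x = y)
    (hf : MDifferentiableAt 𝓘(ℝ, F) 𝓘(ℝ, F') f x) :
    tderiv (F := F) (F' := F') f x =
      fderiv ℝ (fun z ↦ extChartAt 𝓘(ℝ, F') y (f ((extChartAt 𝓘(ℝ, F) x).symm z)))
        (extChartAt 𝓘(ℝ, F) x x) := by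
  subst hy
  have h : tderiv (F := F) (F' := F') f x = fderivWithin ℝ
      (fun z ↦ extChartAt 𝓘(ℝ, F') (f x) (f ((extChartAt 𝓘(ℝ, F) x).symm z)))
        (range 𝓘(ℝ, F)) (extChartAt 𝓘(ℝ, F) x x) := if_pos hf
  rw [h]
  simp only [modelWithCornersSelf_coe, range_id, fderivWithin_univ]

lemma contMDiffAt_chart [IsManifold 𝓘(ℝ, F) ∞ M] (x : M) :
    ContMDiffAt 𝓘(ℝ, F) 𝓘(ℝ, F) ∞ (extChartAt 𝓘(ℝ, F) x) x :=
  contMDiffAt_extChartAt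

lemma contMDiffAt_chart_symm [IsManifold 𝓘(ℝ, F) ∞ M] (x : M) :
    ContMDiffAt 𝓘(ℝ, F) 𝓘(ℝ, F) ∞ (extChartAt 𝓘(ℝ, F) x).symm (extChartAt 𝓘(ℝ, F) x x) :=
  (contMDiffOn_extChartAt_symm x).contMDiffAt (extChartAt_target_mem_nhds x)

lemma tderiv_chart [IsManifold 𝓘(ℝ, F) ∞ M] (x : M) :
    tderiv (F := F) (F' := F) (extChartAt 𝓘(ℝ, F) x) x = .id ℝ F := by
  have : IsManifold 𝓘(ℝ, F) 1 M := IsManifold.of_le (n := ∞) (by simp)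
  exact mfderiv_extChartAt_self

lemma tderiv_chart_symm [IsManifold 𝓘(ℝ, F) ∞ M] (x : M) :
    tderiv (F := F) (F' := F) (extChartAt 𝓘(ℝ, F) x).symm (extChartAt 𝓘(ℝ, F) x x) =
      .id ℝ F := by
  have : IsManifold 𝓘(ℝ, F) 1 M := IsManifold.of_le (n := ∞) (by simp)
  have := mfderivWithin_range_extChartAt_symm (I := 𝓘(ℝ, F)) (x := x)
  simp only [modelWithCornersSelf_coe, range_id, mfderivWithin_univ] at this
  exact this

lemma chart_symm_chart (x : M) :
    (extChartAt 𝓘(ℝ, F) x).symm (extChartAt 𝓘(ℝ, F) x x) = x := extChartAt_to_inv x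

end TDeriv

/-! ### The Lie bracket in the chart around the identity -/

section LieGroup

variable {E : Type*} [NormedAddCommGroup E] [NormedSpace ℝ E]
  {G : Type*} [Group G] [TopologicalSpace G] [ChartedSpace E G]

variable (E G) in
/-- Multiplication of `G` in the preferred chart around `1`. -/
def locMul (p : E × E) : E :=
  extChartAt 𝓘(ℝ, E) (1 : G)
    ((extChartAt 𝓘(ℝ, E) (1 : G)).symm p.1 * (extChartAt 𝓘(ℝ, E) (1 : G)).symm p.2)

variable (E G) in
/-- The coordinates of `1` in the preferred chart around `1`. -/
def locOne : E := extChartAt 𝓘(ℝ, E) (1 : G) 1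

/-- The left-invariant vector field of `X`, in the preferred chart around `1`. -/
def locField (X : E) (s : E) : E := fderiv ℝ (fun t ↦ locMul E G (s, t)) (locOne E G) X

lemma symm_locOne : (extChartAt 𝓘(ℝ, E) (1 : G)).symm (locOne E G) = 1 := chart_symm_chart 1

lemma locOne_mem_nhds : (extChartAt 𝓘(ℝ, E) (1 : G)).target ∈ 𝓝 (locOne E G) :=
  extChartAt_target_mem_nhds 1

lemma locMul_one_right {s : E} (hs : s ∈ (extChartAt 𝓘(ℝ, E) (1 : G)).target) :
    locMul E G (s, locOne E G) = s := by
  simp only [locMul, symm_locOne, mul_one]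
  exact (extChartAt 𝓘(ℝ, E) (1 : G)).right_inv hs

lemma locMul_one_left {s : E} (hs : s ∈ (extChartAt 𝓘(ℝ, E) (1 : G)).target) :
    locMul E G (locOne E G, s) = s := by
  simp only [locMul, symm_locOne, one_mul]
  exact (extChartAt 𝓘(ℝ, E) (1 : G)).right_inv hs

lemma fderiv_locMul_snd : fderiv ℝ (fun t ↦ locMul E G (locOne E G, t)) (locOne E G) = .id ℝ E := by
  have : (fun t ↦ locMul E G (locOne E G, t)) =ᶠ[𝓝 (locOne E G)] fun t ↦ t := by
    filter_upwards [locOne_mem_nhds] with t ht using locMul_one_left ht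
  rw [this.fderiv_eq, fderiv_fun_id]

lemma fderiv_locMul_fst : fderiv ℝ (fun t ↦ locMul E G (t, locOne E G)) (locOne E G) = .id ℝ E := by
  have : (fun t ↦ locMul E G (t, locOne E G)) =ᶠ[𝓝 (locOne E G)] fun t ↦ t := by
    filter_upwards [locOne_mem_nhds] with t ht using locMul_one_right ht
  rw [this.fderiv_eq, fderiv_fun_id]

lemma locField_one (X : E) : locField (E := E) (G := G) X (locOne E G) = X := by
  rw [locField, fderiv_locMul_snd]; rfl

variable [LieGroup 𝓘(ℝ, E) ∞ G]

lemma contMDiffAt_symm_locOne :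
    ContMDiffAt 𝓘(ℝ, E) 𝓘(ℝ, E) ∞ (extChartAt 𝓘(ℝ, E) (1 : G)).symm (locOne E G) :=
  contMDiffAt_chart_symm 1

lemma contMDiffAt_mul_chart :
    ContMDiffAt 𝓘(ℝ, E × E) 𝓘(ℝ, E) ∞ (fun p : E × E ↦
      (extChartAt 𝓘(ℝ, E) (1 : G)).symm p.1 * (extChartAt 𝓘(ℝ, E) (1 : G)).symm p.2)
      (locOne E G, locOne E G) := by
  refine ContMDiffAt.mul (ContMDiffAt.comp _ ?_ contDiffAt_fst.contMDiffAt)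
    (ContMDiffAt.comp _ ?_ contDiffAt_snd.contMDiffAt) <;> exact contMDiffAt_symm_locOne

lemma contDiffAt_locMul : ContDiffAt ℝ ∞ (locMul E G) (locOne E G, locOne E G) := by
  have h := contMDiffAt_mul_chart (E := E) (G := G)
  refine (ContMDiffAt.comp_of_eq (g := extChartAt 𝓘(ℝ, E) (1 : G))
    (contMDiffAt_chart 1) h ?_).contDiffAt
  change (extChartAt 𝓘(ℝ, E) (1 : G)).symm (locOne E G) *
    (extChartAt 𝓘(ℝ, E) (1 : G)).symm (locOne E G) = 1
  rw [symm_locOne, one_mul]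

lemma eventually_symm_locMul : ∀ᶠ p in 𝓝 (locOne E G, locOne E G),
    (extChartAt 𝓘(ℝ, E) (1 : G)).symm (locMul E G p) =
      (extChartAt 𝓘(ℝ, E) (1 : G)).symm p.1 * (extChartAt 𝓘(ℝ, E) (1 : G)).symm p.2 := by
  have h := (contMDiffAt_mul_chart (E := E) (G := G)).continuousAt
  have h1 : (extChartAt 𝓘(ℝ, E) (1 : G)).source ∈ 𝓝 ((extChartAt 𝓘(ℝ, E) (1 : G)).symm
    (locOne E G) * (extChartAt 𝓘(ℝ, E) (1 : G)).symm (locOne E G)) := by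
    rw [symm_locOne, one_mul]
    exact extChartAt_source_mem_nhds 1
  filter_upwards [h h1] with p hp
  exact (extChartAt 𝓘(ℝ, E) (1 : G)).left_inv hp

lemma contDiffAt_locField (X : E) : ContDiffAt ℝ ∞ (locField (E := E) (G := G) X) (locOne E G) :=
  (contDiffAt_fderiv_partial_snd contDiffAt_locMul).clm_apply contDiffAt_const

lemma mdifferentiableAt_mul_left (a b : G) :
    MDifferentiableAt 𝓘(ℝ, E) 𝓘(ℝ, E) (fun x : G ↦ a * x) b :=
  (contMDiff_mul_left (I := 𝓘(ℝ, E)) (n := ∞) (a := a)).mdifferentiable (by simp) b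

/-- Differentiate `φ⁻¹(m(s, t)) = φ⁻¹(s) φ⁻¹(t)` in `t` at the identity, with `m` the multiplication
in the chart `φ`. This identifies `locField` with the coordinate form of a left-invariant field. -/
lemma eventually_tderiv_symm_locField : ∀ᶠ s in 𝓝 (locOne E G), ∀ X : E,
    tderiv (F := E) (F' := E) (extChartAt 𝓘(ℝ, E) (1 : G)).symm s (locField (E := E) (G := G) X s) =
      tderiv (F := E) (F' := E) (fun b : G ↦ (extChartAt 𝓘(ℝ, E) (1 : G)).symm s * b) 1 X := by
  have hd : ∀ᶠ s in 𝓝 (locOne E G), DifferentiableAt ℝ (locMul E G) (s, locOne E G) :=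
    (Continuous.tendsto (f := fun s : E ↦ (s, locOne E G)) (by fun_prop) (locOne E G)).eventually
      (eventually_differentiableAt contDiffAt_locMul)
  filter_upwards [eventually_symm_locMul.curry_nhds, hd, locOne_mem_nhds] with s hs hd hst X
  have h1 := tderiv_congr (F := E) (F' := E) hs
  rw [tderiv_comp (F := E) (F' := E) (F'' := E) (g := (extChartAt 𝓘(ℝ, E) (1 : G)).symm)
    (f := fun t ↦ locMul E G (s, t)) (locMul_one_right hst),
    tderiv_comp (F := E) (F' := E) (F'' := E) (g := fun b ↦ (extChartAt 𝓘(ℝ, E) (1 : G)).symm s * b)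
    symm_locOne] at h1
  · have h2 := congrArg (fun L : E →L[ℝ] E ↦ L X) h1
    simp only [ContinuousLinearMap.comp_apply] at h2
    rw [locOne, tderiv_chart_symm (F := E) (1 : G)] at h2
    rw [locField, ← tderiv_eq_fderiv]
    exact h2
  · exact mdifferentiableAt_mul_left _ _
  · exact (contMDiffAt_symm_locOne (E := E) (G := G)).mdifferentiableAt (by simp)
  · exact (((contMDiffOn_extChartAt_symm (n := ∞) (1 : G)).contMDiffAt
      ((isOpen_extChartAt_target _).mem_nhds hst))).mdifferentiableAt (by simp)
  · exact (DifferentiableAt.comp (f := fun t ↦ (s, t)) (locOne E G) hd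
      ((differentiableAt_const s).prodMk differentiableAt_id)).mdifferentiableAt

variable (G) in
/-- The pullback of the left-invariant vector field of `X` under the inverse of the preferred chart
around `1`. -/
def chartField (X : E) : E → E :=
  VectorField.mpullbackWithin 𝓘(ℝ, E) 𝓘(ℝ, E) (extChartAt 𝓘(ℝ, E) (1 : G)).symm
      (mulInvariantVectorField (I := 𝓘(ℝ, E)) (G := G) X) (range 𝓘(ℝ, E))

/-- The differential of the inverse chart is invertible, so a pulled-back field is determined by its
push-forward, which is computed in `eventually_tderiv_symm_locField`. -/
lemma chartField_eventuallyEq (X : E) :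
    chartField G X =ᶠ[𝓝 (locOne E G)] locField (E := E) (G := G) X := by
  filter_upwards [eventually_tderiv_symm_locField (E := E) (G := G), locOne_mem_nhds] with s hs hst
  have : IsManifold 𝓘(ℝ, E) 1 G := IsManifold.of_le (n := ∞) (by simp)
  have hi := isInvertible_mfderivWithin_extChartAt_symm (I := 𝓘(ℝ, E)) hst
  rw [chartField, VectorField.mpullbackWithin_apply]
  have h1 : mfderivWithin 𝓘(ℝ, E) 𝓘(ℝ, E) (extChartAt 𝓘(ℝ, E) (1 : G)).symm (range 𝓘(ℝ, E)) s
      (locField (E := E) (G := G) X s) = mulInvariantVectorField (I := 𝓘(ℝ, E)) (G := G) X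
        ((extChartAt 𝓘(ℝ, E) (1 : G)).symm s) := by
    simp only [modelWithCornersSelf_coe, range_id, mfderivWithin_univ]
    exact hs X
  rw [← h1]
  obtain ⟨e, he⟩ := hi
  rw [← he]
  exact (congrArg (fun L : _ →L[ℝ] _ ↦ L (e (locField (E := E) (G := G) X s)))
    (ContinuousLinearMap.inverse_equiv e)).trans (e.symm_apply_apply _)

variable (G) in
/-- The bracket of the Lie algebra of `G`, on the model space. -/
def lieB (X Y : E) : E :=
  Bracket.bracket (L := GroupLieAlgebra 𝓘(ℝ, E) G) (M := GroupLieAlgebra 𝓘(ℝ, E) G) X Y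

/-- The bracket at `1` is by definition the flat bracket of the fields pulled back to the chart, and
the differential of the chart at its centre is the identity. -/
lemma lieB_eq (X Y : E) : lieB G X Y =
      fderiv ℝ (locField (E := E) (G := G) Y) (locOne E G) X
        - fderiv ℝ (locField (E := E) (G := G) X) (locOne E G) Y := by
  have e : lieB G X Y =
      (tderiv (F := E) (F' := E) (extChartAt 𝓘(ℝ, E) (1 : G)) 1).inverse
        (VectorField.lieBracketWithin ℝ (chartField G X) (chartField G Y)
          ((extChartAt 𝓘(ℝ, E) (1 : G)).symm ⁻¹' univ ∩ range 𝓘(ℝ, E)) (locOne E G)) := rfl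
  rw [e, tderiv_chart, ContinuousLinearMap.inverse_id]
  have hr : (extChartAt 𝓘(ℝ, E) (1 : G)).symm ⁻¹' univ ∩ range 𝓘(ℝ, E) = univ := by simp
  rw [hr, VectorField.lieBracketWithin_univ]
  refine (Filter.EventuallyEq.lieBracket_vectorField_eq (𝕜 := ℝ) (chartField_eventuallyEq X)
    (chartField_eventuallyEq Y)).trans ?_
  rw [VectorField.lieBracket, locField_one, locField_one]

end LieGroup

/-! ### The adjoint representation and its derivative -/

section Ad

variable {E : Type*} [NormedAddCommGroup E] [NormedSpace ℝ E]
  {G : Type*} [Group G] [TopologicalSpace G] [ChartedSpace E G]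

/-- The adjoint representation, on the model space. -/
def AdE (a : G) : E →L[ℝ] E := tderiv (F := E) (F' := E) (fun b : G ↦ a * b * a⁻¹) 1

lemma AdE_one : AdE (E := E) (1 : G) = .id ℝ E := by
  simp only [AdE, one_mul, inv_one, mul_one]
  exact tderiv_id 1

variable (E G) in
/-- Conjugation `(s, t) ↦ s t s⁻¹` in the preferred chart around `1`. -/
def locConj (p : E × E) : E :=
  extChartAt 𝓘(ℝ, E) (1 : G)
    ((extChartAt 𝓘(ℝ, E) (1 : G)).symm p.1 * (extChartAt 𝓘(ℝ, E) (1 : G)).symm p.2 *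
      ((extChartAt 𝓘(ℝ, E) (1 : G)).symm p.1)⁻¹)

lemma locConj_one_right (s : E) : locConj E G (s, locOne E G) = locOne E G := by
  simp only [locConj, symm_locOne, mul_one, mul_inv_cancel]
  rfl

variable [LieGroup 𝓘(ℝ, E) ∞ G]

lemma mdifferentiableAt_conj (a b : G) :
    MDifferentiableAt 𝓘(ℝ, E) 𝓘(ℝ, E) (fun x : G ↦ a * x * a⁻¹) b :=
  (((contMDiff_mul_right (I := 𝓘(ℝ, E)) (n := ∞) (a := a⁻¹)).comp
    (contMDiff_mul_left (I := 𝓘(ℝ, E)) (n := ∞) (a := a))).mdifferentiable (by simp)) b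

lemma AdE_mul (a b : G) : AdE (E := E) (a * b) = (AdE a).comp (AdE b) := by
  have h : (fun x : G ↦ a * b * x * (a * b)⁻¹) = fun x ↦ a * (b * x * b⁻¹) * a⁻¹ := by
    funext x; group
  rw [AdE, h, tderiv_comp (F := E) (F' := E) (F'' := E) (g := fun x : G ↦ a * x * a⁻¹)
    (f := fun x : G ↦ b * x * b⁻¹) (y := 1) (by group) (mdifferentiableAt_conj _ _)
    (mdifferentiableAt_conj _ _)]
  rfl

lemma AdE_inv_apply_apply (a : G) (X : E) : AdE a⁻¹ (AdE a X) = X := by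
  rw [← ContinuousLinearMap.comp_apply, ← AdE_mul, inv_mul_cancel, AdE_one]; rfl

lemma AdE_apply_inv_apply (a : G) (X : E) : AdE a (AdE a⁻¹ X) = X := by
  rw [← ContinuousLinearMap.comp_apply, ← AdE_mul, mul_inv_cancel, AdE_one]; rfl

lemma contMDiffAt_conj_chart :
    ContMDiffAt 𝓘(ℝ, E × E) 𝓘(ℝ, E) ∞ (fun p : E × E ↦
      (extChartAt 𝓘(ℝ, E) (1 : G)).symm p.1 * (extChartAt 𝓘(ℝ, E) (1 : G)).symm p.2 *
      ((extChartAt 𝓘(ℝ, E) (1 : G)).symm p.1)⁻¹)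
      (locOne E G, locOne E G) := by
  refine contMDiffAt_mul_chart.mul (ContMDiffAt.inv ?_)
  exact (ContMDiffAt.comp _ contMDiffAt_symm_locOne contDiffAt_fst.contMDiffAt)

lemma contDiffAt_locConj : ContDiffAt ℝ ∞ (locConj E G) (locOne E G, locOne E G) := by
  have h := contMDiffAt_conj_chart (E := E) (G := G)
  refine (ContMDiffAt.comp_of_eq (g := extChartAt 𝓘(ℝ, E) (1 : G)) (contMDiffAt_chart 1) h
    ?_).contDiffAt
  change (extChartAt 𝓘(ℝ, E) (1 : G)).symm (locOne E G) *
    (extChartAt 𝓘(ℝ, E) (1 : G)).symm (locOne E G) *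
    ((extChartAt 𝓘(ℝ, E) (1 : G)).symm (locOne E G))⁻¹ = 1
  simp only [symm_locOne, one_mul, inv_one]

lemma eventually_symm_locConj : ∀ᶠ p in 𝓝 (locOne E G, locOne E G),
    (extChartAt 𝓘(ℝ, E) (1 : G)).symm (locConj E G p) =
      (extChartAt 𝓘(ℝ, E) (1 : G)).symm p.1 * (extChartAt 𝓘(ℝ, E) (1 : G)).symm p.2 *
      ((extChartAt 𝓘(ℝ, E) (1 : G)).symm p.1)⁻¹ := by
  have h := (contMDiffAt_conj_chart (E := E) (G := G)).continuousAt
  have h1 : (extChartAt 𝓘(ℝ, E) (1 : G)).source ∈ 𝓝 ((extChartAt 𝓘(ℝ, E) (1 : G)).symm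
    (locOne E G) * (extChartAt 𝓘(ℝ, E) (1 : G)).symm (locOne E G) *
    ((extChartAt 𝓘(ℝ, E) (1 : G)).symm (locOne E G))⁻¹) := by
    simp only [symm_locOne, one_mul, inv_one]
    exact extChartAt_source_mem_nhds 1
  filter_upwards [h h1] with p hp
  exact (extChartAt 𝓘(ℝ, E) (1 : G)).left_inv hp

lemma AdE_symm_eq_fderiv (s : E) :
    AdE (E := E) ((extChartAt 𝓘(ℝ, E) (1 : G)).symm s) =
      fderiv ℝ (fun t ↦ locConj E G (s, t)) (locOne E G) :=
  tderiv_eq_fderiv_chart (F := E) (F' := E) (by group) (mdifferentiableAt_conj _ _)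

lemma contDiffAt_AdE :
    ContDiffAt ℝ ∞ (fun s ↦ AdE (E := E) ((extChartAt 𝓘(ℝ, E) (1 : G)).symm s)) (locOne E G) := by
  simp only [AdE_symm_eq_fderiv]
  exact contDiffAt_fderiv_partial_snd contDiffAt_locConj

/-- This is `(s t s⁻¹) s = s t`; its derivative in `t` compares `Ad(s)` with left-invariant fields.
-/
lemma eventually_locMul_locConj : ∀ᶠ p in 𝓝 (locOne E G, locOne E G),
    locMul E G (locConj E G p, p.1) = locMul E G p := by
  filter_upwards [eventually_symm_locConj] with p hp
  simp only [locMul, hp, inv_mul_cancel_right]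

/-- The differential of `s ↦ s t` at `1` takes `Ad(s) Y` to the value at `s` of the left-invariant
field of `Y`. -/
lemma eventually_fderiv_locMul_AdE : ∀ᶠ s in 𝓝 (locOne E G), ∀ Y : E,
    fderiv ℝ (fun t ↦ locMul E G (t, s)) (locOne E G)
      (AdE ((extChartAt 𝓘(ℝ, E) (1 : G)).symm s) Y) = locField (G := G) Y s := by
  have hd1 : ∀ᶠ s in 𝓝 (locOne E G), DifferentiableAt ℝ (locConj E G) (s, locOne E G) :=
    (Continuous.tendsto (f := fun s : E ↦ (s, locOne E G)) (by fun_prop) (locOne E G)).eventually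
      (eventually_differentiableAt contDiffAt_locConj)
  have hd2 : ∀ᶠ s in 𝓝 (locOne E G), DifferentiableAt ℝ (locMul E G) (locOne E G, s) :=
    (Continuous.tendsto (f := fun s : E ↦ (locOne E G, s)) (by fun_prop) (locOne E G)).eventually
      (eventually_differentiableAt contDiffAt_locMul)
  filter_upwards [eventually_locMul_locConj.curry_nhds, hd1, hd2] with s hs hd1 hd2 Y
  rw [AdE_symm_eq_fderiv, locField, ← Filter.EventuallyEq.fderiv_eq hs]
  have hc : HasFDerivAt (fun t ↦ locConj E G (s, t)) _ (locOne E G) :=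
    (DifferentiableAt.comp (f := fun t ↦ (s, t)) (locOne E G) hd1
      ((differentiableAt_const s).prodMk differentiableAt_id)).hasFDerivAt
  have hm : HasFDerivAt (fun t ↦ locMul E G (t, s)) _ (locConj E G (s, locOne E G)) :=
    DifferentiableAt.hasFDerivAt (by
      rw [locConj_one_right]
      exact DifferentiableAt.comp (f := fun t ↦ (t, s)) (locOne E G) hd2
        (differentiableAt_id.prodMk (differentiableAt_const s)))
  have h := (HasFDerivAt.comp (locOne E G) hm hc).fderiv
  rw [locConj_one_right] at h
  exact (congrArg (fun L : E →L[ℝ] E ↦ L Y) h).symm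

/-- The derivative of `Ad` at `1` is `ad`. Differentiate in `s` the identity of
`eventually_fderiv_locMul_AdE`. Besides the derivative of `Ad`, the product rule produces a mixed
second derivative of the multiplication; by symmetry of mixed partials it equals the derivative of
the field of `X` along `Y`, the subtracted term of the bracket. -/
lemma fderiv_AdE_symm (X Y : E) :
    fderiv ℝ (fun s ↦ AdE ((extChartAt 𝓘(ℝ, E) (1 : G)).symm s) Y) (locOne E G) X =
      lieB G X Y := by
  have hA : HasFDerivAt (fun s ↦ AdE ((extChartAt 𝓘(ℝ, E) (1 : G)).symm s) Y) _ (locOne E G) :=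
    ((contDiffAt_AdE (E := E) (G := G)).clm_apply
      (contDiffAt_const (c := Y))).differentiableAt (by simp) |>.hasFDerivAt
  have hR := ((contDiffAt_fderiv_partial_fst (contDiffAt_locMul (E := E) (G := G))).differentiableAt
    (by simp)).hasFDerivAt
  have h1 := (hR.clm_apply hA).fderiv
  have h2 : (fun s ↦ fderiv ℝ (fun t ↦ locMul E G (t, s)) (locOne E G)
      (AdE ((extChartAt 𝓘(ℝ, E) (1 : G)).symm s) Y)) =ᶠ[𝓝 (locOne E G)] locField (G := G) Y := by
    filter_upwards [eventually_fderiv_locMul_AdE (E := E) (G := G)] with s hs using hs Y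
  rw [h2.fderiv_eq] at h1
  have h3 := congrArg (fun L : E →L[ℝ] E ↦ L X) h1
  simp only [add_apply, ContinuousLinearMap.comp_apply, fderiv_locMul_fst,
    ContinuousLinearMap.flip_apply, symm_locOne, AdE_one, ContinuousLinearMap.id_apply] at h3
  rw [lieB_eq, h3, ← fderiv_fderiv_partial_comm contDiffAt_locMul]
  have h4 : fderiv ℝ (locField (E := E) (G := G) X) (locOne E G) Y =
      fderiv ℝ (fun s ↦ fderiv ℝ (fun t ↦ locMul E G (s, t)) (locOne E G)) (locOne E G) Y X := by
    have := (((contDiffAt_fderiv_partial_snd (contDiffAt_locMul (E := E)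
      (G := G))).differentiableAt (by simp)).hasFDerivAt.clm_apply
        (hasFDerivAt_const X (locOne E G))).fderiv
    have := congrArg (fun L : E →L[ℝ] E ↦ L Y) this
    simpa using! this
  rw [h4]
  abel

/-- The derivative of `Ad(r(w)) Y` at a point `w` with `r(w) = 1`. -/
lemma hasFDerivAt_AdE_comp {W : Type*} [NormedAddCommGroup W] [NormedSpace ℝ W] {r : W → G} {w : W}
    (hr : MDifferentiableAt 𝓘(ℝ, W) 𝓘(ℝ, E) r w) (h1 : r w = 1) (Y : E) :
    ∃ L : W →L[ℝ] E, HasFDerivAt (fun z ↦ AdE (r z) Y) L w ∧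
      ∀ v, L v = lieB G (tderiv (F := W) (F' := E) r w v) Y := by
  have hA : HasFDerivAt (fun s ↦ AdE ((extChartAt 𝓘(ℝ, E) (1 : G)).symm s) Y) _
      (extChartAt 𝓘(ℝ, E) (1 : G) (r w)) :=
    DifferentiableAt.hasFDerivAt (by
      rw [h1]
      exact ((contDiffAt_AdE (E := E) (G := G)).clm_apply
        (contDiffAt_const (c := Y))).differentiableAt (by simp))
  have hc : MDifferentiableAt 𝓘(ℝ, E) 𝓘(ℝ, E) (extChartAt 𝓘(ℝ, E) (1 : G)) 1 :=
    (contMDiffAt_chart (1 : G)).mdifferentiableAt (by simp)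
  have hr' : HasFDerivAt (fun z ↦ extChartAt 𝓘(ℝ, E) (1 : G) (r z))
      (tderiv (F := W) (F' := E) r w) w := by
    have hd : DifferentiableAt ℝ (fun z ↦ extChartAt 𝓘(ℝ, E) (1 : G) (r z)) w :=
      (MDifferentiableAt.comp_of_eq (g := extChartAt 𝓘(ℝ, E) (1 : G)) _ hc hr h1).differentiableAt
    convert hd.hasFDerivAt using 1
    rw [← tderiv_eq_fderiv, tderiv_comp (F := W) (F' := E) (F'' := E) h1 hc hr, tderiv_chart]
    rfl
  have h := HasFDerivAt.comp w hA hr'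
  refine ⟨_, h.congr_of_eventuallyEq ?_, fun v ↦ ?_⟩
  · have hs : (extChartAt 𝓘(ℝ, E) (1 : G)).source ∈ 𝓝 (r w) := by
      rw [h1]; exact extChartAt_source_mem_nhds 1
    filter_upwards [hr.continuousAt hs] with z hz
    simp only [Function.comp_apply]
    rw [(extChartAt 𝓘(ℝ, E) (1 : G)).left_inv hz]
  · rw [ContinuousLinearMap.comp_apply, h1]
    exact fderiv_AdE_symm _ _

end Ad

/-! ### One-parameter subgroups -/

section OneParam

variable {E : Type*} [NormedAddCommGroup E] [NormedSpace ℝ E]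
  {G : Type*} [Group G] [TopologicalSpace G] [ChartedSpace E G]

lemma smulRight_one_apply (v : E) : ((1 : ℝ →L[ℝ] ℝ).smulRight v : ℝ →L[ℝ] E) 1 = v := by simp

lemma isMIntegralCurveOn_of_tderiv {γ : ℝ → G} {v : (x : G) → TangentSpace 𝓘(ℝ, E) x} {s : Set ℝ}
    (h : ∀ t ∈ s, MDifferentiableAt 𝓘(ℝ, ℝ) 𝓘(ℝ, E) γ t)
    (h' : ∀ t ∈ s, tderiv (F := ℝ) (F' := E) γ t 1 = v (γ t)) : IsMIntegralCurveOn γ v s := by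
  intro t ht
  have h1 := (h t ht).hasMFDerivAt
  have h2 : mfderiv 𝓘(ℝ, ℝ) 𝓘(ℝ, E) γ t = (1 : ℝ →L[ℝ] ℝ).smulRight (v (γ t)) := by
    have : tderiv (F := ℝ) (F' := E) γ t = (1 : ℝ →L[ℝ] ℝ).smulRight (v (γ t) : E) := by
      ext
      exact (h' t ht).trans (smulRight_one_apply _).symm
    exact this
  exact (h2 ▸ h1).hasMFDerivWithinAt

variable [LieGroup 𝓘(ℝ, E) ∞ G]

/-- A topological group with closed points is Hausdorff, which global uniqueness of integral curves
requires. -/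
lemma t2Space_of_lieGroup (E : Type*) [NormedAddCommGroup E] [NormedSpace ℝ E]
    (G : Type*) [Group G] [TopologicalSpace G] [ChartedSpace E G] [LieGroup 𝓘(ℝ, E) ∞ G] :
    T2Space G := by
  have := topologicalGroup_of_lieGroup 𝓘(ℝ, E) ∞ (G := G)
  have := (𝓘(ℝ, E)).t1Space G
  infer_instance

/-- Smoothness on the whole chart domain, not only at the identity, is what makes solutions smooth
along an interval. -/
lemma contDiffAt_locField_of_mem (X : E) {s : E} (hs : s ∈ (extChartAt 𝓘(ℝ, E) (1 : G)).target) :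
    ContDiffAt ℝ ∞ (locField (E := E) (G := G) X) s := by
  have h0 : ∀ r ∈ (extChartAt 𝓘(ℝ, E) (1 : G)).target,
      ContMDiffAt 𝓘(ℝ, E) 𝓘(ℝ, E) ∞ (extChartAt 𝓘(ℝ, E) (1 : G)).symm r := fun r hr ↦
    (contMDiffOn_extChartAt_symm (1 : G)).contMDiffAt ((isOpen_extChartAt_target _).mem_nhds hr)
  have h1 : ContMDiffAt 𝓘(ℝ, E × E) 𝓘(ℝ, E) ∞ (fun p : E × E ↦
      (extChartAt 𝓘(ℝ, E) (1 : G)).symm p.1 * (extChartAt 𝓘(ℝ, E) (1 : G)).symm p.2)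
      (s, locOne E G) := by
    refine ContMDiffAt.mul (ContMDiffAt.comp _ ?_ contDiffAt_fst.contMDiffAt)
      (ContMDiffAt.comp _ ?_ contDiffAt_snd.contMDiffAt)
    · exact h0 s hs
    · exact contMDiffAt_symm_locOne
  have h2 : ContDiffAt ℝ ∞ (locMul E G) (s, locOne E G) := by
    refine (ContMDiffAt.comp_of_eq (g := extChartAt 𝓘(ℝ, E) (1 : G))
      (y := (extChartAt 𝓘(ℝ, E) (1 : G)).symm s) ?_ h1 ?_).contDiffAt
    · refine contMDiffAt_extChartAt' ?_
      have := (extChartAt 𝓘(ℝ, E) (1 : G)).map_target hs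
      rwa [extChartAt_source] at this
    · simp only [symm_locOne, mul_one]
  exact (contDiffAt_fderiv_partial_snd h2).clm_apply contDiffAt_const

lemma contMDiff_invField (X : GroupLieAlgebra 𝓘(ℝ, E) G) :
    ContMDiff 𝓘(ℝ, E) 𝓘(ℝ, E).tangent 1
      (fun g : G ↦ (⟨g, mulInvariantVectorField X g⟩ : TangentBundle 𝓘(ℝ, E) G)) := by
  refine (contMDiff_mulInvariantVectorField (I := 𝓘(ℝ, E)) X).of_le ?_
  rw [minSmoothness_of_isRCLikeNormedField]
  exact one_le_two

lemma tderiv_mul_left_mulInvariantVectorField (b a : G) (X : E) :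
    tderiv (F := E) (F' := E) (fun x : G ↦ b * x) a
      (mulInvariantVectorField (I := 𝓘(ℝ, E)) (G := G) X a) =
      mulInvariantVectorField (I := 𝓘(ℝ, E)) (G := G) X (b * a) := by
  have h : (fun x : G ↦ b * a * x) = fun x ↦ b * (a * x) := by funext x; group
  have h1 := tderiv_comp (F := E) (F' := E) (F'' := E) (g := fun x : G ↦ b * x)
    (f := fun x : G ↦ a * x) (x := 1) (mul_one a) (mdifferentiableAt_mul_left b _)
    (mdifferentiableAt_mul_left a _)
  rw [← h] at h1
  exact (congrArg (fun L : E →L[ℝ] E ↦ L X) h1).symm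

/-- Left translates of one local integral curve through `1` give integral curves through all points
with a common lifetime, whence completeness of the field. -/
lemma IsMIntegralCurveOn.mul_left {γ : ℝ → G} {X : E} {s : Set ℝ} (hs : IsOpen s)
    (h : IsMIntegralCurveOn γ (mulInvariantVectorField (I := 𝓘(ℝ, E)) (G := G) X) s) (b : G) :
    IsMIntegralCurveOn (fun t ↦ b * γ t) (mulInvariantVectorField (I := 𝓘(ℝ, E)) (G := G) X) s := by
  have hd : ∀ t ∈ s, HasMFDerivAt 𝓘(ℝ, ℝ) 𝓘(ℝ, E) γ t ((1 : ℝ →L[ℝ] ℝ).smulRight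
      (mulInvariantVectorField (I := 𝓘(ℝ, E)) (G := G) X (γ t))) :=
    fun t ht ↦ (h t ht).hasMFDerivAt (hs.mem_nhds ht)
  refine isMIntegralCurveOn_of_tderiv (fun t ht ↦ ?_) fun t ht ↦ ?_
  · exact (mdifferentiableAt_mul_left b (γ t)).comp t (hd t ht).mdifferentiableAt
  · rw [tderiv_comp (F := ℝ) (F' := E) (F'' := E) (g := fun x ↦ b * x) (f := γ) rfl
      (mdifferentiableAt_mul_left b (γ t)) (hd t ht).mdifferentiableAt]
    have h1 : tderiv (F := ℝ) (F' := E) γ t 1 =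
        mulInvariantVectorField (I := 𝓘(ℝ, E)) (G := G) X (γ t) := by
      have : tderiv (F := ℝ) (F' := E) γ t = (1 : ℝ →L[ℝ] ℝ).smulRight
          (mulInvariantVectorField (I := 𝓘(ℝ, E)) (G := G) X (γ t) : E) := (hd t ht).mfderiv
      rw [this]
      exact smulRight_one_apply _
    rw [ContinuousLinearMap.comp_apply, h1, tderiv_mul_left_mulInvariantVectorField]

/-- A smooth one-parameter subgroup `γ` of `G` with `γ'(0) = X`. -/
structure IsOneParam (γ : ℝ → G) (X : E) : Prop where
  contMDiff : ContMDiff 𝓘(ℝ, ℝ) 𝓘(ℝ, E) ∞ γ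
  add : ∀ s t, γ (s + t) = γ s * γ t
  tderiv_zero : tderiv (F := ℝ) (F' := E) γ 0 1 = X

lemma IsOneParam.zero {γ : ℝ → G} {X : E} (h : IsOneParam γ X) : γ 0 = 1 := by
  have := h.add 0 0
  simpa using this

lemma IsOneParam.mdifferentiableAt {γ : ℝ → G} {X : E} (h : IsOneParam γ X) (t : ℝ) :
    MDifferentiableAt 𝓘(ℝ, ℝ) 𝓘(ℝ, E) γ t := h.contMDiff.mdifferentiable (by simp) t

/-- Differentiate `γ(s) = γ(t) γ(s - t)` at `s = t`. -/
lemma IsOneParam.tderiv_eq {γ : ℝ → G} {X : E} (h : IsOneParam γ X) (t : ℝ) :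
    tderiv (F := ℝ) (F' := E) γ t 1 = tderiv (F := E) (F' := E) (fun x ↦ γ t * x) 1 X := by
  have h1 : γ = fun s ↦ γ t * γ (s - t) := by
    funext s
    rw [← h.add, add_sub_cancel]
  have h3 : MDifferentiableAt 𝓘(ℝ, ℝ) 𝓘(ℝ, E) (fun s ↦ γ (s - t)) t :=
    MDifferentiableAt.comp (g := γ) (f := fun s : ℝ ↦ s - t) t (h.mdifferentiableAt _)
      (differentiableAt_id.sub_const t).mdifferentiableAt
  have h4 : tderiv (F := ℝ) (F' := E) (fun s ↦ γ (s - t)) t = tderiv γ 0 := by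
    rw [tderiv_comp (F := ℝ) (F' := ℝ) (F'' := E) (g := γ) (f := fun s : ℝ ↦ s - t) (sub_self t)
      (h.mdifferentiableAt _) (differentiableAt_id.sub_const t).mdifferentiableAt, tderiv_eq_fderiv]
    rw [fderiv_sub_const, fderiv_fun_id]
    rfl
  have h5 := tderiv_comp (F := ℝ) (F' := E) (F'' := E) (g := fun x ↦ γ t * x)
    (f := fun s ↦ γ (s - t)) (x := t) (y := 1) (by simp [h.zero])
    (mdifferentiableAt_mul_left (γ t) 1) h3
  rw [← h1, h4] at h5
  rw [h5, ContinuousLinearMap.comp_apply, h.tderiv_zero]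

lemma IsOneParam.isMIntegralCurve {γ : ℝ → G} {X : E} (h : IsOneParam γ X) :
    IsMIntegralCurve γ (mulInvariantVectorField (I := 𝓘(ℝ, E)) (G := G) X) := by
  rw [isMIntegralCurve_iff_isMIntegralCurveOn]
  exact isMIntegralCurveOn_of_tderiv (fun t _ ↦ h.mdifferentiableAt t) fun t _ ↦ h.tderiv_eq t

variable [CompleteSpace E]

theorem IsOneParam.unique {γ γ' : ℝ → G} {X : E} (h : IsOneParam γ X) (h' : IsOneParam γ' X) :
    γ = γ' := by
  have := t2Space_of_lieGroup E G
  have : IsManifold 𝓘(ℝ, E) 1 G := IsManifold.of_le (n := ∞) (by simp)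
  exact isMIntegralCurve_Ioo_eq_of_contMDiff_boundaryless (t₀ := 0) (contMDiff_invField X)
    h.isMIntegralCurve h'.isMIntegralCurve (by rw [h.zero, h'.zero])

/-- The left-invariant field of `X` has a smooth integral curve through `1`. -/
lemma exists_local_integralCurve (X : E) : ∃ ε > 0, ∃ c : ℝ → G, c 0 = 1 ∧
    (∀ t ∈ Ioo (-ε) ε, ContMDiffAt 𝓘(ℝ, ℝ) 𝓘(ℝ, E) ∞ c t) ∧
    IsMIntegralCurveOn c (mulInvariantVectorField (I := 𝓘(ℝ, E)) (G := G) X) (Ioo (-ε) ε) := by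
  obtain ⟨α, hα0, ε₁, hε₁, hα⟩ := ((contDiffAt_locField (E := E) (G := G) X).of_le
    (m := 1) (by simp)).exists_forall_mem_closedBall_exists_eq_forall_mem_Ioo_hasDerivAt₀ 0
  simp only [zero_sub, zero_add] at hα
  have hc : ContinuousAt α 0 := (hα 0 ⟨by linarith, hε₁⟩).continuousAt
  have hgood := (eventually_tderiv_symm_locField (E := E) (G := G)).and
    (locOne_mem_nhds (E := E) (G := G))
  rw [← hα0] at hgood
  obtain ⟨ε₂, hε₂, hball⟩ := Metric.eventually_nhds_iff.1 (hc.eventually hgood)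
  -- Halving keeps the closed interval `[-ε, ε]` inside both the interval of existence and the one
  -- on which the curve stays where `locField` is the left-invariant field.
  set ε := min ε₁ ε₂ / 2 with hε
  have hεpos : 0 < ε := by positivity
  have hm1 : ε < ε₁ := by have := min_le_left ε₁ ε₂; linarith [lt_min hε₁ hε₂]
  have hm2 : ε < ε₂ := by have := min_le_right ε₁ ε₂; linarith [lt_min hε₁ hε₂]
  have hin : ∀ t ∈ Icc (-ε) ε, dist t 0 < ε₂ := fun t ht ↦ by
    rw [Real.dist_eq, sub_zero]
    exact (abs_le.2 ht).trans_lt hm2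
  have hsm : ContDiffOn ℝ ∞ α (Icc (-ε) ε) := by
    refine ODE.contDiffOn_enat_Icc_of_hasDerivWithinAt (n := ⊤)
      (f := fun _ ↦ locField (E := E) (G := G) X) (u := (extChartAt 𝓘(ℝ, E) (1 : G)).target)
      (fun p hp ↦ ?_) (fun t ht ↦ (hα t ⟨by linarith [ht.1], by linarith [ht.2]⟩).hasDerivWithinAt)
      (fun t ht ↦ (hball (hin t ht)).2)
    exact (ContDiffAt.comp p (contDiffAt_locField_of_mem X hp.2) contDiffAt_snd).contDiffWithinAt
  have hsymm : ∀ t ∈ Ioo (-ε) ε, ContMDiffAt 𝓘(ℝ, E) 𝓘(ℝ, E) ∞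
      (extChartAt 𝓘(ℝ, E) (1 : G)).symm (α t) := fun t ht ↦
    (contMDiffOn_extChartAt_symm (1 : G)).contMDiffAt
      ((isOpen_extChartAt_target _).mem_nhds (hball (hin t (Ioo_subset_Icc_self ht))).2)
  have hsm' : ∀ t ∈ Ioo (-ε) ε, ContMDiffAt 𝓘(ℝ, ℝ) 𝓘(ℝ, E) ∞
      (fun t ↦ (extChartAt 𝓘(ℝ, E) (1 : G)).symm (α t)) t := fun t ht ↦
    ContMDiffAt.comp t (hsymm t ht) (hsm.contDiffAt (Icc_mem_nhds ht.1 ht.2)).contMDiffAt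
  refine ⟨ε, hεpos, fun t ↦ (extChartAt 𝓘(ℝ, E) (1 : G)).symm (α t), ?_, hsm', ?_⟩
  · simp only [hα0, symm_locOne]
  · refine isMIntegralCurveOn_of_tderiv (fun t ht ↦ (hsm' t ht).mdifferentiableAt (by simp))
      fun t ht ↦ ?_
    have hd := hα t ⟨by linarith [ht.1], by linarith [ht.2]⟩
    rw [tderiv_comp (F := ℝ) (F' := E) (F'' := E) (g := (extChartAt 𝓘(ℝ, E) (1 : G)).symm) (f := α)
      rfl ((hsymm t ht).mdifferentiableAt (by simp)) hd.differentiableAt.mdifferentiableAt,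
      tderiv_eq_fderiv, ContinuousLinearMap.comp_apply, fderiv_eq_smul_deriv, hd.deriv, one_smul]
    exact (hball (hin t (Ioo_subset_Icc_self ht))).1 X

/-- Every vector of the Lie algebra is the velocity of a one-parameter subgroup. -/
theorem exists_isOneParam (X : E) : ∃ γ : ℝ → G, IsOneParam γ X := by
  have := t2Space_of_lieGroup E G
  have : IsManifold 𝓘(ℝ, E) 1 G := IsManifold.of_le (n := ∞) (by simp)
  obtain ⟨ε, hε, c, hc0, hcs, hc⟩ := exists_local_integralCurve (G := G) X
  obtain ⟨γ, hγ0, hγ⟩ := exists_isMIntegralCurve_of_isMIntegralCurveOn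
    (contMDiff_invField (G := G) X) hε
    (fun b ↦ ⟨fun t ↦ b * c t, by simp [hc0], IsMIntegralCurveOn.mul_left isOpen_Ioo hc b⟩) 1
  have hadd : ∀ s t, γ (s + t) = γ s * γ t := by
    intro s t
    -- Homomorphism property by uniqueness: the time shift of `γ` by `s` and its left translate by
    -- `γ s` are integral curves of the same field with the same value at `0`.
    have h1 : IsMIntegralCurve (γ ∘ (· + s))
        (mulInvariantVectorField (I := 𝓘(ℝ, E)) (G := G) X) := hγ.comp_add s
    have h2 : IsMIntegralCurve (fun t ↦ γ s * γ t)
        (mulInvariantVectorField (I := 𝓘(ℝ, E)) (G := G) X) := by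
      rw [isMIntegralCurve_iff_isMIntegralCurveOn] at hγ ⊢
      exact IsMIntegralCurveOn.mul_left isOpen_univ hγ (γ s)
    have := isMIntegralCurve_Ioo_eq_of_contMDiff_boundaryless (t₀ := 0)
      (contMDiff_invField (G := G) X) h1 h2 (by simp [hγ0])
    rw [add_comm]
    exact congrFun this t
  have heq : EqOn γ c (Ioo (-ε) ε) := isMIntegralCurveOn_Ioo_eqOn_of_contMDiff_boundaryless
    (t₀ := 0) ⟨by linarith, hε⟩ (contMDiff_invField (G := G) X) (hγ.isMIntegralCurveOn _) hc
    (by rw [hγ0, hc0])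
  have heq' : γ =ᶠ[𝓝 0] c := heq.eventuallyEq_of_mem (Ioo_mem_nhds (by linarith) hε)
  have hsm0 : ContMDiffAt 𝓘(ℝ, ℝ) 𝓘(ℝ, E) ∞ γ 0 :=
    (hcs 0 ⟨by linarith, hε⟩).congr_of_eventuallyEq heq'
  refine ⟨γ, fun t ↦ ?_, hadd, ?_⟩
  -- Near `0` the curve is the smooth local solution; the homomorphism property spreads smoothness
  -- to every `t`.
  · have h1 : γ = fun s ↦ γ t * γ (s - t) := by
      funext s
      rw [← hadd, add_sub_cancel]
    rw [h1]
    refine contMDiffAt_const.mul (ContMDiffAt.comp_of_eq (g := γ) (f := fun s ↦ s - t) hsm0 ?_ ?_)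
    · exact (contDiffAt_id.sub contDiffAt_const).contMDiffAt
    · simp
  · have h1 : tderiv (F := ℝ) (F' := E) γ 0 = (1 : ℝ →L[ℝ] ℝ).smulRight
          (mulInvariantVectorField (I := 𝓘(ℝ, E)) (G := G) X (γ 0) : E) := (hγ 0).mfderiv
    rw [h1, hγ0]
    have h2 : tderiv (F := E) (F' := E) (fun b : G ↦ 1 * b) 1 = .id ℝ E := by
      simp only [one_mul]; exact tderiv_id 1
    have h3 : (mulInvariantVectorField (I := 𝓘(ℝ, E)) (G := G) X 1 : E) = X :=
      congrArg (fun L : E →L[ℝ] E ↦ L X) h2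
    rw [h3]
    exact smulRight_one_apply _

end OneParam

/-- A smooth map between vector spaces with surjective differential at `a` has a smooth local
section through `a`. -/
lemma exists_local_section {A C : Type*} [NormedAddCommGroup A] [NormedSpace ℝ A]
    [NormedAddCommGroup C] [NormedSpace ℝ C] [FiniteDimensional ℝ C] {p : A → C} {a : A}
    (hp : ContDiffAt ℝ ∞ p a) (hs : Function.Surjective (fderiv ℝ p a)) :
    ∃ σ : C → A, σ (p a) = a ∧ ContDiffAt ℝ ∞ σ (p a) ∧ ∀ᶠ y in 𝓝 (p a), p (σ y) = y := by
  have : CompleteSpace C := FiniteDimensional.complete ℝ C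
  obtain ⟨R, hR⟩ := ContinuousLinearMap.exists_rightInverse_of_surjective (fderiv ℝ p a)
    (LinearMap.range_eq_top.2 hs)
  -- Along this affine slice through `a`, the map `p` has differential the identity at `p a`, so the
  -- inverse function theorem applies to `p ∘ τ`.
  set τ : C → A := fun y ↦ a + R (y - p a) with hτ
  have hτa : τ (p a) = a := by simp [hτ]
  have hτs : ContDiff ℝ ∞ τ := contDiff_const.add (R.contDiff.comp (contDiff_id.sub contDiff_const))
  have hq : ContDiffAt ℝ ∞ (fun y ↦ p (τ y)) (p a) :=
    ContDiffAt.comp (p a) (hτa.symm ▸ hp) hτs.contDiffAt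
  have hτd : HasFDerivAt τ R (p a) := by
    have := (R.hasFDerivAt.comp (p a) ((hasFDerivAt_id (𝕜 := ℝ) (p a)).sub_const (p a))).const_add a
    rw [ContinuousLinearMap.comp_id] at this
    exact this
  have hqd : HasFDerivAt (fun y ↦ p (τ y)) ((ContinuousLinearEquiv.refl ℝ C : C →L[ℝ] C)) (p a) := by
    have h1 : HasFDerivAt p (fderiv ℝ p a) (τ (p a)) :=
      hτa.symm ▸ (hp.differentiableAt (by simp)).hasFDerivAt
    have h2 := h1.comp (p a) hτd
    rw [hR] at h2
    exact h2
  have hn : (∞ : WithTop ℕ∞) ≠ 0 := by simp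
  have h1 := hq.localInverse_apply_image hqd hn
  have h2 := hq.to_localInverse hqd hn
  have h3 : ∀ᶠ y in 𝓝 (p (τ (p a))), p (τ (hq.localInverse hqd hn y)) = y :=
    (hq.hasStrictFDerivAt' hqd hn).eventually_right_inverse
  simp only [hτa] at h1 h2 h3
  refine ⟨fun y ↦ τ (hq.localInverse hqd hn y), ?_, hτs.contDiffAt.comp _ h2, h3⟩
  simp only [h1, hτa]

/-! ### The homogeneous space: local sections, the action, and the isotropy group -/

section Quotient

variable {E : Type*} [NormedAddCommGroup E] [NormedSpace ℝ E]
  {F : Type*} [NormedAddCommGroup F] [NormedSpace ℝ F]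
  {G : Type*} [Group G] [TopologicalSpace G] [ChartedSpace E G]
  {K : Subgroup G} [ChartedSpace F (G ⧸ K)]

variable (E F K) in
/-- The differential at `1` of the projection `G → G/K`, on the model spaces. -/
def dpi : E →L[ℝ] F := tderiv (F := E) (F' := F) (QuotientGroup.mk : G → G ⧸ K) (1 : G)

variable (F) in
/-- The differential at `x` of the action of `a` on `G/K`. -/
def dact (a : G) (x : G ⧸ K) : F →L[ℝ] F := tderiv (F := F) (F' := F) (fun y : G ⧸ K ↦ a • y) x

lemma dact_one (x : G ⧸ K) : dact F (1 : G) x = .id ℝ F := by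
  simp only [dact, one_smul]
  exact tderiv_id x

variable [IsManifold 𝓘(ℝ, F) ∞ (G ⧸ K)] [LieGroup 𝓘(ℝ, E) ∞ G] [FiniteDimensional ℝ F]
  (hM : IsQuotientManifold E F K)

include hM

/-- Apply `exists_local_section` to the projection in charts. These sections reduce smoothness and
differentiability questions on `G/K` to questions on `G`. -/
lemma exists_section (a : G) : ∃ s : G ⧸ K → G, s (a : G ⧸ K) = a ∧
    ContMDiffAt 𝓘(ℝ, F) 𝓘(ℝ, E) ∞ s (a : G ⧸ K) ∧
    ∀ᶠ x in 𝓝 (a : G ⧸ K), ((s x : G) : G ⧸ K) = x := by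
  set e := extChartAt 𝓘(ℝ, E) a with he
  set ψ := extChartAt 𝓘(ℝ, F) (a : G ⧸ K) with hψ
  set p : E → F := fun z ↦ ψ ((e.symm z : G) : G ⧸ K) with hp
  have hsymm : ContMDiffAt 𝓘(ℝ, E) 𝓘(ℝ, E) ∞ e.symm (e a) := contMDiffAt_chart_symm a
  have hea : e.symm (e a) = a := chart_symm_chart a
  have hpa : p (e a) = ψ (a : G ⧸ K) := by simp only [hp, hea]
  have hps : ContMDiffAt 𝓘(ℝ, E) 𝓘(ℝ, F) ∞ p (e a) := by
    refine ContMDiffAt.comp_of_eq (g := ψ) (y := (a : G ⧸ K)) (contMDiffAt_chart _)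
      (hM.contMDiff_mk.contMDiffAt.comp _ hsymm) ?_
    simp only [hea]
  have hpd : fderiv ℝ p (e a) = tderiv (F := E) (F' := F) (QuotientGroup.mk : G → G ⧸ K) a :=
    (tderiv_eq_fderiv_chart (F := E) (F' := F) (f := (QuotientGroup.mk : G → G ⧸ K)) rfl
      (hM.contMDiff_mk.mdifferentiable (by simp) a)).symm
  obtain ⟨σ, hσ1, hσ2, hσ3⟩ := exists_local_section hps.contDiffAt (by
    rw [hpd]
    exact hM.mfderiv_surjective a)
  rw [hpa] at hσ1 hσ2 hσ3
  have hψc : ContMDiffAt 𝓘(ℝ, F) 𝓘(ℝ, F) ∞ ψ (a : G ⧸ K) := contMDiffAt_chart _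
  have hs : ContMDiffAt 𝓘(ℝ, F) 𝓘(ℝ, E) ∞ (fun x ↦ e.symm (σ (ψ x))) (a : G ⧸ K) := by
    refine ContMDiffAt.comp_of_eq (g := e.symm) (y := e a) hsymm
      (ContMDiffAt.comp (g := σ) _ hσ2.contMDiffAt hψc) ?_
    simp only [hσ1]
  refine ⟨fun x ↦ e.symm (σ (ψ x)), by simp only [hσ1, hea], hs, ?_⟩
  have h1 : ContinuousAt (fun x ↦ ((e.symm (σ (ψ x)) : G) : G ⧸ K)) (a : G ⧸ K) :=
    (hM.contMDiff_mk.continuous.continuousAt).comp hs.continuousAt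
  have h2 : ψ.source ∈ 𝓝 (((e.symm (σ (ψ (a : G ⧸ K)))) : G) : G ⧸ K) := by
    rw [hσ1, hea]
    exact extChartAt_source_mem_nhds _
  filter_upwards [hψc.continuousAt.eventually hσ3, h1 h2, extChartAt_source_mem_nhds (I := 𝓘(ℝ, F))
    (a : G ⧸ K)] with x hx1 hx2 hx3
  -- The section property is only known in coordinates; injectivity of the chart returns it to
  -- `G/K`.
  exact ψ.injOn hx2 hx3 hx1

/-- The action of `G` on `G/K` is smooth. -/
lemma contMDiff_smul :
    ContMDiff (𝓘(ℝ, E).prod 𝓘(ℝ, F)) 𝓘(ℝ, F) ∞ (fun p : G × (G ⧸ K) ↦ p.1 • p.2) := by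
  rintro ⟨b, x⟩
  obtain ⟨a, rfl⟩ := QuotientGroup.mk_surjective x
  obtain ⟨s, hs1, hs2, hs3⟩ := exists_section hM a
  have h : ContMDiffAt (𝓘(ℝ, E).prod 𝓘(ℝ, F)) 𝓘(ℝ, F) ∞
      (fun p : G × (G ⧸ K) ↦ ((p.1 * s p.2 : G) : G ⧸ K)) (b, (a : G ⧸ K)) :=
    hM.contMDiff_mk.contMDiffAt.comp _ (contMDiffAt_fst.mul
      (ContMDiffAt.comp (b, (a : G ⧸ K)) hs2 contMDiffAt_snd))
  refine h.congr_of_eventuallyEq ?_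
  have ht : Tendsto (fun p : G × (G ⧸ K) ↦ p.2) (𝓝 (b, (a : G ⧸ K))) (𝓝 (a : G ⧸ K)) :=
    continuous_snd.tendsto _
  filter_upwards [ht.eventually hs3] with p hp
  nth_rw 1 [← hp]
  rfl

lemma contMDiff_smul_left (a : G) :
    ContMDiff 𝓘(ℝ, F) 𝓘(ℝ, F) ∞ (fun x : G ⧸ K ↦ a • x) :=
  (contMDiff_smul hM).comp (contMDiff_const.prodMk contMDiff_id)

lemma mdifferentiableAt_smul (a : G) (x : G ⧸ K) :
    MDifferentiableAt 𝓘(ℝ, F) 𝓘(ℝ, F) (fun x : G ⧸ K ↦ a • x) x :=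
  (contMDiff_smul_left hM a).mdifferentiable (by simp) x

lemma mdifferentiableAt_mk (a : G) :
    MDifferentiableAt 𝓘(ℝ, E) 𝓘(ℝ, F) (QuotientGroup.mk : G → G ⧸ K) a :=
  hM.contMDiff_mk.mdifferentiable (by simp) a

lemma dact_mul (a b : G) {x y : G ⧸ K} (h : b • x = y) :
    dact F (a * b) x = (dact F a y).comp (dact F b x) := by
  have e : (fun x : G ⧸ K ↦ (a * b) • x) = fun x ↦ a • b • x := by funext x; rw [mul_smul]
  rw [dact, e]
  exact tderiv_comp (F := F) (F' := F) (F'' := F) (g := fun x ↦ a • x) (f := fun x ↦ b • x) h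
    (mdifferentiableAt_smul hM a _) (mdifferentiableAt_smul hM b _)

lemma dact_inv_apply (a : G) {x y : G ⧸ K} (h : a • x = y) (u : F) :
    dact F a⁻¹ y (dact F a x u) = u := by
  rw [← ContinuousLinearMap.comp_apply, ← dact_mul hM _ _ h, inv_mul_cancel, dact_one]; rfl

lemma dact_apply_inv (a : G) {x y : G ⧸ K} (h : a • x = y) (u : F) :
    dact F a x (dact F a⁻¹ y u) = u := by
  rw [← ContinuousLinearMap.comp_apply, ← dact_mul hM a a⁻¹ (by rw [← h, inv_smul_smul]),
    mul_inv_cancel, dact_one]; rfl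

lemma dpi_surjective : Function.Surjective (dpi E F K) := hM.mfderiv_surjective 1

omit hM in
lemma smul_one_of_mem {k : G} (hk : k ∈ K) : k • ((1 : G) : G ⧸ K) = ((1 : G) : G ⧸ K) := by
  rw [MulAction.Quotient.smul_coe, smul_eq_mul, mul_one, QuotientGroup.eq]
  simpa using hk

/-- The differential at `b = 1` of `b ↦ a b K`. -/
lemma tderiv_mk_mul_left (a : G) :
    tderiv (F := E) (F' := F) (fun b : G ↦ ((a * b : G) : G ⧸ K)) 1 =
      (dact F a ((1 : G) : G ⧸ K)).comp (dpi E F K) :=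
  tderiv_comp (F := E) (F' := F) (F'' := F) (g := fun x : G ⧸ K ↦ a • x)
    (f := (QuotientGroup.mk : G → G ⧸ K)) rfl (mdifferentiableAt_smul hM a _)
      (mdifferentiableAt_mk hM 1)

/-- Right translation by `k⁻¹` is invisible in `G/K`: `k b k⁻¹ K = k b K`. -/
lemma dpi_AdE {k : G} (hk : k ∈ K) (X : E) :
    dpi E F K (AdE k X) = dact F k ((1 : G) : G ⧸ K) (dpi E F K X) := by
  have h1 : (fun b : G ↦ ((k * b * k⁻¹ : G) : G ⧸ K)) = fun b ↦ ((k * b : G) : G ⧸ K) := by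
    funext b
    rw [QuotientGroup.eq]
    simpa [mul_assoc] using hk
  have h2 := tderiv_mk_mul_left hM k
  rw [← h1, tderiv_comp (F := E) (F' := E) (F'' := F) (g := (QuotientGroup.mk : G → G ⧸ K))
    (f := fun b ↦ k * b * k⁻¹) (y := 1) (by group) (mdifferentiableAt_mk hM 1)
    (mdifferentiableAt_conj _ _)] at h2
  exact congrArg (fun L : E →L[ℝ] F ↦ L X) h2

/-- The one-parameter subgroup of a vector of the Lie algebra of `K` is contained in `K`. -/
lemma IsOneParam.mem {γ : ℝ → G} {Z : E} (hγ : IsOneParam γ Z) (hZ : dpi E F K Z = 0) (t : ℝ) :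
    γ t ∈ K := by
  have hmem : ∀ a : G, (a : G ⧸ K) = ((1 : G) : G ⧸ K) ↔ a ∈ K := by
    intro a
    rw [QuotientGroup.eq, mul_one, inv_mem_iff]
  -- The velocity of `γ(t)K` is the translate by `γ(t)` of the projection of `Z`, hence zero. So the
  -- curve is constant in a chart for small `t`.
  have hd : ∀ t, tderiv (F := ℝ) (F' := F) (fun t ↦ ((γ t : G) : G ⧸ K)) t = 0 := by
    intro t
    ext
    rw [tderiv_comp (F := ℝ) (F' := E) (F'' := F) (g := (QuotientGroup.mk : G → G ⧸ K)) (f := γ) rfl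
      (mdifferentiableAt_mk hM _) (hγ.mdifferentiableAt t), ContinuousLinearMap.comp_apply,
      hγ.tderiv_eq, ← ContinuousLinearMap.comp_apply,
      ← tderiv_comp (F := E) (F' := E) (F'' := F) (g := (QuotientGroup.mk : G → G ⧸ K))
        (f := fun x ↦ γ t * x) (mul_one _) (mdifferentiableAt_mk hM _)
        (mdifferentiableAt_mul_left _ _), tderiv_mk_mul_left hM, ContinuousLinearMap.comp_apply, hZ,
      map_zero]
    rfl
  have hc : Continuous (fun t ↦ ((γ t : G) : G ⧸ K)) :=
    hM.contMDiff_mk.continuous.comp hγ.contMDiff.continuous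
  set ψ := extChartAt 𝓘(ℝ, F) ((1 : G) : G ⧸ K) with hψ
  have hU : (fun t ↦ ((γ t : G) : G ⧸ K)) ⁻¹' ψ.source ∈ 𝓝 (0 : ℝ) := by
    refine hc.continuousAt ?_
    rw [hγ.zero]
    exact extChartAt_source_mem_nhds _
  obtain ⟨ε, hε, hball⟩ := Metric.mem_nhds_iff.1 hU
  have hmd : ∀ t ∈ Metric.ball (0 : ℝ) ε,
      MDifferentiableAt 𝓘(ℝ, F) 𝓘(ℝ, F) ψ ((γ t : G) : G ⧸ K) := fun t ht ↦ by
    refine mdifferentiableAt_extChartAt ?_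
    have := hball ht
    rwa [mem_preimage, hψ, extChartAt_source] at this
  have hmd' : ∀ t, MDifferentiableAt 𝓘(ℝ, ℝ) 𝓘(ℝ, F) (fun t ↦ ((γ t : G) : G ⧸ K)) t := fun t ↦
    (mdifferentiableAt_mk hM _).comp t (hγ.mdifferentiableAt t)
  have hloc : ∀ t ∈ Metric.ball (0 : ℝ) ε, γ t ∈ K := by
    intro t ht
    rw [← hmem]
    refine ψ.injOn (hball ht) (mem_extChartAt_source _) ?_
    have h0 : ((1 : G) : G ⧸ K) = ((γ 0 : G) : G ⧸ K) := by rw [hγ.zero]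
    have hmain : ψ ((γ t : G) : G ⧸ K) = ψ ((γ 0 : G) : G ⧸ K) := by
      refine Metric.isOpen_ball.is_const_of_fderiv_eq_zero (𝕜 := ℝ)
        (f := fun t ↦ ψ ((γ t : G) : G ⧸ K)) (convex_ball (0 : ℝ) ε).isPreconnected
        (fun s hs ↦ ?_) (fun s hs ↦ ?_) ht (Metric.mem_ball_self hε)
      · exact ((hmd s hs).comp s (hmd' s)).differentiableAt.differentiableWithinAt
      · rw [← tderiv_eq_fderiv, tderiv_comp (F := ℝ) (F' := F) (F'' := F) (g := ψ)
          (f := fun t ↦ ((γ t : G) : G ⧸ K)) rfl (hmd s hs) (hmd' s), hd]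
        simp
    rw [hmain, ← h0]
  -- From small times to all times: `γ(t) = γ(t/n)ⁿ` with `|t|/n < ε`.
  obtain ⟨n, hn⟩ := exists_nat_gt (|t| / ε)
  have hnpos : (0 : ℝ) < n := lt_of_le_of_lt (by positivity) hn
  have hpow : ∀ (m : ℕ) (s : ℝ), γ (m * s) = γ s ^ m := by
    intro m s
    induction m with
    | zero => simp [hγ.zero]
    | succ m ih => rw [Nat.cast_succ, add_mul, one_mul, hγ.add, ih, pow_succ]
  have : γ t = γ (t / n) ^ n := by
    rw [← hpow]; congr 1; field_simp
  rw [this]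
  refine K.pow_mem (hloc _ ?_) n
  rw [Metric.mem_ball, Real.dist_eq, sub_zero, abs_div, Nat.abs_cast, div_lt_iff₀ hnpos]
  rwa [div_lt_iff₀ hε, mul_comm] at hn

omit hM in
lemma IsOneParam.hasDerivAt_AdE {γ : ℝ → G} {X : E} (hγ : IsOneParam γ X) (Y : E) :
    HasDerivAt (fun t ↦ AdE (γ t) Y) (lieB G X Y) 0 := by
  obtain ⟨L, hL, hL'⟩ := hasFDerivAt_AdE_comp (hγ.mdifferentiableAt 0) hγ.zero Y
  have := hL.hasDerivAt
  rwa [hL', hγ.tderiv_zero] at this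

variable [CompleteSpace E]

/-- A linear condition on `Ad(k) Y` for `k ∈ K` passes to `[Z, Y]` for `Z` in the Lie algebra
of `K`. -/
lemma map_lieB_eq_zero {C : Type*} [NormedAddCommGroup C] [NormedSpace ℝ C] (q : E →L[ℝ] C) {Y : E}
    (hq : ∀ k ∈ K, q (AdE k Y) = 0) {Z : E} (hZ : dpi E F K Z = 0) : q (lieB G Z Y) = 0 := by
  obtain ⟨γ, hγ⟩ := exists_isOneParam (G := G) Z
  have h1 := q.hasFDerivAt.comp_hasDerivAt (0 : ℝ) (hγ.hasDerivAt_AdE Y)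
  have h2 : (q ∘ fun t ↦ AdE (γ t) Y) = fun _ ↦ 0 := funext fun t ↦ hq _ (hγ.mem hM hZ t)
  rw [h2] at h1
  exact h1.unique (hasDerivAt_const _ _)

lemma dpi_lieB_eq_zero {Z Z' : E} (hZ : dpi E F K Z = 0) (hZ' : dpi E F K Z' = 0) :
    dpi E F K (lieB G Z Z') = 0 :=
  map_lieB_eq_zero hM _ (fun k hk ↦ by rw [dpi_AdE hM hk, hZ', map_zero]) hZ

/-- If `Y` is fixed by `Ad(K)` then it commutes with the Lie algebra of `K`. -/
lemma lieB_eq_zero_of_AdE_eq {Y : E} (hY : ∀ k ∈ K, AdE k Y = Y) {Z : E} (hZ : dpi E F K Z = 0) :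
    lieB G Z Y = 0 := by
  obtain ⟨γ, hγ⟩ := exists_isOneParam (G := G) Z
  have h1 := hγ.hasDerivAt_AdE Y
  have h2 : (fun t ↦ AdE (γ t) Y) = fun _ ↦ Y := funext fun t ↦ hY _ (hγ.mem hM hZ t)
  rw [h2] at h1
  exact h1.unique (hasDerivAt_const _ _)

/-- The Lie algebra of `K` acts by skew endomorphisms with respect to an invariant form. -/
lemma invariant_form_lieB (β : F →L[ℝ] F →L[ℝ] ℝ)
    (hβ : ∀ k ∈ K, ∀ u v, β (dact F k ((1 : G) : G ⧸ K) u) (dact F k ((1 : G) : G ⧸ K) v) = β u v)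
    {Z : E} (hZ : dpi E F K Z = 0) (Y Y' : E) :
    β (dpi E F K (lieB G Z Y)) (dpi E F K Y') + β (dpi E F K Y) (dpi E F K (lieB G Z Y')) = 0 := by
  obtain ⟨γ, hγ⟩ := exists_isOneParam (G := G) Z
  have h1 := (dpi E F K).hasFDerivAt.comp_hasDerivAt (0 : ℝ) (hγ.hasDerivAt_AdE Y)
  have h1' := (dpi E F K).hasFDerivAt.comp_hasDerivAt (0 : ℝ) (hγ.hasDerivAt_AdE Y')
  have h2 := (β.hasFDerivAt.comp_hasDerivAt (0 : ℝ) h1).clm_apply h1'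
  have h3 : (fun t ↦ (β ∘ dpi E F K ∘ fun t ↦ AdE (γ t) Y) t ((dpi E F K ∘ fun t ↦ AdE (γ t) Y') t))
      = fun _ ↦ β (dpi E F K Y) (dpi E F K Y') := by
    funext t
    simp only [Function.comp_apply]
    rw [dpi_AdE hM (hγ.mem hM hZ t), dpi_AdE hM (hγ.mem hM hZ t), hβ _ (hγ.mem hM hZ t)]
  rw [h3] at h2
  have h4 := h2.unique (hasDerivAt_const _ _)
  simpa [hγ.zero, AdE_one] using h4

end Quotient

/-! ### Invariant tensors from isotropy-invariant forms, and fixed vectors of a connected isotropy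
group -/

section Extend

variable {E : Type*} [NormedAddCommGroup E] [NormedSpace ℝ E]
  {F : Type*} [NormedAddCommGroup F] [NormedSpace ℝ F]
  {G : Type*} [Group G] [TopologicalSpace G] [ChartedSpace E G]
  {K : Subgroup G} [ChartedSpace F (G ⧸ K)]

/-- The form `(u, v) ↦ β(J u, J v)`. -/
def pullForm (β : F →L[ℝ] F →L[ℝ] ℝ) (J : F →L[ℝ] F) : F →L[ℝ] F →L[ℝ] ℝ :=
  ((ContinuousLinearMap.compL ℝ F F ℝ).flip J).comp (β.comp J)

lemma contDiff_pullForm (β : F →L[ℝ] F →L[ℝ] ℝ) : ContDiff ℝ ∞ (pullForm β) := by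
  unfold pullForm
  fun_prop

/-- The form `β` on the tangent space at `o`, as an invariant field of forms on `G/K`. -/
def extendForm (β : F →L[ℝ] F →L[ℝ] ℝ) : BilinField F (G ⧸ K) := fun x ↦
  (pullForm β (dact F (Quotient.out x)⁻¹ x) : F →L[ℝ] F →L[ℝ] ℝ)

/-- The value at `x` of a field of forms, as a form on the model space. -/
def formCLM (T : BilinField F (G ⧸ K)) (x : G ⧸ K) : F →L[ℝ] F →L[ℝ] ℝ := T x

lemma formAt_apply (T : BilinField F (G ⧸ K)) (x : G ⧸ K) (u v : F) :
    formAt T x u v = formCLM T x u v := rfl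

lemma pullback_smul_apply (T : BilinField F (G ⧸ K)) (a : G) (x : G ⧸ K) (u v : F) :
    formCLM (pullback (fun y : G ⧸ K ↦ a • y) T) x u v =
      formCLM T (a • x) (dact F a x u) (dact F a x v) := rfl

variable [IsManifold 𝓘(ℝ, F) ∞ (G ⧸ K)] [LieGroup 𝓘(ℝ, E) ∞ G] [FiniteDimensional ℝ F]
  (hM : IsQuotientManifold E F K)

include hM

/-- Two representatives of a coset differ by an element of `K`, under which `β` is invariant. Thus
the arbitrary `Quotient.out` can be replaced by any representative, in particular by a smooth local
section. -/
lemma extendForm_apply {β : F →L[ℝ] F →L[ℝ] ℝ}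
    (hβ : ∀ k ∈ K, ∀ u v, β (dact F k ((1 : G) : G ⧸ K) u) (dact F k ((1 : G) : G ⧸ K) v) = β u v)
    {a : G} {x : G ⧸ K} (h : (a : G ⧸ K) = x) (u v : F) :
    formCLM (extendForm β) x u v = β (dact F a⁻¹ x u) (dact F a⁻¹ x v) := by
  have h1 : ((Quotient.out x : G) : G ⧸ K) = x := Quotient.out_eq' x
  have hk : (Quotient.out x)⁻¹ * a ∈ K := by
    rw [← QuotientGroup.eq, h1, h]
  have h2 : (Quotient.out x)⁻¹ = ((Quotient.out x)⁻¹ * a) * a⁻¹ := by group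
  have h3 : a⁻¹ • x = ((1 : G) : G ⧸ K) := by
    rw [← h, MulAction.Quotient.smul_coe, smul_eq_mul, inv_mul_cancel]
  change β (dact F (Quotient.out x)⁻¹ x u) (dact F (Quotient.out x)⁻¹ x v) = _
  rw [h2, dact_mul hM _ _ h3]
  exact hβ _ hk _ _

lemma contMDiff_extendForm {β : F →L[ℝ] F →L[ℝ] ℝ}
    (hβ : ∀ k ∈ K, ∀ u v, β (dact F k ((1 : G) : G ⧸ K) u) (dact F k ((1 : G) : G ⧸ K) v) = β u v) :
    ContMDiff 𝓘(ℝ, F) (𝓘(ℝ, F).prod 𝓘(ℝ, F →L[ℝ] F →L[ℝ] ℝ)) ∞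
      (fun x : G ⧸ K ↦ TotalSpace.mk' (F →L[ℝ] F →L[ℝ] ℝ)
        (E := fun x : G ⧸ K ↦ TangentSpace 𝓘(ℝ, F) x →L[ℝ] TangentSpace 𝓘(ℝ, F) x →L[ℝ] ℝ)
        x (extendForm β x)) := by
  intro x
  rw [contMDiffAt_section]
  obtain ⟨a, rfl⟩ := QuotientGroup.mk_surjective x
  obtain ⟨s, hs1, hs2, hs3⟩ := exists_section hM a
  set ψ := extChartAt 𝓘(ℝ, F) (a : G ⧸ K) with hψ
  set ψo := extChartAt 𝓘(ℝ, F) ((1 : G) : G ⧸ K) with hψo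
  set y0 := ψ (a : G ⧸ K) with hy0
  have hsy0 : ψ.symm y0 = (a : G ⧸ K) := chart_symm_chart _
  -- The first variable enters only through the section, the second is the point acted upon. The
  -- partial differential in the second variable along the diagonal is the translation to `o` in
  -- coordinates, and it depends smoothly on the point.
  set f : F × F → F := fun p ↦ ψo ((s (ψ.symm p.1))⁻¹ • ψ.symm p.2) with hf
  have hsymm : ContMDiffAt 𝓘(ℝ, F) 𝓘(ℝ, F) ∞ ψ.symm y0 := contMDiffAt_chart_symm _
  have hss : ContMDiffAt 𝓘(ℝ, F) 𝓘(ℝ, E) ∞ (fun y ↦ s (ψ.symm y)) y0 :=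
    ContMDiffAt.comp_of_eq (g := s) hs2 hsymm hsy0
  have hgs : ContMDiffAt 𝓘(ℝ, F × F) 𝓘(ℝ, F) ∞
      (fun p : F × F ↦ (s (ψ.symm p.1))⁻¹ • ψ.symm p.2) (y0, y0) := by
    have h1 : ContMDiffAt 𝓘(ℝ, F × F) (𝓘(ℝ, E).prod 𝓘(ℝ, F)) ∞
        (fun p : F × F ↦ ((s (ψ.symm p.1))⁻¹, ψ.symm p.2)) (y0, y0) :=
      ContMDiffAt.prodMk
        (ContMDiffAt.inv (ContMDiffAt.comp (g := fun y ↦ s (ψ.symm y)) (f := Prod.fst) (y0, y0) hss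
          contDiffAt_fst.contMDiffAt))
        (ContMDiffAt.comp (g := ψ.symm) (f := Prod.snd) (y0, y0) hsymm contDiffAt_snd.contMDiffAt)
    exact ((contMDiff_smul hM).contMDiffAt.comp _ h1)
  have hfs : ContDiffAt ℝ ∞ f (y0, y0) := by
    refine (ContMDiffAt.comp_of_eq (g := ψo) (contMDiffAt_chart _) hgs ?_).contDiffAt
    simp only [hsy0, hs1]
    rw [MulAction.Quotient.smul_coe, smul_eq_mul, inv_mul_cancel]
  have hJs : ContDiffAt ℝ ∞ (fun y ↦ fderiv ℝ (fun z ↦ f (y, z)) y) y0 :=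
    ContDiffAt.fderiv (f := fun y z ↦ f (y, z)) (g := fun y ↦ y) (n := ∞) hfs contDiffAt_id
      (by simp)
  have hCs : ContMDiffAt 𝓘(ℝ, F) 𝓘(ℝ, F →L[ℝ] F →L[ℝ] ℝ) ∞
      (fun x ↦ pullForm β (fderiv ℝ (fun z ↦ f (ψ x, z)) (ψ x))) (a : G ⧸ K) :=
    ContMDiffAt.comp (g := fun y ↦ pullForm β (fderiv ℝ (fun z ↦ f (y, z)) y)) _
      (((contDiff_pullForm β).contDiffAt.comp _ hJs).contMDiffAt) (contMDiffAt_chart _)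
  refine hCs.congr_of_eventuallyEq ?_
  filter_upwards [hs3, extChartAt_source_mem_nhds (I := 𝓘(ℝ, F)) (a : G ⧸ K)] with x hx hxs
  have hxt : ψ x ∈ ψ.target := ψ.map_source hxs
  have hxx : ψ.symm (ψ x) = x := ψ.left_inv hxs
  have hdsymm : MDifferentiableAt 𝓘(ℝ, F) 𝓘(ℝ, F) ψ.symm (ψ x) :=
    ((contMDiffOn_extChartAt_symm (n := ∞) (a : G ⧸ K)).contMDiffAt
      ((isOpen_extChartAt_target _).mem_nhds hxt)).mdifferentiableAt (by simp)
  have hsx : (s x)⁻¹ • x = ((1 : G) : G ⧸ K) := by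
    nth_rw 2 [← hx]
    rw [MulAction.Quotient.smul_coe, smul_eq_mul, inv_mul_cancel]
  have hJ : fderiv ℝ (fun z ↦ f (ψ x, z)) (ψ x) = (dact F (s x)⁻¹ x).comp
      (tderiv (F := F) (F' := F) ψ.symm (ψ x)) := by
    rw [← tderiv_eq_fderiv]
    simp only [hf, hxx]
    have hmd := mdifferentiableAt_smul hM (s x)⁻¹ x
    rw [tderiv_comp (F := F) (F' := F) (F'' := F) (g := ψo) (f := fun z ↦ (s x)⁻¹ • ψ.symm z)
      (y := ((1 : G) : G ⧸ K)) (by simp only [hxx, hsx])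
      ((contMDiffAt_chart _).mdifferentiableAt (by simp))
      (MDifferentiableAt.comp_of_eq (g := fun z ↦ (s x)⁻¹ • z) _ hmd hdsymm hxx),
      tderiv_comp (F := F) (F' := F) (F'' := F) (g := fun z : G ⧸ K ↦ (s x)⁻¹ • z) hxx hmd hdsymm,
      hψo, tderiv_chart]
    rfl
  rw [hJ]
  ext u v
  have h1 := component_eq (extendForm (K := K) β) (a : G ⧸ K) hxt u v
  have h2 := congrArg (fun p ↦ (trivializationAt (F →L[ℝ] F →L[ℝ] ℝ)
        (fun x : G ⧸ K ↦ TangentSpace 𝓘(ℝ, F) x →L[ℝ] TangentSpace 𝓘(ℝ, F) x →L[ℝ] ℝ) (a : G ⧸ K)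
        ⟨p, extendForm β p⟩).2 u v) hxx
  refine (h1.trans h2).symm.trans ?_
  have h3 := extendForm_apply hM hβ (hx.trans hxx.symm)
    (tderiv (F := F) (F' := F) ψ.symm (ψ x) u) (tderiv (F := F) (F' := F) ψ.symm (ψ x) v)
  refine Eq.trans h3 ?_
  rw [hxx]
  rfl

/-- A form on the tangent space at `o` which is invariant under the isotropy representation is the
value of an invariant tensor. -/
theorem exists_invTensor {β : F →L[ℝ] F →L[ℝ] ℝ} (hsymm : ∀ u v, β u v = β v u)
    (hβ : ∀ k ∈ K, ∀ u v, β (dact F k ((1 : G) : G ⧸ K) u) (dact F k ((1 : G) : G ⧸ K) v) = β u v) :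
    ∃ T : invTensors F K, ∀ u v, formAt T.1 ((1 : G) : G ⧸ K) u v = β u v := by
  refine ⟨⟨⟨extendForm β, contMDiff_extendForm hM hβ⟩, fun x u v ↦ hsymm
      (dact F (Quotient.out x)⁻¹ x u) (dact F (Quotient.out x)⁻¹ x v), fun a x ↦ ?_⟩,
    fun u v ↦ ?_⟩
  · obtain ⟨b, rfl⟩ := QuotientGroup.mk_surjective x
    have h : ∀ u v : F, formCLM (pullback (fun y : G ⧸ K ↦ a • y) (extendForm β)) (b : G ⧸ K) u v =
        formCLM (extendForm β) (b : G ⧸ K) u v := by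
      intro u v
      rw [pullback_smul_apply, extendForm_apply hM hβ (a := a * b) (x := a • (b : G ⧸ K)) rfl,
        extendForm_apply hM hβ (a := b) rfl, mul_inv_rev]
      have h1 : a⁻¹ • (a • (b : G ⧸ K)) = (b : G ⧸ K) := inv_smul_smul _ _
      rw [dact_mul hM _ _ h1, ContinuousLinearMap.comp_apply, ContinuousLinearMap.comp_apply,
        dact_inv_apply hM a rfl, dact_inv_apply hM a rfl]
    exact ContinuousLinearMap.ext fun u ↦ ContinuousLinearMap.ext fun v ↦ h u v
  · have := extendForm_apply hM hβ (a := 1) rfl u v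
    rw [inv_one, dact_one] at this
    exact this

omit hM in
lemma invTensors_apply (T : invTensors F K) (a : G) (x : G ⧸ K) (u v : F) :
    formCLM T.1 (a • x) (dact F a x u) (dact F a x v) = formCLM T.1 x u v :=
  congrArg (fun L : F →L[ℝ] F →L[ℝ] ℝ ↦ L u v) (T.2.2 a x)

omit hM in
lemma invTensors_symm (T : invTensors F K) (x : G ⧸ K) (u v : F) :
    formCLM T.1 x u v = formCLM T.1 x v u := T.2.1 x u v

omit hM in
lemma invTensors_apply_isotropy (T : invTensors F K) {k : G} (hk : k ∈ K) (u v : F) :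
    formCLM T.1 ((1 : G) : G ⧸ K) (dact F k ((1 : G) : G ⧸ K) u) (dact F k ((1 : G) : G ⧸ K) v) =
      formCLM T.1 ((1 : G) : G ⧸ K) u v := by
  have := invTensors_apply T k ((1 : G) : G ⧸ K) u v
  rwa [smul_one_of_mem hk] at this

/-- An invariant tensor is determined by its value at `o`. -/
lemma invTensors_ext {S T : invTensors F K}
    (h : ∀ u v, formCLM S.1 ((1 : G) : G ⧸ K) u v = formCLM T.1 ((1 : G) : G ⧸ K) u v) : S = T := by
  apply Subtype.ext
  apply ContMDiffSection.ext
  intro x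
  obtain ⟨a, rfl⟩ := QuotientGroup.mk_surjective x
  have hx : a • ((1 : G) : G ⧸ K) = (a : G ⧸ K) := by
    rw [MulAction.Quotient.smul_coe, smul_eq_mul, mul_one]
  have key : ∀ u v : F, formCLM S.1 (a : G ⧸ K) u v = formCLM T.1 (a : G ⧸ K) u v := by
    intro u v
    rw [← dact_apply_inv hM a hx u, ← dact_apply_inv hM a hx v, ← hx, invTensors_apply,
      invTensors_apply, h]
  exact ContinuousLinearMap.ext fun u ↦ ContinuousLinearMap.ext fun v ↦ key u v

omit hM in
lemma lieB_neg_swap [CompleteSpace E] (X Y : E) : -lieB G Y X = lieB G X Y :=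
  lie_skew (L := GroupLieAlgebra 𝓘(ℝ, E) G) X Y

/-- If `K` is connected, vectors commuting with the Lie algebra of `K` are fixed by `Ad(K)`. -/
theorem AdE_eq_of_isConnected [CompleteSpace E] (hK : IsConnected (K : Set G)) {X : E}
    (hX : ∀ Z, dpi E F K Z = 0 → lieB G Z X = 0) {k : G} (hk : k ∈ K) : AdE k X = X := by
  have : IsTopologicalGroup G := topologicalGroup_of_lieGroup 𝓘(ℝ, E) ∞
  have : IsManifold 𝓘(ℝ, E) 1 G := IsManifold.of_le (n := ∞) (by simp)
  have : IsManifold 𝓘(ℝ, F) 1 (G ⧸ K) := IsManifold.of_le (n := ∞) (by simp)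
  obtain ⟨s, hs1, hs2, hs3⟩ := exists_section hM (1 : G)
  set φ := extChartAt 𝓘(ℝ, E) (1 : G) with hφ
  have hφ0 : φ.symm (locOne E G) = 1 := symm_locOne
  have hmkc : Continuous (fun a : G ↦ (a : G ⧸ K)) := hM.contMDiff_mk.continuous
  have hφc : ContinuousAt φ.symm (locOne E G) := contMDiffAt_symm_locOne.continuousAt
  -- A smooth map from a neighbourhood of the identity into `K`, restricting to the identity on `K`.
  -- It allows calculus along `K` without using a manifold structure on it.
  set R : E → G := fun e ↦ (s ((φ.symm e : G) : G ⧸ K))⁻¹ * φ.symm e with hR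
  have hR0 : R (locOne E G) = 1 := by simp only [hR, hφ0, hs1]; group
  have hRs : ContMDiffAt 𝓘(ℝ, E) 𝓘(ℝ, E) 1 R (locOne E G) := by
    refine ContMDiffAt.of_le (n := ∞) (ContMDiffAt.mul (ContMDiffAt.inv ?_)
      contMDiffAt_symm_locOne) (by simp)
    exact ContMDiffAt.comp_of_eq (g := s) hs2
      (hM.contMDiff_mk.contMDiffAt.comp _ contMDiffAt_symm_locOne) (congrArg _ hφ0)
  have hRd : ∀ᶠ e in 𝓝 (locOne E G), MDifferentiableAt 𝓘(ℝ, E) 𝓘(ℝ, E) R e := by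
    filter_upwards [(contMDiffAt_iff_contMDiffAt_nhds
      (WithTop.coe_injective.ne (by simp : (1 : ℕ∞) ≠ ⊤))).1 hRs] with e he
    exact he.mdifferentiableAt (by simp)
  have hRK : ∀ᶠ e in 𝓝 (locOne E G), R e ∈ K := by
    have hc : ContinuousAt (fun e ↦ ((φ.symm e : G) : G ⧸ K)) (locOne E G) :=
      hmkc.continuousAt.comp hφc
    have h1 : ∀ᶠ x in 𝓝 ((φ.symm (locOne E G) : G) : G ⧸ K), ((s x : G) : G ⧸ K) = x := by
      rwa [hφ0]
    filter_upwards [hc.eventually h1] with e he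
    exact QuotientGroup.eq.1 he
  -- The map `z ↦ R(e)⁻¹ R(z)` is `K`-valued near `e` and equals `1` at `e`, so its differential has
  -- values in `𝔨`. The derivative of `Ad` of it at `X` is then a bracket `[Z, X] = 0`; applying
  -- `Ad(R(e))` gives the claim.
  have hzero : ∀ᶠ e in 𝓝 (locOne E G), HasFDerivAt (fun e ↦ AdE (R e) X) (0 : E →L[ℝ] E) e := by
    filter_upwards [hRd, hRK.eventually_nhds] with e hd hk
    have hd' : MDifferentiableAt 𝓘(ℝ, E) 𝓘(ℝ, E) (fun z ↦ (R e)⁻¹ * R z) e :=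
      (mdifferentiableAt_mul_left _ _).comp e hd
    obtain ⟨L, hL, hL'⟩ := hasFDerivAt_AdE_comp hd' (inv_mul_cancel _) X
    have hL0 : L = 0 := by
      ext v
      rw [hL', zero_apply]
      have h1 : ((fun z ↦ (((R e)⁻¹ * R z : G) : G ⧸ K))) =ᶠ[𝓝 e]
          fun _ ↦ ((1 : G) : G ⧸ K) := by
        have he := hk.self_of_nhds
        filter_upwards [hk] with z hz
        rw [eq_comm, QuotientGroup.eq, inv_one, one_mul]
        exact K.mul_mem (K.inv_mem he) hz
      have h2 := tderiv_congr (F := E) (F' := F) h1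
      rw [tderiv_const, tderiv_comp (F := E) (F' := E) (F'' := F)
        (g := (QuotientGroup.mk : G → G ⧸ K)) (f := fun z ↦ (R e)⁻¹ * R z)
        (inv_mul_cancel _) (mdifferentiableAt_mk hM 1) hd']
        at h2
      exact hX _ (congrArg (fun L : E →L[ℝ] F ↦ L v) h2)
    rw [hL0] at hL
    have h3 := (AdE (E := E) (R e)).hasFDerivAt.comp e hL
    rw [ContinuousLinearMap.comp_zero] at h3
    refine h3.congr_of_eventuallyEq (Eventually.of_forall fun z ↦ ?_)
    simp only [Function.comp_apply]
    rw [← ContinuousLinearMap.comp_apply, ← AdE_mul, mul_inv_cancel_left]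
  obtain ⟨ε, hε, hball⟩ := Metric.eventually_nhds_iff_ball.1 hzero
  have hconst : ∀ e ∈ Metric.ball (locOne E G) ε, AdE (R e) X = X := by
    intro e he
    have := Metric.isOpen_ball.is_const_of_fderiv_eq_zero (𝕜 := ℝ)
      (convex_ball (locOne E G) ε).isPreconnected
      (fun z hz ↦ (hball z hz).differentiableAt.differentiableWithinAt)
      (fun z hz ↦ (hball z hz).fderiv) he (Metric.mem_ball_self hε)
    rw [this, hR0, AdE_one]
    rfl
  have hnear : ∀ᶠ a in 𝓝 (1 : G), a ∈ K → AdE a X = X := by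
    have hφ1 : ContinuousAt φ 1 := (contMDiffAt_chart (1 : G)).continuousAt
    filter_upwards [hφ1 (Metric.ball_mem_nhds _ hε), extChartAt_source_mem_nhds (I := 𝓘(ℝ, E))
      (1 : G)] with a ha has hak
    have h1 := hconst _ ha
    have h2 : (a : G ⧸ K) = ((1 : G) : G ⧸ K) := by
      rw [eq_comm, QuotientGroup.eq, inv_one, one_mul]; exact hak
    have h3 : R (φ a) = a := by
      simp only [hR]
      rw [φ.left_inv has, h2, hs1, inv_one, one_mul]
    rwa [h3] at h1
  have : ConnectedSpace K := isConnected_iff_connectedSpace.1 hK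
  -- The stabiliser of `X` in `K` contains a neighbourhood of `1`, so it is open and closed.
  let H : Subgroup K :=
    { carrier := {k | AdE (k : G) X = X}
      one_mem' := by
        change AdE (1 : G) X = X
        rw [AdE_one]; rfl
      mul_mem' := by
        intro a b ha hb
        change AdE ((a : G) * b) X = X
        rw [AdE_mul, ContinuousLinearMap.comp_apply]
        exact (congrArg _ hb).trans ha
      inv_mem' := by
        intro a ha
        change AdE (a : G)⁻¹ X = X
        nth_rw 1 [← show AdE (a : G) X = X from ha]
        exact AdE_inv_apply_apply _ _ }
  have hHo : IsOpen (H : Set K) := by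
    refine H.isOpen_of_mem_nhds (g := 1) ?_
    have : Tendsto (fun k : K ↦ (k : G)) (𝓝 1) (𝓝 1) := continuous_subtype_val.tendsto (1 : K)
    filter_upwards [this.eventually hnear] with k hk
    exact hk k.2
  have huniv : (H : Set K) = univ := IsClopen.eq_univ ⟨H.isClosed_of_isOpen hHo, hHo⟩ ⟨1, H.one_mem⟩
  have : (⟨k, hk⟩ : K) ∈ (H : Set K) := huniv ▸ mem_univ _
  exact this

end Extend

/-! ### The action in charts and the derivatives of invariant tensors -/

section LocalAction

variable {E : Type*} [NormedAddCommGroup E] [NormedSpace ℝ E]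
  {F : Type*} [NormedAddCommGroup F] [NormedSpace ℝ F]
  {G : Type*} [Group G] [TopologicalSpace G] [ChartedSpace E G]
  {K : Subgroup G} [ChartedSpace F (G ⧸ K)]

variable (E F K) in
/-- The action of `a b a⁻¹`, for `b` close to `1`, on a neighbourhood of `aK`, in charts. -/
def locAct (a : G) (p : E × F) : F :=
  extChartAt 𝓘(ℝ, F) (a : G ⧸ K) ((a * (extChartAt 𝓘(ℝ, E) (1 : G)).symm p.1 * a⁻¹) •
    (extChartAt 𝓘(ℝ, F) (a : G ⧸ K)).symm p.2)

variable (E F K) in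
/-- The map `b ↦ abK` in charts. -/
def locProj (a : G) (s : E) : F :=
  extChartAt 𝓘(ℝ, F) (a : G ⧸ K) ((a * (extChartAt 𝓘(ℝ, E) (1 : G)).symm s : G) : G ⧸ K)

variable (F K) in
/-- The coordinates of `aK`. -/
def locBase (a : G) : F := extChartAt 𝓘(ℝ, F) (a : G ⧸ K) (a : G ⧸ K)

variable (E F K) in
/-- The differential of `y ↦ (a b a⁻¹) y` at `aK`, in charts. -/
def locActDeriv (a : G) (s : E) : F →L[ℝ] F :=
  fderiv ℝ (fun y ↦ locAct E F K a (s, y)) (locBase F K a)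

variable (E F K) in
/-- The differential at `b = 1` of `b ↦ abK`. -/
def dorb (a : G) : E →L[ℝ] F := (dact F a ((1 : G) : G ⧸ K)).comp (dpi E F K)

lemma symm_locBase (a : G) :
    (extChartAt 𝓘(ℝ, F) (a : G ⧸ K)).symm (locBase F K a) = (a : G ⧸ K) := chart_symm_chart _

lemma locProj_one (a : G) : locProj E F K a (locOne E G) = locBase F K a := by
  rw [locProj, symm_locOne, mul_one]; rfl

/-- Acting by `a b a⁻¹` instead of `b` moves `aK` to `abK`. So left-invariant fields govern the
computation at every base point, not only at `o`. -/
lemma locAct_base (a : G) (s : E) : locAct E F K a (s, locBase F K a) = locProj E F K a s := by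
  rw [locAct, symm_locBase, locProj, MulAction.Quotient.smul_coe, smul_eq_mul,
    inv_mul_cancel_right]

variable [IsManifold 𝓘(ℝ, F) ∞ (G ⧸ K)] [LieGroup 𝓘(ℝ, E) ∞ G] [FiniteDimensional ℝ F]

/-- The coordinates of a tensor in the chart around `x`. -/
def locTensor (T : Tensor2 F (G ⧸ K)) (x : G ⧸ K) (y : F) : F →L[ℝ] F →L[ℝ] ℝ :=
  (trivializationAt (F →L[ℝ] F →L[ℝ] ℝ)
    (fun x : G ⧸ K ↦ TangentSpace 𝓘(ℝ, F) x →L[ℝ] TangentSpace 𝓘(ℝ, F) x →L[ℝ] ℝ) x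
    ⟨(extChartAt 𝓘(ℝ, F) x).symm y, T ((extChartAt 𝓘(ℝ, F) x).symm y)⟩).2

omit [FiniteDimensional ℝ F] in
lemma differentiableAt_locTensor (T : Tensor2 F (G ⧸ K)) (x : G ⧸ K) :
    DifferentiableAt ℝ (locTensor T x) (extChartAt 𝓘(ℝ, F) x x) := by
  have h1 := (contMDiffAt_section (s := T.toFun) x).1 (T.contMDiff x)
  exact (ContMDiffAt.comp_of_eq h1 (contMDiffAt_chart_symm x)
    (extChartAt_to_inv x)).contDiffAt.differentiableAt (by simp)

omit [FiniteDimensional ℝ F] in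
lemma locTensor_apply (T : Tensor2 F (G ⧸ K)) (x : G ⧸ K) {y : F}
    (hy : y ∈ (extChartAt 𝓘(ℝ, F) x).target) (u v : F) :
    locTensor T x y u v = component T x u v y := (component_eq T x hy u v).symm

omit [FiniteDimensional ℝ F] in
lemma locTensor_self (T : Tensor2 F (G ⧸ K)) (x : G ⧸ K) (u v : F) :
    locTensor T x (extChartAt 𝓘(ℝ, F) x x) u v = formCLM T x u v :=
  (locTensor_apply T x (mem_extChartAt_target x) u v).trans (component_self T x u v)

omit [FiniteDimensional ℝ F] in
lemma partialDeriv_eq (T : Tensor2 F (G ⧸ K)) (x : G ⧸ K) (u v w : F) :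
    partialDeriv T x u v w =
      fderiv ℝ (locTensor T x) (extChartAt 𝓘(ℝ, F) x x) u v w := by
  have h : component T x v w =ᶠ[𝓝 (extChartAt 𝓘(ℝ, F) x x)] fun y ↦ locTensor T x y v w := by
    filter_upwards [extChartAt_target_mem_nhds x] with y hy using (locTensor_apply T x hy v w).symm
  have h1 := ((differentiableAt_locTensor T x).hasFDerivAt.clm_apply
    (hasFDerivAt_const v _)).clm_apply (hasFDerivAt_const w _)
  rw [partialDeriv, h.fderiv_eq, h1.fderiv]
  simp

variable (hM : IsQuotientManifold E F K)

include hM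

lemma fderiv_locProj (a : G) : fderiv ℝ (locProj E F K a) (locOne E G) = dorb E F K a := by
  rw [dorb, ← tderiv_mk_mul_left hM]
  exact (tderiv_eq_fderiv_chart (F := E) (F' := F) (x := (1 : G)) (y := (a : G ⧸ K))
    (f := fun b : G ↦ ((a * b : G) : G ⧸ K)) (by rw [mul_one])
    ((mdifferentiableAt_mk hM _).comp _ (mdifferentiableAt_mul_left _ _))).symm

lemma contMDiffAt_act_chart (a : G) : ContMDiffAt 𝓘(ℝ, E × F) 𝓘(ℝ, F) ∞
    (fun p : E × F ↦ (a * (extChartAt 𝓘(ℝ, E) (1 : G)).symm p.1 * a⁻¹) •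
    (extChartAt 𝓘(ℝ, F) (a : G ⧸ K)).symm p.2) (locOne E G, locBase F K a) := by
  have h1 : ContMDiffAt 𝓘(ℝ, E × F) (𝓘(ℝ, E).prod 𝓘(ℝ, F)) ∞
      (fun p : E × F ↦ (a * (extChartAt 𝓘(ℝ, E) (1 : G)).symm p.1 * a⁻¹,
        (extChartAt 𝓘(ℝ, F) (a : G ⧸ K)).symm p.2)) (locOne E G, locBase F K a) :=
    ContMDiffAt.prodMk
      ((contMDiffAt_const.mul (ContMDiffAt.comp (f := Prod.fst) (locOne E G, locBase F K a)
        contMDiffAt_symm_locOne contDiffAt_fst.contMDiffAt)).mul contMDiffAt_const)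
      (ContMDiffAt.comp (f := Prod.snd) (locOne E G, locBase F K a)
        (contMDiffAt_chart_symm _) contDiffAt_snd.contMDiffAt)
  exact (contMDiff_smul hM).contMDiffAt.comp _ h1

omit hM [IsManifold 𝓘(ℝ, F) ∞ (G ⧸ K)] [FiniteDimensional ℝ F] [LieGroup 𝓘(ℝ, E) ∞ G] in
lemma act_chart_base (a : G) : (a * (extChartAt 𝓘(ℝ, E) (1 : G)).symm (locOne E G) * a⁻¹) •
    (extChartAt 𝓘(ℝ, F) (a : G ⧸ K)).symm (locBase F K a) = (a : G ⧸ K) := by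
  rw [symm_locOne, symm_locBase, mul_one, mul_inv_cancel, one_smul]

lemma contDiffAt_locAct (a : G) :
    ContDiffAt ℝ ∞ (locAct E F K a) (locOne E G, locBase F K a) :=
  (ContMDiffAt.comp_of_eq (g := extChartAt 𝓘(ℝ, F) (a : G ⧸ K)) (contMDiffAt_chart _)
    (contMDiffAt_act_chart hM a) (act_chart_base a)).contDiffAt

lemma contDiffAt_locProj (a : G) : ContDiffAt ℝ ∞ (locProj E F K a) (locOne E G) := by
  have h : locProj E F K a = fun s ↦ locAct E F K a (s, locBase F K a) :=
    funext fun s ↦ (locAct_base a s).symm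
  rw [h]
  exact ContDiffAt.comp (g := locAct E F K a) (f := fun s ↦ (s, locBase F K a)) (locOne E G)
    (contDiffAt_locAct hM a) (contDiffAt_id.prodMk contDiffAt_const)

lemma eventually_symm_locAct (a : G) : ∀ᶠ p in 𝓝 (locOne E G, locBase F K a),
    (extChartAt 𝓘(ℝ, F) (a : G ⧸ K)).symm (locAct E F K a p) =
    (a * (extChartAt 𝓘(ℝ, E) (1 : G)).symm p.1 * a⁻¹) •
      (extChartAt 𝓘(ℝ, F) (a : G ⧸ K)).symm p.2 := by
  have h := (contMDiffAt_act_chart hM a).continuousAt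
  have h1 : (extChartAt 𝓘(ℝ, F) (a : G ⧸ K)).source ∈
      𝓝 ((a * (extChartAt 𝓘(ℝ, E) (1 : G)).symm (locOne E G) * a⁻¹) •
    (extChartAt 𝓘(ℝ, F) (a : G ⧸ K)).symm (locBase F K a)) := by
    rw [act_chart_base]
    exact extChartAt_source_mem_nhds _
  filter_upwards [h h1] with p hp
  exact (extChartAt 𝓘(ℝ, F) (a : G ⧸ K)).left_inv hp

lemma contDiffAt_locActDeriv (a : G) : ContDiffAt ℝ ∞ (locActDeriv E F K a) (locOne E G) :=
  contDiffAt_fderiv_partial_snd (contDiffAt_locAct hM a)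

omit hM [IsManifold 𝓘(ℝ, F) ∞ (G ⧸ K)] [FiniteDimensional ℝ F] [LieGroup 𝓘(ℝ, E) ∞ G] in
lemma locActDeriv_one (a : G) : locActDeriv E F K a (locOne E G) = .id ℝ F := by
  have : (fun y ↦ locAct E F K a (locOne E G, y)) =ᶠ[𝓝 (locBase F K a)] fun y ↦ y := by
    filter_upwards [extChartAt_target_mem_nhds (I := 𝓘(ℝ, F)) (a : G ⧸ K)] with y hy
    simp only [locAct, symm_locOne, mul_one, mul_inv_cancel, one_smul]
    exact (extChartAt 𝓘(ℝ, F) (a : G ⧸ K)).right_inv hy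
  rw [locActDeriv, this.fderiv_eq, fderiv_fun_id]

/-- Invariance of a tensor, in charts. -/
lemma eventually_locTensor_locAct {T : Tensor2 F (G ⧸ K)}
    (hT : ∀ (b : G) y u v, formCLM T (b • y) (dact F b y u) (dact F b y v) = formCLM T y u v)
    (a : G) : ∀ᶠ s in 𝓝 (locOne E G), ∀ u v,
    locTensor T (a : G ⧸ K) (locProj E F K a s) (locActDeriv E F K a s u)
      (locActDeriv E F K a s v) = formCLM T (a : G ⧸ K) u v := by
  have hd : ∀ᶠ s in 𝓝 (locOne E G), DifferentiableAt ℝ (locAct E F K a) (s, locBase F K a) :=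
    (Continuous.tendsto (f := fun s : E ↦ (s, locBase F K a))
      (by fun_prop) (locOne E G)).eventually
      (eventually_differentiableAt (contDiffAt_locAct hM a))
  have ht : ∀ᶠ s in 𝓝 (locOne E G),
      locProj E F K a s ∈ (extChartAt 𝓘(ℝ, F) (a : G ⧸ K)).target := by
    refine (contDiffAt_locProj hM a).continuousAt ?_
    rw [locProj_one]
    exact extChartAt_target_mem_nhds _
  filter_upwards [(eventually_symm_locAct hM a).curry_nhds, hd, ht] with s hs hd ht u v
  rw [locTensor_apply _ _ ht]
  set b := a * (extChartAt 𝓘(ℝ, E) (1 : G)).symm s * a⁻¹ with hb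
  have hdy : DifferentiableAt ℝ (fun y ↦ locAct E F K a (s, y)) (locBase F K a) :=
    DifferentiableAt.comp (f := fun y ↦ (s, y)) (locBase F K a) hd
      ((differentiableAt_const s).prodMk differentiableAt_id)
  have h1 := tderiv_congr (F := F) (F' := F) hs
  rw [tderiv_comp (F := F) (F' := F) (F'' := F) (g := (extChartAt 𝓘(ℝ, F) (a : G ⧸ K)).symm)
    (f := fun y ↦ locAct E F K a (s, y)) (locAct_base a s)
    (((contMDiffOn_extChartAt_symm (n := ∞) (a : G ⧸ K)).contMDiffAt
      ((isOpen_extChartAt_target _).mem_nhds ht)).mdifferentiableAt (by simp))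
    hdy.mdifferentiableAt,
    tderiv_comp (F := F) (F' := F) (F'' := F) (g := fun z : G ⧸ K ↦ b • z)
      (f := (extChartAt 𝓘(ℝ, F) (a : G ⧸ K)).symm)
    (symm_locBase a) (mdifferentiableAt_smul hM b _)
    ((contMDiffAt_chart_symm _).mdifferentiableAt (by simp)), locBase,
    tderiv_chart_symm, tderiv_eq_fderiv] at h1
  have h2 : ∀ u, tderiv (F := F) (F' := F) (extChartAt 𝓘(ℝ, F) (a : G ⧸ K)).symm
      (locProj E F K a s) (locActDeriv E F K a s u) = dact F b (a : G ⧸ K) u :=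
    fun u ↦ congrArg (fun L : F →L[ℝ] F ↦ L u) h1
  have h3 : (extChartAt 𝓘(ℝ, F) (a : G ⧸ K)).symm (locProj E F K a s) = b • (a : G ⧸ K) := by
    have := hs.self_of_nhds
    rwa [locAct_base, symm_locBase] at this
  have h4 : component T (a : G ⧸ K) (locActDeriv E F K a s u) (locActDeriv E F K a s v)
      (locProj E F K a s) = formCLM T ((extChartAt 𝓘(ℝ, F) (a : G ⧸ K)).symm (locProj E F K a s))
      (tderiv (F := F) (F' := F) (extChartAt 𝓘(ℝ, F) (a : G ⧸ K)).symm
      (locProj E F K a s) (locActDeriv E F K a s u))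
      (tderiv (F := F) (F' := F) (extChartAt 𝓘(ℝ, F) (a : G ⧸ K)).symm
      (locProj E F K a s) (locActDeriv E F K a s v)) := rfl
  rw [h4, h2, h2, h3, hT]

variable (E F K) in
omit hM in
/-- The differentials at `aK` of the vector fields of the action, in charts. -/
def actJac (a : G) : E →L[ℝ] F →L[ℝ] F := fderiv ℝ (locActDeriv E F K a) (locOne E G)

omit hM in
lemma hasFDerivAt_locActDeriv (hM : IsQuotientManifold E F K) (a : G) :
    HasFDerivAt (locActDeriv E F K a) (actJac E F K a) (locOne E G) :=
  ((contDiffAt_locActDeriv hM a).differentiableAt (by simp)).hasFDerivAt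

set_option synthInstance.maxHeartbeats 200000 in
/-- The partial derivatives of an invariant tensor. -/
lemma partialDeriv_invariant {T : Tensor2 F (G ⧸ K)}
    (hT : ∀ (b : G) y u v, formCLM T (b • y) (dact F b y u) (dact F b y v) = formCLM T y u v)
    (a : G) (X : E) (v w : F) :
    partialDeriv T (a : G ⧸ K) (dorb E F K a X) v w =
      - formCLM T (a : G ⧸ K) (actJac E F K a X v) w
      - formCLM T (a : G ⧸ K) v (actJac E F K a X w) := by
  have hq : HasFDerivAt (locProj E F K a) (dorb E F K a) (locOne E G) := by
    rw [← fderiv_locProj hM]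
    exact ((contDiffAt_locProj hM a).differentiableAt (by simp)).hasFDerivAt
  have hJ := hasFDerivAt_locActDeriv hM a
  have hTd : HasFDerivAt (locTensor T (a : G ⧸ K)) (fderiv ℝ (locTensor T (a : G ⧸ K))
      (locBase F K a)) (locProj E F K a (locOne E G)) := by
    rw [locProj_one]
    exact (differentiableAt_locTensor T _).hasFDerivAt
  have hc : HasFDerivAt (fun s ↦ locTensor T (a : G ⧸ K) (locProj E F K a s))
      ((fderiv ℝ (locTensor T (a : G ⧸ K)) (locBase F K a)).comp (dorb E F K a)) (locOne E G) :=
    HasFDerivAt.comp (g := locTensor T (a : G ⧸ K)) (locOne E G) hTd hq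
  have hJv : ∀ v : F, HasFDerivAt (fun s ↦ locActDeriv E F K a s v)
      ((actJac E F K a).flip v) (locOne E G) := fun v ↦ by
    simpa using hJ.clm_apply (hasFDerivAt_const v _)
  have h0 := HasFDerivAt.clm_apply (G := F) (H := F →L[ℝ] ℝ) hc (hJv v)
  have h1 := HasFDerivAt.clm_apply (G := F) (H := ℝ) h0 (hJv w)
  -- By invariance the evaluated tensor is constant in `s`; comparing its zero derivative with the
  -- product rule yields the formula.
  have h2 : (fun s ↦ locTensor T (a : G ⧸ K) (locProj E F K a s) (locActDeriv E F K a s v)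
      (locActDeriv E F K a s w)) =ᶠ[𝓝 (locOne E G)] fun _ ↦ formCLM T (a : G ⧸ K) v w := by
    filter_upwards [eventually_locTensor_locAct hM hT a] with s hs using hs v w
  have h3 := (h1.congr_of_eventuallyEq h2.symm).unique (hasFDerivAt_const _ _)
  have h4 := congrArg (fun L : E →L[ℝ] ℝ ↦ L X) h3
  have h5 : ∀ u v, locTensor T (a : G ⧸ K) (locBase F K a) u v = formCLM T (a : G ⧸ K) u v :=
    locTensor_self T _
  simp [locActDeriv_one, locProj_one, h5] at h4
  rw [partialDeriv_eq]
  change fderiv ℝ (locTensor T (a : G ⧸ K)) (locBase F K a) (dorb E F K a X) v w = _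
  linarith

/-- The vector fields of the action are related to the left-invariant fields by the projection. -/
lemma eventually_locActDeriv_dorb (a : G) : ∀ᶠ s in 𝓝 (locOne E G), ∀ Y : E,
    locActDeriv E F K a s (dorb E F K a Y) =
      fderiv ℝ (locProj E F K a) s (locField (E := E) (G := G) Y s) := by
  have hd1 : ∀ᶠ s in 𝓝 (locOne E G), DifferentiableAt ℝ (locAct E F K a) (s, locBase F K a) :=
    (Continuous.tendsto (f := fun s : E ↦ (s, locBase F K a))
      (by fun_prop) (locOne E G)).eventually
      (eventually_differentiableAt (contDiffAt_locAct hM a))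
  have hd2 : ∀ᶠ s in 𝓝 (locOne E G), DifferentiableAt ℝ (locMul E G) (s, locOne E G) :=
    (Continuous.tendsto (f := fun s : E ↦ (s, locOne E G)) (by fun_prop) (locOne E G)).eventually
      (eventually_differentiableAt contDiffAt_locMul)
  have hd3 := eventually_differentiableAt (contDiffAt_locProj hM a)
  have hsrc : ∀ᶠ s' in 𝓝 (locOne E G),
      ((a * (extChartAt 𝓘(ℝ, E) (1 : G)).symm s' : G) : G ⧸ K) ∈
        (extChartAt 𝓘(ℝ, F) (a : G ⧸ K)).source := by
    have hc : ContinuousAt (fun s' ↦ ((a * (extChartAt 𝓘(ℝ, E) (1 : G)).symm s' : G) : G ⧸ K))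
        (locOne E G) :=
      (hM.contMDiff_mk.continuous.continuousAt).comp
        ((contMDiffAt_const (I := 𝓘(ℝ, E)) (n := ∞) (c := a)).mul
          contMDiffAt_symm_locOne).continuousAt
    refine hc ?_
    beta_reduce
    rw [symm_locOne, mul_one]
    exact extChartAt_source_mem_nhds _
  have hev : ∀ᶠ p in 𝓝 (locOne E G, locOne E G),
      locAct E F K a (p.1, locProj E F K a p.2) = locProj E F K a (locMul E G p) := by
    filter_upwards [eventually_symm_locMul, (continuous_snd.tendsto
      (locOne E G, locOne E G)).eventually hsrc] with p hp hp2
    rw [locAct, locProj, locProj, (extChartAt 𝓘(ℝ, F) (a : G ⧸ K)).left_inv hp2, hp,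
      MulAction.Quotient.smul_coe, smul_eq_mul]
    congr 2
    group
  filter_upwards [hev.curry_nhds, hd1, hd2, hd3, locOne_mem_nhds] with s hs hd1 hd2 hd3 hst Y
  have e1 : HasFDerivAt (fun s' ↦ locAct E F K a (s, locProj E F K a s')) _ (locOne E G) :=
    HasFDerivAt.comp (g := fun y ↦ locAct E F K a (s, y)) (g' := locActDeriv E F K a s)
      (locOne E G) (by
      rw [locProj_one]
      exact (DifferentiableAt.comp (f := fun y ↦ (s, y)) (locBase F K a) hd1
      ((differentiableAt_const s).prodMk differentiableAt_id)).hasFDerivAt)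
      ((contDiffAt_locProj hM a).differentiableAt (by simp)).hasFDerivAt
  have e2 : HasFDerivAt (fun s' ↦ locProj E F K a (locMul E G (s, s'))) _ (locOne E G) :=
    HasFDerivAt.comp (g := locProj E F K a) (g' := fderiv ℝ (locProj E F K a) s)
      (locOne E G) (by
      rw [locMul_one_right hst]
      exact hd3.hasFDerivAt)
      (DifferentiableAt.comp (f := fun t ↦ (s, t)) (locOne E G) hd2
      ((differentiableAt_const s).prodMk differentiableAt_id)).hasFDerivAt
  have e3 := e1.unique (e2.congr_of_eventuallyEq hs)
  rw [fderiv_locProj hM] at e3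
  exact congrArg (fun L : E →L[ℝ] F ↦ L Y) e3

/-- Differentiate `eventually_locActDeriv_dorb` along `X`. The second derivative of the projection
is symmetric in `X`, `Y`, so antisymmetrising leaves the projected difference of derivatives of
left-invariant fields, that is, the bracket. -/
lemma actJac_sub (a : G) (X Y : E) :
    actJac E F K a X (dorb E F K a Y) - actJac E F K a Y (dorb E F K a X) =
      dorb E F K a (lieB G X Y) := by
  have hq := contDiffAt_locProj hM a
  have hq2 : HasFDerivAt (fderiv ℝ (locProj E F K a)) _ (locOne E G) :=
    ((hq.fderiv_right (m := ∞) (by simp)).differentiableAt (by simp)).hasFDerivAt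
  have hJ := hasFDerivAt_locActDeriv hM a
  have key : ∀ X Y : E, actJac E F K a X (dorb E F K a Y) =
      fderiv ℝ (fderiv ℝ (locProj E F K a)) (locOne E G) X Y +
        dorb E F K a (fderiv ℝ (locField (E := E) (G := G) Y) (locOne E G) X) := by
    intro X Y
    have h1 := hJ.clm_apply (hasFDerivAt_const (dorb E F K a Y) _)
    have h2 := hq2.clm_apply ((contDiffAt_locField (E := E) (G := G) Y).differentiableAt
      (by simp)).hasFDerivAt
    have h3 : (fun s ↦ locActDeriv E F K a s (dorb E F K a Y)) =ᶠ[𝓝 (locOne E G)]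
        fun s ↦ fderiv ℝ (locProj E F K a) s (locField (E := E) (G := G) Y s) := by
      filter_upwards [eventually_locActDeriv_dorb hM a] with s hs using hs Y
    have h4 := congrArg (fun L : E →L[ℝ] F ↦ L X) (h1.unique (h2.congr_of_eventuallyEq h3))
    simp only [add_apply, ContinuousLinearMap.comp_apply, ContinuousLinearMap.flip_apply,
      zero_apply, map_zero, zero_add, locField_one, fderiv_locProj hM] at h4
    rw [h4, add_comm]
  have hs : minSmoothness ℝ 2 ≤ ∞ := by
    rw [minSmoothness_of_isRCLikeNormedField]
    exact WithTop.coe_le_coe.2 le_top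
  rw [key, key, (hq.isSymmSndFDerivAt hs).eq X Y, lieB_eq, map_sub]
  abel

end LocalAction

/-! ### Traces of adjoint, symmetric and skew endomorphisms -/

section LinearAlgebra

variable {V : Type*} [AddCommGroup V] [Module ℝ V] [FiniteDimensional ℝ V]
  {g : LinearMap.BilinForm ℝ V}

/-- The isomorphism of `V` with its dual given by `g` conjugates `L` into the transpose of `L'`. -/
lemma trace_eq_of_adjoint (hn : g.Nondegenerate) {L L' : V →ₗ[ℝ] V}
    (h : ∀ u v, g (L u) v = g u (L' v)) : LinearMap.trace ℝ V L = LinearMap.trace ℝ V L' := by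
  have h1 : Module.Dual.transpose L' = (g.toDual hn).conj L := by
    ext f v
    obtain ⟨u, rfl⟩ := (g.toDual hn).surjective f
    rw [LinearEquiv.conj_apply_apply, LinearEquiv.symm_apply_apply, LinearMap.BilinForm.toDual_def,
      h]
    rfl
  rw [← LinearMap.trace_transpose' L', h1, LinearMap.trace_conj']

lemma trace_eq_zero_of_skew (hn : g.Nondegenerate) {L : V →ₗ[ℝ] V}
    (h : ∀ u v, g (L u) v = - g u (L v)) : LinearMap.trace ℝ V L = 0 := by
  have := trace_eq_of_adjoint hn (L := L) (L' := -L) (by simp [h])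
  rw [map_neg] at this
  linarith

/-- The trace of a product of a symmetric and a skew endomorphism vanishes. -/
lemma trace_comp_eq_zero (hn : g.Nondegenerate) {A B : V →ₗ[ℝ] V}
    (hA : ∀ u v, g (A u) v = g u (A v)) (hB : ∀ u v, g (B u) v = - g u (B v)) :
    LinearMap.trace ℝ V (A ∘ₗ B) = 0 := by
  have := trace_eq_of_adjoint hn (L := A ∘ₗ B) (L' := -(B ∘ₗ A)) (by simp [hA, hB])
  have h2 := LinearMap.trace_comp_comm' A B
  rw [map_neg] at this
  linarith

lemma exists_endo (hn : g.Nondegenerate) (B : LinearMap.BilinForm ℝ V) :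
    ∃ L : V →ₗ[ℝ] V, ∀ u v, g (L u) v = B u v :=
  ⟨B.symmCompOfNondegenerate g hn, fun u v ↦
    LinearMap.BilinForm.symmCompOfNondegenerate_left_apply B hn v u⟩

lemma exists_adjoint (hn : g.Nondegenerate) (L : V →ₗ[ℝ] V) :
    ∃ L' : V →ₗ[ℝ] V, ∀ u v, g (L' u) v = g u (L v) := by
  obtain ⟨L', h⟩ := exists_endo hn (g.compl₁₂ LinearMap.id L)
  exact ⟨L', fun u v ↦ by rw [h]; simp⟩

lemma endo_unique (hn : g.Nondegenerate) {L L' : V →ₗ[ℝ] V} (h : ∀ u v, g (L u) v = g (L' u) v) :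
    L = L' := by
  ext u
  have := hn.1 (L u - L' u) (fun v ↦ by rw [map_sub, LinearMap.sub_apply, h, sub_self])
  exact sub_eq_zero.1 this

/-- The contraction of the covariant derivative of a symmetric form `g(A ·, ·)` in terms of the
torsion-free connection determined by the skew bilinear map `c`. -/
lemma trace_connection (hn : g.Nondegenerate) (hs : ∀ u v, g u v = g v u)
    (c Λ : V →ₗ[ℝ] V →ₗ[ℝ] V) (hc : ∀ u v, c u v = - c v u)
    (htr : ∀ u, LinearMap.trace ℝ V (c u) = 0)
    (hΛ : ∀ u v w, 2 * g (Λ u v) w = g (c u v) w + g (c w u) v + g (c w v) u)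
    {A : V →ₗ[ℝ] V} (hA : ∀ u v, g (A u) v = g u (A v)) (w : V) {D : V →ₗ[ℝ] V}
    (hD : ∀ u v, g (D u) v = - g (A (Λ u v)) w - g (A v) (Λ u w)) :
    LinearMap.trace ℝ V D = LinearMap.trace ℝ V (A ∘ₗ c w) := by
  have hB : ∀ y, ∃ B : V →ₗ[ℝ] V, ∀ u v, g (B u) v = g (c u v) y := fun y ↦ by
    obtain ⟨B, h⟩ := exists_endo hn (c.compr₂ (g.flip y))
    exact ⟨B, fun u v ↦ by rw [h]; simp⟩
  have hBs : ∀ {y} {B : V →ₗ[ℝ] V}, (∀ u v, g (B u) v = g (c u v) y) →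
      ∀ u v, g (B u) v = - g u (B v) := fun {y B} h u v ↦ by
    rw [h, hs u, h, hc u v, map_neg, LinearMap.neg_apply]
  obtain ⟨B₁, h1⟩ := hB (A w)
  obtain ⟨B₂, h2⟩ := hB w
  obtain ⟨C₁, h3⟩ := exists_adjoint hn (c (A w))
  obtain ⟨C₂, h4⟩ := exists_adjoint hn (B₂ ∘ₗ A)
  obtain ⟨C₃, h5⟩ := exists_adjoint hn (c.flip w ∘ₗ A)
  have hcw : c.flip w = - c w := by ext v; simp [hc v w]
  -- Koszul's formula used twice gives six terms. `B₁` is skew; `c (A w)` and its adjoint `C₁` are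
  -- traceless by `htr`; `C₂` is adjoint to a product of a skew and a symmetric map. Only `A ∘ₗ
  -- c.flip w` and `C₃` survive, each with trace `-tr(A ∘ c w)`, and the factor `-1/2` turns their
  -- sum into `tr(A ∘ c w)`.
  have e : D = (-(1 / 2 : ℝ)) • (B₁ + c (A w) + C₁ + A ∘ₗ c.flip w + C₂ + C₃) := by
    refine endo_unique hn fun u v ↦ ?_
    have e1 := hΛ u v (A w)
    have e2 := hΛ u w (A v)
    simp only [LinearMap.smul_apply, LinearMap.add_apply, map_smul, map_add, smul_eq_mul,
      LinearMap.comp_apply, h1, h3, h4, h5, LinearMap.flip_apply]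
    rw [hD, hA, hs (A v), hs u (B₂ (A v)), h2, hs u (c (A v) w), hA (c u w) v,
      hs u (c (A w) v)]
    linarith
  have t1 := trace_eq_zero_of_skew hn (hBs h1)
  have t2 := trace_eq_of_adjoint hn h3
  have t3 := trace_eq_of_adjoint hn h4
  have t4 := trace_eq_of_adjoint hn h5
  have t5 := trace_comp_eq_zero hn hA (hBs h2)
  rw [e, map_smul]
  simp only [map_add, t1, t2, t3, t4, htr, hcw, smul_eq_mul]
  rw [LinearMap.trace_comp_comm' A B₂, t5, LinearMap.trace_comp_comm' A (-c w)]
  simp only [LinearMap.comp_neg, map_neg]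
  ring

/-- The trace form on symmetric endomorphisms is positive definite. -/
lemma trace_comp_self_pos (hs : ∀ u v, g u v = g v u) (hpos : ∀ u, u ≠ 0 → 0 < g u u)
    {A : V →ₗ[ℝ] V} (hA : ∀ u v, g (A u) v = g u (A v)) (h0 : A ≠ 0) :
    0 < LinearMap.trace ℝ V (A ∘ₗ A) := by
  obtain ⟨b, hb⟩ := LinearMap.BilinForm.exists_orthogonal_basis (B := g) (⟨fun u v ↦ hs u v⟩)
  have hbb : ∀ i, 0 < g (b i) (b i) := fun i ↦ hpos _ (b.ne_zero i)
  have hnn : ∀ u, 0 ≤ g u u := fun u ↦ by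
    rcases eq_or_ne u 0 with rfl | h
    · simp
    · exact (hpos u h).le
  have hrepr : ∀ v i, b.repr v i = g v (b i) / g (b i) (b i) := by
    intro v i
    rw [eq_div_iff (hbb i).ne']
    conv_rhs => rw [← b.sum_repr v]
    rw [map_sum, LinearMap.sum_apply, Finset.sum_eq_single i]
    · simp
    · intro j _ hj
      have : g (b j) (b i) = 0 := hb hj
      simp [this]
    · simp
  -- In a `g`-orthogonal basis the trace is `∑ g(A b_i, A b_i) / g(b_i, b_i)`.
  rw [LinearMap.trace_eq_matrix_trace ℝ b, Matrix.trace]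
  simp only [Matrix.diag_apply, LinearMap.toMatrix_apply, hrepr, LinearMap.comp_apply,
    fun i ↦ hA (A (b i)) (b i)]
  have hex : ∃ i, A (b i) ≠ 0 := by
    by_contra! h
    exact h0 (b.ext fun i ↦ by simpa using h i)
  obtain ⟨i, hi⟩ := hex
  exact Finset.sum_pos' (fun j _ ↦ div_nonneg (hnn _) (hbb j).le)
    ⟨i, Finset.mem_univ i, div_pos (hpos _ hi) (hbb i)⟩

end LinearAlgebra

/-! ### The divergence of an invariant tensor -/

section Divergence

variable {E : Type*} [NormedAddCommGroup E] [NormedSpace ℝ E] [CompleteSpace E]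
  {F : Type*} [NormedAddCommGroup F] [NormedSpace ℝ F] [FiniteDimensional ℝ F]
  {G : Type*} [Group G] [TopologicalSpace G] [ChartedSpace E G] [LieGroup 𝓘(ℝ, E) ∞ G]
  {K : Subgroup G} [ChartedSpace F (G ⧸ K)] [IsManifold 𝓘(ℝ, F) ∞ (G ⧸ K)]

variable (E G) in
/-- The Lie bracket of `G` as a bilinear map on the model space. -/
def lieBL : E →ₗ[ℝ] E →ₗ[ℝ] E :=
  LinearMap.mk₂ ℝ (lieB G)
    (fun X X' Y ↦ add_lie (L := GroupLieAlgebra 𝓘(ℝ, E) G)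
      (M := GroupLieAlgebra 𝓘(ℝ, E) G) X X' Y)
    (fun r X Y ↦ smul_lie (L := GroupLieAlgebra 𝓘(ℝ, E) G)
      (M := GroupLieAlgebra 𝓘(ℝ, E) G) r X Y)
    (fun X Y Y' ↦ lie_add (L := GroupLieAlgebra 𝓘(ℝ, E) G)
      (M := GroupLieAlgebra 𝓘(ℝ, E) G) X Y Y')
    (fun r X Y ↦ lie_smul (L := GroupLieAlgebra 𝓘(ℝ, E) G)
      (M := GroupLieAlgebra 𝓘(ℝ, E) G) r X Y)

lemma lieBL_apply (X Y : E) : lieBL E G X Y = lieB G X Y := rfl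

/-- The value of a metric at `x`. -/
lemma metric_symm (g : Metric F (G ⧸ K)) (x : G ⧸ K) (u v : F) :
    formAt g.inner x u v = formAt g.inner x v u := g.symm x u v

lemma metric_pos (g : Metric F (G ⧸ K)) (x : G ⧸ K) (u : F) (hu : u ≠ 0) :
    0 < formAt g.inner x u u := g.pos x u hu

lemma endo_apply (g : Metric F (G ⧸ K)) (x : G ⧸ K) (B : LinearMap.BilinForm ℝ F) (u v : F) :
    formAt g.inner x (endo g x B u) v = B u v :=
  LinearMap.BilinForm.symmCompOfNondegenerate_left_apply B (formAt_nondegenerate g x) v u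

lemma endo_eq (g : Metric F (G ⧸ K)) (x : G ⧸ K) {B : LinearMap.BilinForm ℝ F} {L : F →ₗ[ℝ] F}
    (h : ∀ u v, formAt g.inner x (L u) v = B u v) : endo g x B = L :=
  endo_unique (formAt_nondegenerate g x) fun u v ↦ by rw [endo_apply, h]

lemma endo_symm (g : Metric F (G ⧸ K)) (x : G ⧸ K) {B : LinearMap.BilinForm ℝ F}
    (hB : ∀ u v, B u v = B v u) (u v : F) :
    formAt g.inner x (endo g x B u) v = formAt g.inner x u (endo g x B v) := by
  rw [endo_apply, metric_symm g x u, endo_apply, hB]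

lemma formAt_christoffel (g : Metric F (G ⧸ K)) (x : G ⧸ K) (u v w : F) :
    formAt g.inner x (christoffel g x u v) w =
      (partialDeriv (metricTensor g) x u v w + partialDeriv (metricTensor g) x v u w
    - partialDeriv (metricTensor g) x w u v) / 2 :=
  LinearMap.BilinForm.apply_toDual_symm_apply (hB := formAt_nondegenerate g x)
    (koszulForm g x u v) w

variable (hM : IsQuotientManifold E F K) {g : Metric F (G ⧸ K)} (hg : IsInvariantMetric g)

/-- An invariant metric as an invariant tensor. -/
def metricInv (hg : IsInvariantMetric g) : invTensors F K := ⟨metricTensor g, g.symm, hg⟩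

lemma formAt_metricInv (hg : IsInvariantMetric g) (x : G ⧸ K) :
    formAt (metricInv hg).1 x = formAt g.inner x := rfl

include hM hg in
/-- The divergence of an invariant tensor, in terms of the bracket. -/
theorem divergence_invariant (T : invTensors F K) (a : G) {σ : F →ₗ[ℝ] E}
    (hσ : ∀ u, dorb E F K a (σ u) = u)
    (htr : ∀ u, LinearMap.trace ℝ F (dorb E F K a ∘ₗ lieBL E G (σ u) ∘ₗ σ) = 0) (w : F) :
    divergence g T.1 (a : G ⧸ K) w = - LinearMap.trace ℝ F
      (endo g (a : G ⧸ K) (formAt T.1 (a : G ⧸ K)) ∘ₗ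
        dorb E F K a ∘ₗ lieBL E G (σ w) ∘ₗ σ) := by
  set x : G ⧸ K := (a : G ⧸ K) with hx
  set c : F →ₗ[ℝ] F →ₗ[ℝ] F := ((lieBL E G).compl₁₂ σ σ).compr₂ (dorb E F K a).toLinearMap with hc
  have hcu : ∀ u, dorb E F K a ∘ₗ lieBL E G (σ u) ∘ₗ σ = c u := fun u ↦ rfl
  have hcuv : ∀ u v, c u v = dorb E F K a (lieB G (σ u) (σ v)) := fun u v ↦ rfl
  simp only [hcu] at htr ⊢
  -- The Jacobian at `aK` of the action field with value `u` there, lifted to the Lie algebra by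
  -- `σ`.
  let b : F →ₗ[ℝ] F →ₗ[ℝ] F := LinearMap.mk₂ ℝ (fun u v ↦ actJac E F K a (σ u) v)
    (by simp) (by simp) (by simp) (by simp)
  have hb : ∀ u v, b u v = actJac E F K a (σ u) v := fun u v ↦ rfl
  have hbc : ∀ u v, b u v - b v u = c u v := fun u v ↦ by
    have := actJac_sub hM a (σ u) (σ v)
    rwa [hσ, hσ] at this
  have hpd : ∀ (S : invTensors F K) (u v w : F), partialDeriv S.1 x u v w =
      - formAt S.1 x (b u v) w - formAt S.1 x v (b u w) := fun S u v w ↦ by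
    have := partialDeriv_invariant hM (invTensors_apply S) a (σ u) v w
    rwa [hσ] at this
  rw [divergence]
  -- In `Λ = Γ + b` the derivatives of `g` cancel: by `hpd` for the metric itself they are expressed
  -- by `b`, and only its antisymmetrisation `c` remains in Koszul's formula. The same identity for
  -- `T` turns `∇_u T` into minus the action of `Λ u`.
  refine congrArg Neg.neg (trace_connection (formAt_nondegenerate g x) (metric_symm g x) c
    (christoffel g x + b) (fun u v ↦ ?_) htr (fun u v w ↦ ?_)
    (endo_symm g x fun u v ↦ invTensors_symm T x u v) w fun u v ↦ ?_)
  · rw [hcuv, hcuv, ← lieB_neg_swap, map_neg]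
  · have e := hpd (metricInv hg)
    rw [formAt_metricInv] at e
    simp only [LinearMap.add_apply, map_add, formAt_christoffel]
    change ∀ u v w, partialDeriv (metricTensor g) x u v w = _ at e
    rw [e, e, e, ← hbc, ← hbc, ← hbc]
    simp only [map_sub, LinearMap.sub_apply]
    rw [metric_symm g x v, metric_symm g x u, metric_symm g x u]
    ring
  · rw [endo_apply, endo_apply, endo_apply]
    simp only [covDeriv, LinearMap.mk₂_apply, LinearMap.add_apply, map_add]
    rw [hpd]
    ring

end Divergence

/-! ### Reductive splittings: divergence at the origin and fixed vectors -/

section Reductive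

variable {E : Type*} [NormedAddCommGroup E] [NormedSpace ℝ E] [CompleteSpace E]
  {F : Type*} [NormedAddCommGroup F] [NormedSpace ℝ F] [FiniteDimensional ℝ F]
  {G : Type*} [Group G] [TopologicalSpace G] [ChartedSpace E G] [LieGroup 𝓘(ℝ, E) ∞ G]
  {K : Subgroup G} [ChartedSpace F (G ⧸ K)] [IsManifold 𝓘(ℝ, F) ∞ (G ⧸ K)]

/-- Differentiate `Ad(a γ(t) a⁻¹) Ad(a) Y = Ad(a) Ad(γ(t)) Y` at `t = 0`. -/
lemma AdE_lieB (a : G) (X Y : E) : AdE a (lieB G X Y) = lieB G (AdE a X) (AdE a Y) := by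
  obtain ⟨γ, hγ⟩ := exists_isOneParam (G := G) X
  have h1 := (AdE (E := E) a).hasFDerivAt.comp_hasDerivAt (0 : ℝ) (hγ.hasDerivAt_AdE Y)
  have hd : MDifferentiableAt 𝓘(ℝ, ℝ) 𝓘(ℝ, E) (fun t ↦ a * γ t * a⁻¹) 0 :=
    (mdifferentiableAt_conj (E := E) a (γ 0)).comp (0 : ℝ) (hγ.mdifferentiableAt 0)
  have hz : a * γ 0 * a⁻¹ = 1 := by rw [hγ.zero]; group
  obtain ⟨L, hL, hL'⟩ := hasFDerivAt_AdE_comp hd hz (AdE a Y)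
  have h2 := hL.hasDerivAt
  have h3 : tderiv (F := ℝ) (F' := E) (fun t ↦ a * γ t * a⁻¹) 0 1 = AdE a X := by
    rw [tderiv_comp (F := ℝ) (F' := E) (F'' := E) (g := fun b : G ↦ a * b * a⁻¹) (f := γ) hγ.zero
      (mdifferentiableAt_conj _ _) (hγ.mdifferentiableAt 0), ContinuousLinearMap.comp_apply,
      hγ.tderiv_zero]
    rfl
  rw [hL', h3] at h2
  refine h1.unique (h2.congr_of_eventuallyEq (Eventually.of_forall fun t ↦ ?_))
  simp only [Function.comp_apply]
  rw [← ContinuousLinearMap.comp_apply, ← ContinuousLinearMap.comp_apply, ← AdE_mul, ← AdE_mul,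
    inv_mul_cancel_right]

variable (K) in
/-- `σ` is a `K`-equivariant right inverse of the differential of the projection at `1`. -/
structure IsEquivariantSection (σ : F →ₗ[ℝ] E) : Prop where
  dpi_apply : ∀ u, dpi E F K (σ u) = u
  AdE_apply : ∀ k ∈ K, ∀ u, AdE k (σ u) = σ (dact F k ((1 : G) : G ⧸ K) u)

variable (K) in
/-- The map `ad_𝔭 X` on the tangent space at `o`. -/
def adF (σ : F →ₗ[ℝ] E) (X : E) : F →ₗ[ℝ] F := (dpi E F K).toLinearMap ∘ₗ lieBL E G X ∘ₗ σ

lemma adF_apply (σ : F →ₗ[ℝ] E) (X : E) (u : F) :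
    adF K σ X u = dpi E F K (lieB G X (σ u)) := rfl

variable (K) in
/-- The form `T` at `o` is the symmetric part of `ad_𝔭 X`. -/
def IsSymmAd (g : Metric F (G ⧸ K)) (σ : F →ₗ[ℝ] E) (X : E) (T : BilinField F (G ⧸ K)) : Prop :=
  ∀ u v, formAt T ((1 : G) : G ⧸ K) u v =
    (1 / 2) * (formAt g.inner ((1 : G) : G ⧸ K) (adF K σ X u) v +
      formAt g.inner ((1 : G) : G ⧸ K) u (adF K σ X v))

variable {σ : F →ₗ[ℝ] E} (hM : IsQuotientManifold E F K) (hσ : IsEquivariantSection K σ)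
  {g : Metric F (G ⧸ K)} (hg : IsInvariantMetric g)

include hM

include hσ in
-- Infinitesimal form of `Ad(K) 𝔭 ⊆ 𝔭`: the map `id - σ ∘ dπ` kills `Ad(k) σ(u)` for all `k ∈ K`,
-- hence also the bracket with `𝔨`.
lemma lieB_section {Z : E} (hZ : dpi E F K Z = 0) (u : F) :
    σ (dpi E F K (lieB G Z (σ u))) = lieB G Z (σ u) := by
  have h := map_lieB_eq_zero hM (.id ℝ E - (LinearMap.toContinuousLinearMap σ).comp (dpi E F K))
    (Y := σ u) (fun k hk ↦ by
      simp [hσ.AdE_apply k hk, hσ.dpi_apply]) hZ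
  exact (sub_eq_zero.1 h).symm

include hσ in
-- For `X = σ(u)`, `ad X` maps `ker dπ = 𝔨` into the range of `σ`. So its `𝔨`-block vanishes and its
-- whole trace is that of the other diagonal block, `ad_𝔭 X`.
lemma trace_adF [FiniteDimensional ℝ E] {u : F}
    (h : LinearMap.trace ℝ E (lieBL E G (σ u)) = 0) : LinearMap.trace ℝ F (adF K σ (σ u)) = 0 := by
  set P : E →ₗ[ℝ] E := σ ∘ₗ (dpi E F K).toLinearMap with hP
  have hPσ : P ∘ₗ P = P := by
    ext X
    simp [hP, hσ.dpi_apply]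
  have h1 : P ∘ₗ lieBL E G (σ u) ∘ₗ (1 - P) = lieBL E G (σ u) ∘ₗ (1 - P) := by
    ext X
    have hZ : dpi E F K (X - σ (dpi E F K X)) = 0 := by rw [map_sub, hσ.dpi_apply, sub_self]
    have := lieB_section hM hσ hZ u
    rw [← lieB_neg_swap, map_neg, map_neg, neg_inj] at this
    exact this
  have h2 : LinearMap.trace ℝ E (lieBL E G (σ u) ∘ₗ (1 - P)) = 0 := by
    rw [← h1, LinearMap.trace_comp_comm', LinearMap.comp_assoc]
    have : (1 - P) ∘ₗ P = 0 := by
      rw [LinearMap.sub_comp, hPσ]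
      exact sub_self P
    rw [this, LinearMap.comp_zero, map_zero]
  have h3 : LinearMap.trace ℝ E (lieBL E G (σ u) ∘ₗ P) = 0 := by
    have : lieBL E G (σ u) ∘ₗ (1 - P) = lieBL E G (σ u) - lieBL E G (σ u) ∘ₗ P := by
      rw [LinearMap.comp_sub]; rfl
    rw [this, map_sub, h] at h2
    linarith
  rw [adF, LinearMap.trace_comp_comm', LinearMap.comp_assoc]
  exact h3

omit hM in
lemma smul_base (a : G) : a • ((1 : G) : G ⧸ K) = (a : G ⧸ K) := by
  rw [MulAction.Quotient.smul_coe, smul_eq_mul, mul_one]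

variable (F) in
/-- The differential of the action of `a` at `o`, as a linear equivalence. -/
def dactEquiv (a : G) : F ≃ₗ[ℝ] F :=
  LinearEquiv.ofLinearMap (dact F a ((1 : G) : G ⧸ K)).toLinearMap
    (dact F a⁻¹ (a : G ⧸ K)).toLinearMap
    (LinearMap.ext fun u ↦ dact_apply_inv hM a (smul_base a) u)
    (LinearMap.ext fun u ↦ dact_inv_apply hM a (smul_base a) u)

lemma dactEquiv_apply (a : G) (u : F) : dactEquiv F hM a u = dact F a ((1 : G) : G ⧸ K) u := rfl

lemma formAt_dactEquiv (T : invTensors F K) (a : G) (u v : F) :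
    formAt T.1 (a : G ⧸ K) (dactEquiv F hM a u) (dactEquiv F hM a v) =
      formAt T.1 ((1 : G) : G ⧸ K) u v := by
  have := invTensors_apply T a ((1 : G) : G ⧸ K) u v
  rw [smul_base] at this
  exact this

include hg

lemma metric_dactEquiv (a : G) (u v : F) :
    formAt g.inner (a : G ⧸ K) (dactEquiv F hM a u) (dactEquiv F hM a v) =
      formAt g.inner ((1 : G) : G ⧸ K) u v :=
  formAt_dactEquiv hM (metricInv hg) a u v

lemma endo_dactEquiv (T : invTensors F K) (a : G) :
    endo g (a : G ⧸ K) (formAt T.1 (a : G ⧸ K)) =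
      (dactEquiv F hM a).conj (endo g ((1 : G) : G ⧸ K) (formAt T.1 ((1 : G) : G ⧸ K))) := by
  refine endo_eq g _ fun u v ↦ ?_
  obtain ⟨u, rfl⟩ := (dactEquiv F hM a).surjective u
  obtain ⟨v, rfl⟩ := (dactEquiv F hM a).surjective v
  rw [LinearEquiv.conj_apply_apply, LinearEquiv.symm_apply_apply, metric_dactEquiv hM hg,
    endo_apply, formAt_dactEquiv]

include hσ in
lemma divergence_section (htr : ∀ u, LinearMap.trace ℝ F (adF K σ (σ u)) = 0) (T : invTensors F K)
    (a : G) (u : F) : divergence g T.1 (a : G ⧸ K) (dact F a ((1 : G) : G ⧸ K) u) =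
      - LinearMap.trace ℝ F (endo g ((1 : G) : G ⧸ K) (formAt T.1 ((1 : G) : G ⧸ K)) ∘ₗ
        adF K σ (σ u)) := by
  set φ := dactEquiv F hM a with hφ
  -- The section transported to `aK`. Everything there is conjugate by `φ` to the situation at `o`,
  -- and traces do not change.
  set τ : F →ₗ[ℝ] E := σ ∘ₗ φ.symm.toLinearMap with hτ
  have hc : ∀ v, (dorb E F K a).toLinearMap ∘ₗ lieBL E G (τ v) ∘ₗ τ =
      φ.conj (adF K σ (σ (φ.symm v))) := fun v ↦ rfl
  have h := divergence_invariant hM hg T a (σ := τ) (fun v ↦ by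
    change φ (dpi E F K (σ (φ.symm v))) = v
    rw [hσ.dpi_apply, LinearEquiv.apply_symm_apply]) (fun v ↦ by
    rw [hc, LinearMap.trace_conj', htr]) (φ u)
  rw [hc, LinearEquiv.symm_apply_apply, endo_dactEquiv hM hg, ← hφ, ← LinearEquiv.conj_comp,
    LinearMap.trace_conj'] at h
  exact h

include hσ in
lemma mem_divFree_iff (htr : ∀ u, LinearMap.trace ℝ F (adF K σ (σ u)) = 0) (T : invTensors F K) :
    T ∈ divFree g ↔ ∀ u, LinearMap.trace ℝ F
      (endo g ((1 : G) : G ⧸ K) (formAt T.1 ((1 : G) : G ⧸ K)) ∘ₗ adF K σ (σ u)) = 0 := by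
  refine ⟨fun h u ↦ ?_, fun h x w ↦ ?_⟩
  · have h1 := divergence_section hM hσ hg htr T 1 u
    rw [h _ _] at h1
    linarith
  · obtain ⟨a, rfl⟩ := QuotientGroup.mk_surjective x
    obtain ⟨u, rfl⟩ := (dactEquiv F hM a).surjective w
    exact (divergence_section hM hσ hg htr T a u).trans (by rw [h, neg_zero])

omit hM hg in
-- If `A` is symmetric and `C` is adjoint to `B`, then `tr(A C) = tr(A B)`; symmetrising `ad_𝔭 X`
-- does not affect the trace.
lemma innerG_symmAd {X : E} {S : invTensors F K} (hS : IsSymmAd K g σ X S.1) (T : invTensors F K) :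
    innerG g T S = LinearMap.trace ℝ F
      (endo g ((1 : G) : G ⧸ K) (formAt T.1 ((1 : G) : G ⧸ K)) ∘ₗ adF K σ X) := by
  have hn := formAt_nondegenerate g ((1 : G) : G ⧸ K)
  obtain ⟨C, hC⟩ := exists_adjoint hn (adF K σ X)
  have h1 : endo g ((1 : G) : G ⧸ K) (formAt S.1 ((1 : G) : G ⧸ K)) =
      (1 / 2 : ℝ) • (adF K σ X + C) := by
    refine endo_eq g _ fun u v ↦ ?_
    rw [hS u v]
    simp only [LinearMap.smul_apply, LinearMap.add_apply, map_smul, map_add, hC, smul_eq_mul]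
  have hA : ∀ u v, _ := endo_symm g ((1 : G) : G ⧸ K) (B := formAt T.1 ((1 : G) : G ⧸ K))
    (fun u v ↦ invTensors_symm T _ u v)
  have h2 := trace_eq_of_adjoint hn
    (L := endo g ((1 : G) : G ⧸ K) (formAt T.1 ((1 : G) : G ⧸ K)) ∘ₗ C)
    (L' := adF K σ X ∘ₗ endo g ((1 : G) : G ⧸ K) (formAt T.1 ((1 : G) : G ⧸ K)))
    (fun u v ↦ by simp [hA, hC])
  rw [LinearMap.trace_comp_comm' _ (adF K σ X)] at h2
  rw [innerG, h1, LinearMap.comp_smul, LinearMap.comp_add, map_smul, map_add, h2, smul_eq_mul]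
  ring

omit hg in
include hσ in
lemma adF_AdE {k : G} (hk : k ∈ K) (X : E) (u : F) :
    adF K σ (AdE k X) (dact F k ((1 : G) : G ⧸ K) u) =
      dact F k ((1 : G) : G ⧸ K) (adF K σ X u) := by
  rw [adF_apply, ← hσ.AdE_apply k hk, ← AdE_lieB, dpi_AdE hM hk, adF_apply]

lemma metric_isotropy {k : G} (hk : k ∈ K) (u v : F) :
    formAt g.inner ((1 : G) : G ⧸ K) (dact F k ((1 : G) : G ⧸ K) u) (dact F k ((1 : G) : G ⧸ K) v) =
      formAt g.inner ((1 : G) : G ⧸ K) u v :=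
  invTensors_apply_isotropy (metricInv hg) hk u v

include hσ in
-- For `Ad(K)`-fixed `X`, `ad_𝔭 X` commutes with the isotropy representation, so its symmetric part
-- is an invariant form and extends.
lemma exists_isSymmAd {X : E} (hX : ∀ k ∈ K, AdE k X = X) :
    ∃ S : invTensors F K, IsSymmAd K g σ X S.1 := by
  set γ : F →L[ℝ] F →L[ℝ] ℝ := formCLM g.inner ((1 : G) : G ⧸ K) with hγ
  set C : F →L[ℝ] F := LinearMap.toContinuousLinearMap (adF K σ X) with hC
  set β : F →L[ℝ] F →L[ℝ] ℝ := (1 / 2 : ℝ) • (γ.comp C + (γ.flip.comp C).flip) with hβ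
  have hβ' : ∀ u v, β u v = (1 / 2) * (formAt g.inner ((1 : G) : G ⧸ K) (adF K σ X u) v +
      formAt g.inner ((1 : G) : G ⧸ K) u (adF K σ X v)) := fun u v ↦ rfl
  refine exists_invTensor hM (β := β) (fun u v ↦ ?_) fun k hk u v ↦ ?_
  · rw [hβ', hβ', metric_symm g _ (adF K σ X u), metric_symm g _ u, add_comm]
  · have h := adF_AdE hM hσ hk X
    rw [hX k hk] at h
    rw [hβ', hβ', h, h, metric_isotropy hM hg hk, metric_isotropy hM hg hk]

include hσ in
-- The functional `ℓ(u) = tr(A ∘ ad_𝔭 σ(u))` is isotropy-invariant because `A` commutes with the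
-- isotropy representation. Its metric dual `y` is therefore fixed, and `ℓ(y) = g(y, y) > 0` when `ℓ
-- ≠ 0`. This is the passage from all of `𝔭` to fixed vectors.
lemma exists_fixed_of_trace_ne_zero {T : invTensors F K} {w : F} (hw : LinearMap.trace ℝ F
      (endo g ((1 : G) : G ⧸ K) (formAt T.1 ((1 : G) : G ⧸ K)) ∘ₗ adF K σ (σ w)) ≠ 0) :
    ∃ y : F, (∀ k ∈ K, AdE k (σ y) = σ y) ∧ LinearMap.trace ℝ F
      (endo g ((1 : G) : G ⧸ K) (formAt T.1 ((1 : G) : G ⧸ K)) ∘ₗ adF K σ (σ y)) ≠ 0 := by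
  set A := endo g ((1 : G) : G ⧸ K) (formAt T.1 ((1 : G) : G ⧸ K)) with hA
  have hn := formAt_nondegenerate g ((1 : G) : G ⧸ K)
  set ℓ : F →ₗ[ℝ] ℝ := LinearMap.trace ℝ F ∘ₗ LinearMap.llcomp ℝ F F F A ∘ₗ
    (((lieBL E G).compl₁₂ σ σ).compr₂ (dpi E F K).toLinearMap) with hℓ
  have hℓ' : ∀ u, ℓ u = LinearMap.trace ℝ F (A ∘ₗ adF K σ (σ u)) := fun u ↦ rfl
  set y := ((formAt g.inner ((1 : G) : G ⧸ K)).toDual hn).symm ℓ with hy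
  have hy' : ∀ u, formAt g.inner ((1 : G) : G ⧸ K) y u = ℓ u := fun u ↦
    LinearMap.BilinForm.apply_toDual_symm_apply (hB := hn) ℓ u
  have hA' : ∀ k ∈ K, ∀ u, A (dact F k ((1 : G) : G ⧸ K) u) = dact F k ((1 : G) : G ⧸ K) (A u) := by
    intro k hk u
    refine sub_eq_zero.1 (hn.1 _ fun v ↦ ?_)
    obtain ⟨v, rfl⟩ := (dactEquiv F hM k).surjective v
    rw [dactEquiv_apply, map_sub, LinearMap.sub_apply, metric_isotropy hM hg hk, hA, endo_apply,
      endo_apply, sub_eq_zero]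
    exact invTensors_apply_isotropy T hk u v
  have hinv : ∀ k ∈ K, ∀ u, ℓ (dact F k ((1 : G) : G ⧸ K) u) = ℓ u := by
    intro k hk u
    rw [hℓ', hℓ', ← hσ.AdE_apply k hk]
    have : A ∘ₗ adF K σ (AdE k (σ u)) = (dactEquiv F hM k).conj (A ∘ₗ adF K σ (σ u)) := by
      ext v
      obtain ⟨v, rfl⟩ := (dactEquiv F hM k).surjective v
      rw [LinearEquiv.conj_apply_apply, LinearEquiv.symm_apply_apply, LinearMap.comp_apply,
        dactEquiv_apply, adF_AdE hM hσ hk, hA' k hk]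
      rfl
    rw [this, LinearMap.trace_conj']
  refine ⟨y, fun k hk ↦ ?_, ?_⟩
  · rw [hσ.AdE_apply k hk]
    congr 1
    refine sub_eq_zero.1 (hn.1 _ fun v ↦ ?_)
    obtain ⟨v, rfl⟩ := (dactEquiv F hM k).surjective v
    rw [dactEquiv_apply, map_sub, LinearMap.sub_apply, metric_isotropy hM hg hk, hy', hy',
      hinv k hk, sub_self]
  · rw [← hℓ', ← hy']
    refine (metric_pos g _ y fun h0 ↦ hw ?_).ne'
    rw [← hℓ', ← hy', h0, map_zero, LinearMap.zero_apply]

end Reductive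

/-! ### Orthogonal direct sums for a positive definite form -/

section OrthogonalSum

variable {V : Type*} [AddCommGroup V] [Module ℝ V]

/-- A vector of one summand that also lies in the span of the others is orthogonal to itself, hence
zero. -/
lemma isOrthogonalDirectSum_of_iSup_eq_top {B : LinearMap.BilinForm ℝ V}
    (hpos : ∀ x, x ≠ 0 → 0 < B x x) {n : ℕ} {W : Fin n → Submodule ℝ V}
    (horth : ∀ i j, i ≠ j → ∀ x ∈ W i, ∀ y ∈ W j, B x y = 0) (htop : ⨆ i, W i = ⊤) :
    IsOrthogonalDirectSum (fun x y ↦ B x y) W := by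
  refine ⟨DirectSum.isInternal_submodule_of_iSupIndep_of_iSup_eq_top (fun i ↦ ?_) htop, horth⟩
  rw [Submodule.disjoint_def]
  intro x hx hx'
  have hle : ⨆ j, ⨆ (_ : j ≠ i), W j ≤ LinearMap.ker (B x) :=
    iSup₂_le fun j hj y hy ↦ horth i j hj.symm x hx y hy
  by_contra h0
  exact (hpos x h0).ne' (hle hx')

lemma sub_projectionOnto_mem {p q : Submodule ℝ V}
    (h : IsCompl p q) (v : V) : v - (p.projectionOnto q h v : V) ∈ q := by
  rw [← Submodule.projectionOnto_apply_eq_zero_iff h, map_sub,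
    Submodule.projectionOnto_apply_left, sub_self]

variable [FiniteDimensional ℝ V]

lemma sup_orthogonal_eq_top {B : LinearMap.BilinForm ℝ V} (hs : ∀ x y, B x y = B y x)
    (hpos : ∀ x, x ≠ 0 → 0 < B x x) (W : Submodule ℝ V) : W ⊔ B.orthogonal W = ⊤ := by
  have hr : B.IsRefl := fun x y h ↦ by rw [hs, h]
  refine (LinearMap.BilinForm.isCompl_orthogonal_iff_disjoint hr).2 ?_ |>.sup_eq_top
  rw [Submodule.disjoint_def]
  intro x hx hx'
  by_contra h0
  exact (hpos x h0).ne' (hx' x hx)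

end OrthogonalSum

/-! ### The orthogonal decompositions of the invariant tensors -/

section Decomposition

variable {E : Type*} [NormedAddCommGroup E] [NormedSpace ℝ E] [CompleteSpace E]
  {F : Type*} [NormedAddCommGroup F] [NormedSpace ℝ F] [FiniteDimensional ℝ F]
  {G : Type*} [Group G] [TopologicalSpace G] [ChartedSpace E G] [LieGroup 𝓘(ℝ, E) ∞ G]
  {K : Subgroup G} [ChartedSpace F (G ⧸ K)] [IsManifold 𝓘(ℝ, F) ∞ (G ⧸ K)]
  (hM : IsQuotientManifold E F K)
  {𝔭 : Submodule ℝ (GroupLieAlgebra 𝓘(ℝ, E) G)} (h𝔭 : IsReductive E F K 𝔭)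
  {g : Metric F (G ⧸ K)} (hg : IsInvariantMetric g)

/-- A section of the differential of the projection with range the complement `𝔭`. -/
structure IsSectionOnto (𝔭 : Submodule ℝ (GroupLieAlgebra 𝓘(ℝ, E) G)) (σ : F →ₗ[ℝ] E) : Prop where
  mem : ∀ u, σ u ∈ 𝔭
  apply_dpi : ∀ X : E, X ∈ 𝔭 → σ (dpi E F K X) = X

include hM in
-- The differential of the projection is bijective on a complement of its kernel; `σ` is the
-- inverse. Equivariance comes from `dpi_AdE`, once `Ad(K)` is known to preserve `𝔭`.
lemma IsReductive.exists_section (h𝔭 : IsReductive E F K 𝔭) :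
    ∃ σ : F →ₗ[ℝ] E, IsEquivariantSection K σ ∧ IsSectionOnto (K := K) 𝔭 σ := by
  let 𝔮 : Submodule ℝ E := 𝔭
  have h1 : ∀ X : E, X ∈ 𝔭 → dpi E F K X = 0 → X = 0 := fun X hX hX' ↦
    Submodule.disjoint_def.1 h𝔭.isCompl.disjoint X hX hX'
  let f : 𝔮 →ₗ[ℝ] F := (dpi E F K).toLinearMap ∘ₗ 𝔮.subtype
  have hf : Function.Bijective f := by
    refine ⟨?_, fun u ↦ ?_⟩
    · rw [← LinearMap.ker_eq_bot, LinearMap.ker_eq_bot']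
      exact fun X hX ↦ Subtype.ext (h1 X.1 X.2 hX)
    · obtain ⟨X, rfl⟩ := dpi_surjective hM u
      have hX : (X : GroupLieAlgebra 𝓘(ℝ, E) G) ∈ 𝔭 ⊔ isotropyAlgebra E F K := by
        rw [h𝔭.isCompl.sup_eq_top]; trivial
      obtain ⟨Y, hY, Z, hZ, hYZ⟩ := (Submodule.mem_sup (M := GroupLieAlgebra 𝓘(ℝ, E) G)).1 hX
      refine ⟨⟨Y, hY⟩, ?_⟩
      have h2 : dpi E F K X = dpi E F K Y + dpi E F K Z :=
        (congrArg (dpi E F K) hYZ.symm).trans (map_add (dpi E F K) _ _)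
      have hZ' : dpi E F K Z = 0 := hZ
      rw [hZ', add_zero] at h2
      exact h2.symm
  let e := LinearEquiv.ofBijective f hf
  have he : ∀ u, dpi E F K (e.symm u).1 = u := fun u ↦ e.apply_symm_apply u
  have he' : ∀ X : E, ∀ hX : X ∈ 𝔭, (e.symm (dpi E F K X)).1 = X := fun X hX ↦
    congrArg Subtype.val (e.symm_apply_apply ⟨X, hX⟩)
  refine ⟨𝔮.subtype ∘ₗ e.symm.toLinearMap, ⟨he, fun k hk u ↦ ?_⟩, fun u ↦ (e.symm u).2, he'⟩
  have h2 : (AdE k (e.symm u).1 : E) ∈ 𝔭 := h𝔭.ad_mem k hk _ (e.symm u).2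
  have h3 := he' _ h2
  rw [dpi_AdE hM hk, he] at h3
  exact h3.symm

variable {σ : F →ₗ[ℝ] E} (hσ : IsEquivariantSection K σ) (hσ𝔭 : IsSectionOnto (K := K) 𝔭 σ)

lemma dpi_adP (X : E) (Y : 𝔭) :
    dpi E F K (adP h𝔭 X Y).1 = dpi E F K (lieB (E := E) G X Y.1) := by
  let W : E := lieB (E := E) G X Y.1
  let V : E := (adP h𝔭 X Y).1
  have h1 : dpi E F K (W - V) = 0 := by
    have h := sub_projectionOnto_mem h𝔭.isCompl (W : GroupLieAlgebra 𝓘(ℝ, E) G)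
    exact h
  rw [map_sub, sub_eq_zero] at h1
  exact h1.symm

include hσ hσ𝔭 in
lemma isSymmAdAt_iff (X : E) (T : BilinField F (G ⧸ K)) :
    IsSymmAdAt g h𝔭 X T ↔ IsSymmAd K g σ X T := by
  have key : IsSymmAdAt g h𝔭 X T ↔ ∀ Y Z : 𝔭,
      formAt T ((1 : G) : G ⧸ K) (dpi E F K Y.1) (dpi E F K Z.1) =
      (1 / 2) * (formAt g.inner ((1 : G) : G ⧸ K) (dpi E F K (lieB (E := E) G X Y.1))
          (dpi E F K Z.1) +
        formAt g.inner ((1 : G) : G ⧸ K) (dpi E F K Y.1)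
          (dpi E F K (lieB (E := E) G X Z.1))) := by
    simp only [← dpi_adP h𝔭]
    rfl
  rw [key]
  refine ⟨fun h u v ↦ ?_, fun h Y Z ↦ ?_⟩
  · have := h ⟨σ u, hσ𝔭.mem u⟩ ⟨σ v, hσ𝔭.mem v⟩
    simp only [hσ.dpi_apply] at this
    exact this
  · have := h (dpi E F K Y.1) (dpi E F K Z.1)
    simp only [adF_apply, hσ𝔭.apply_dpi _ Y.2, hσ𝔭.apply_dpi _ Z.2] at this
    exact this

lemma mem_pZero_iff {X : E} : X ∈ pZero F K 𝔭 ↔ X ∈ 𝔭 ∧ ∀ Z, dpi E F K Z = 0 → lieB G Z X = 0 :=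
  Iff.rfl

include hM hσ hσ𝔭 in
lemma mem_pZero_of_fixed {u : F} (hu : ∀ k ∈ K, AdE k (σ u) = σ u) : σ u ∈ pZero F K 𝔭 :=
  mem_pZero_iff.2 ⟨hσ𝔭.mem u, fun _ hZ ↦ lieB_eq_zero_of_AdE_eq hM hu hZ⟩

include hM in
-- Evaluation at `o` is injective.
lemma finiteDimensional_invTensors : FiniteDimensional ℝ (invTensors F K) := by
  let f : invTensors F K →ₗ[ℝ] LinearMap.BilinForm ℝ F :=
    { toFun := fun T ↦ formAt T.1 ((1 : G) : G ⧸ K)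
      map_add' := fun S T ↦ formAt_add S.1 T.1 _
      map_smul' := fun c T ↦ formAt_smul c T.1 _ }
  refine Module.Finite.of_injective (N := LinearMap.BilinForm ℝ F) f
    fun S T h ↦ invTensors_ext hM fun u v ↦ ?_
  exact congrArg (fun B : LinearMap.BilinForm ℝ F ↦ B u v) h

lemma endo_formAt_add (g : Metric F (G ⧸ K)) (x : G ⧸ K) (S T : invTensors F K) :
    endo g x (formAt (S + T).1 x) = endo g x (formAt S.1 x) + endo g x (formAt T.1 x) := by
  refine endo_eq g x fun u v ↦ ?_
  rw [LinearMap.add_apply, map_add, LinearMap.add_apply, endo_apply, endo_apply]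
  rfl

lemma endo_formAt_smul (g : Metric F (G ⧸ K)) (x : G ⧸ K) (c : ℝ) (T : invTensors F K) :
    endo g x (formAt (c • T).1 x) = c • endo g x (formAt T.1 x) := by
  refine endo_eq g x fun u v ↦ ?_
  rw [LinearMap.smul_apply, map_smul, LinearMap.smul_apply, endo_apply]
  rfl

/-- The inner product on the invariant tensors, as a bilinear form. -/
def innerForm (g : Metric F (G ⧸ K)) : LinearMap.BilinForm ℝ (invTensors F K) :=
  LinearMap.mk₂ ℝ (innerG g)
    (fun S S' T ↦ by simp only [innerG, endo_formAt_add, LinearMap.add_comp, map_add])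
    (fun c S T ↦ by simp only [innerG, endo_formAt_smul, LinearMap.smul_comp, map_smul])
    (fun S T T' ↦ by simp only [innerG, endo_formAt_add, LinearMap.comp_add, map_add])
    (fun c S T ↦ by simp only [innerG, endo_formAt_smul, LinearMap.comp_smul, map_smul])

lemma innerForm_apply (S T : invTensors F K) : innerForm g S T = innerG g S T := rfl

lemma innerG_comm (S T : invTensors F K) : innerG g S T = innerG g T S :=
  LinearMap.trace_comp_comm' _ _

include hM in
lemma innerForm_pos (T : invTensors F K) (hT : T ≠ 0) : 0 < innerForm g T T := by
  refine trace_comp_self_pos (metric_symm g _) (metric_pos g _)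
    (endo_symm g _ fun u v ↦ invTensors_symm T _ u v) fun h ↦ hT (invTensors_ext hM fun u v ↦ ?_)
  have := endo_apply g ((1 : G) : G ⧸ K) (formAt T.1 ((1 : G) : G ⧸ K)) u v
  rw [h, LinearMap.zero_apply, map_zero] at this
  exact this.symm

lemma endo_metricInv (hg : IsInvariantMetric g) (x : G ⧸ K) :
    endo g x (formAt (metricInv hg).1 x) = LinearMap.id :=
  endo_eq g _ fun _ _ ↦ rfl

include hM hσ hσ𝔭 hg

lemma mem_divFree_iff_orthogonal (htr : ∀ u, LinearMap.trace ℝ F (adF K σ (σ u)) = 0)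
    (T : invTensors F K) : T ∈ divFree g ↔ ∀ S ∈ adTensors g h𝔭, innerG g T S = 0 := by
  rw [mem_divFree_iff hM hσ hg htr]
  refine ⟨fun h S ⟨X, hX, hS⟩ ↦ ?_, fun h u ↦ ?_⟩
  · rw [innerG_symmAd ((isSymmAdAt_iff h𝔭 hσ hσ𝔭 X _).1 hS),
      ← hσ𝔭.apply_dpi X ((mem_pZero_iff (E := E)).1 hX).1]
    exact h _
  -- A nonzero trace at some `u` yields one at a fixed vector `y ∈ 𝔭₀`. The tensor of `y` exists
  -- without connectedness of `K`, precisely because `y` is fixed by all of `K`.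
  · by_contra hu
    obtain ⟨y, hy, hy'⟩ := exists_fixed_of_trace_ne_zero hM hσ hg hu
    obtain ⟨S, hS⟩ := exists_isSymmAd hM hσ hg hy
    rw [← innerG_symmAd hS] at hy'
    exact hy' (h S ⟨σ y, mem_pZero_of_fixed hM hσ hσ𝔭 hy, (isSymmAdAt_iff h𝔭 hσ hσ𝔭 _ _).2 hS⟩)

lemma orthogonal_adTensors (htr : ∀ u, LinearMap.trace ℝ F (adF K σ (σ u)) = 0) :
    (innerForm g).orthogonal (adTensors g h𝔭) = divFree g := by
  ext T
  rw [mem_divFree_iff_orthogonal hM h𝔭 hg hσ hσ𝔭 htr, LinearMap.BilinForm.mem_orthogonal_iff]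
  refine forall₂_congr fun S _ ↦ ?_
  rw [innerG_comm]
  rfl

omit hσ hσ𝔭 in
-- The endomorphism of `g` is the identity, so pairing with `g` is the trace at `o`; at other points
-- the trace is the same by invariance.
lemma orthogonal_metricLine : (innerForm g).orthogonal (metricLine g hg) = traceless g := by
  ext T
  have h1 : innerForm g (metricInv hg) T = trace g ((1 : G) : G ⧸ K)
      (formAt T.1 ((1 : G) : G ⧸ K)) := by
    rw [innerForm_apply, innerG, endo_metricInv, LinearMap.id_comp]; rfl
  refine ⟨fun h x ↦ ?_, fun h S hS ↦ ?_⟩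
  · obtain ⟨a, rfl⟩ := QuotientGroup.mk_surjective x
    change LinearMap.trace ℝ F (endo g (a : G ⧸ K) _) = 0
    rw [endo_dactEquiv hM hg, LinearMap.trace_conj']
    exact h1.symm.trans (h _ (Submodule.mem_span_singleton_self _))
  · obtain ⟨c, rfl⟩ := Submodule.mem_span_singleton.1 hS
    change innerForm g (c • metricInv hg) T = 0
    rw [map_smul, LinearMap.smul_apply, h1, h, smul_zero]

lemma isOrthogonalDirectSum_divFree (htr : ∀ u, LinearMap.trace ℝ F (adF K σ (σ u)) = 0) :
    IsOrthogonalDirectSum (innerG g) ![adTensors g h𝔭, divFree g] := by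
  have := finiteDimensional_invTensors hM
  have h := sup_orthogonal_eq_top (B := innerForm g) innerG_comm (innerForm_pos hM)
    (adTensors g h𝔭)
  rw [orthogonal_adTensors hM h𝔭 hg hσ hσ𝔭 htr] at h
  have ho := mem_divFree_iff_orthogonal hM h𝔭 hg hσ hσ𝔭 htr
  refine isOrthogonalDirectSum_of_iSup_eq_top (B := innerForm g) (innerForm_pos hM) ?_ ?_
  · intro i j hij S hS T hT
    change innerG g S T = 0
    fin_cases i <;> fin_cases j
    · exact absurd rfl hij
    · rw [innerG_comm]; exact (ho T).1 hT S hS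
    · exact (ho S).1 hS T hT
    · exact absurd rfl hij
  · rw [← h]
    exact le_antisymm (iSup_le fun i ↦ by fin_cases i; exacts [le_sup_left, le_sup_right])
      (sup_le (le_iSup ![adTensors g h𝔭, divFree g] 0) (le_iSup ![adTensors g h𝔭, divFree g] 1))

lemma isOrthogonalDirectSum_ttTensors (htr : ∀ u, LinearMap.trace ℝ F (adF K σ (σ u)) = 0) :
    IsOrthogonalDirectSum (innerG g) ![metricLine g hg, adTensors g h𝔭, ttTensors g] := by
  have := finiteDimensional_invTensors hM
  have ho := mem_divFree_iff_orthogonal hM h𝔭 hg hσ hσ𝔭 htr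
  have hL := orthogonal_metricLine hM hg
  have hP := orthogonal_adTensors hM h𝔭 hg hσ hσ𝔭 htr
  -- The trace condition for `g` reads `tr ad_𝔭 X = 0`. So `g` is divergence-free, and therefore
  -- orthogonal to `adTensors g h𝔭`.
  have hLP : metricLine g hg ≤ divFree g := by
    refine (Submodule.span_singleton_le_iff_mem _ _).2
      ((mem_divFree_iff hM hσ hg htr (metricInv hg)).2 fun u ↦ ?_)
    rw [endo_metricInv, LinearMap.id_comp, htr]
  have h := sup_orthogonal_eq_top (B := innerForm g) innerG_comm (innerForm_pos hM)
    (metricLine g hg ⊔ adTensors g h𝔭)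
  have horth : (innerForm g).orthogonal (metricLine g hg ⊔ adTensors g h𝔭) = ttTensors g := by
    rw [ttTensors, ← hP, ← hL]
    refine le_antisymm (fun T hT ↦ ⟨fun S hS ↦ hT S (Submodule.mem_sup_right hS),
      fun S hS ↦ hT S (Submodule.mem_sup_left hS)⟩) ?_
    rintro T ⟨h1, h2⟩ S hS
    obtain ⟨S₁, hS₁, S₂, hS₂, rfl⟩ := Submodule.mem_sup.1 hS
    have e1 : innerForm g S₁ T = 0 := h2 S₁ hS₁
    have e2 : innerForm g S₂ T = 0 := h1 S₂ hS₂
    change innerForm g (S₁ + S₂) T = 0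
    rw [map_add, LinearMap.add_apply, e1, e2, add_zero]
  rw [horth] at h
  refine isOrthogonalDirectSum_of_iSup_eq_top (B := innerForm g) (innerForm_pos hM) ?_ ?_
  · have h01 : ∀ S ∈ metricLine g hg, ∀ T ∈ adTensors g h𝔭, innerG g S T = 0 := fun S hS T hT ↦
      (ho S).1 (hLP hS) T hT
    have h02 : ∀ S ∈ metricLine g hg, ∀ T ∈ ttTensors g, innerG g S T = 0 := fun S hS T hT ↦ by
      have h2 : T ∈ traceless g := hT.2
      rw [← hL] at h2
      exact h2 S hS
    have h12 : ∀ S ∈ adTensors g h𝔭, ∀ T ∈ ttTensors g, innerG g S T = 0 := fun S hS T hT ↦ by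
      rw [innerG_comm]; exact (ho T).1 hT.1 S hS
    intro i j hij S hS T hT
    change innerG g S T = 0
    fin_cases i <;> fin_cases j
    · exact absurd rfl hij
    · exact h01 S hS T hT
    · exact h02 S hS T hT
    · rw [innerG_comm]; exact h01 T hT S hS
    · exact absurd rfl hij
    · exact h12 S hS T hT
    · rw [innerG_comm]; exact h02 T hT S hS
    · rw [innerG_comm]; exact h12 T hT S hS
    · exact absurd rfl hij
  · refine top_unique (h ▸ ?_)
    have hle := le_iSup ![metricLine g hg, adTensors g h𝔭, ttTensors g]
    exact sup_le (sup_le (hle 0) (hle 1)) (hle 2)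

end Decomposition

/-! ### Compact groups: averaging over Haar measure -/

section Compact

variable {E : Type*} [NormedAddCommGroup E] [NormedSpace ℝ E] [FiniteDimensional ℝ E]
  {G : Type*} [Group G] [TopologicalSpace G] [ChartedSpace E G] [LieGroup 𝓘(ℝ, E) ∞ G]

lemma continuous_AdE : Continuous (fun a : G ↦ AdE (E := E) a) := by
  have : IsTopologicalGroup G := topologicalGroup_of_lieGroup 𝓘(ℝ, E) ∞
  have h1 : ContinuousAt (fun a : G ↦ AdE (E := E) a) 1 := by
    have h := ContinuousAt.comp (f := extChartAt 𝓘(ℝ, E) (1 : G)) (x := (1 : G))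
      (contDiffAt_AdE (E := E) (G := G)).continuousAt (contMDiffAt_chart (1 : G)).continuousAt
    refine h.congr ?_
    filter_upwards [extChartAt_source_mem_nhds (I := 𝓘(ℝ, E)) (1 : G)] with a ha
    exact congrArg AdE ((extChartAt 𝓘(ℝ, E) (1 : G)).left_inv ha)
  refine continuous_iff_continuousAt.2 fun b ↦ ?_
  have h2 : ContinuousAt (fun a : G ↦ AdE (E := E) (b⁻¹ * a)) b :=
    ContinuousAt.comp (f := fun a ↦ b⁻¹ * a) (g := fun a : G ↦ AdE (E := E) a)
      (by rwa [inv_mul_cancel]) (continuous_const_mul _).continuousAt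
  have h3 := (continuousAt_const (y := AdE (E := E) b)).clm_comp h2
  refine h3.congr (Eventually.of_forall fun a ↦ ?_)
  change (AdE b).comp (AdE (b⁻¹ * a)) = AdE a
  rw [← AdE_mul, mul_inv_cancel_left]

open MeasureTheory

/-- The adjoint representation of a compact group has an invariant inner product. -/
theorem exists_invariant_form [CompactSpace G] : ∃ B : LinearMap.BilinForm ℝ E,
    (∀ X Y, B X Y = B Y X) ∧ (∀ X, X ≠ 0 → 0 < B X X) ∧
      ∀ (a : G) X Y, B (AdE a X) (AdE a Y) = B X Y := by
  have : IsTopologicalGroup G := topologicalGroup_of_lieGroup 𝓘(ℝ, E) ∞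
  let _ : MeasurableSpace G := borel G
  have : BorelSpace G := ⟨rfl⟩
  -- With `a⁻¹` in place of `a`, acting by `Ad(b)` becomes the left translation `a ↦ b⁻¹ a`, so left
  -- invariance of Haar measure is enough.
  set f : E → E → G → ℝ := fun X Y a ↦
    inner ℝ (toEuclidean (AdE (E := E) a⁻¹ X)) (toEuclidean (AdE (E := E) a⁻¹ Y)) with hf
  have hA : ∀ X : E, Continuous fun a : G ↦ AdE (E := E) a⁻¹ X := fun X ↦
    (continuous_AdE.comp continuous_inv).clm_apply continuous_const
  have hc : ∀ X Y, Continuous (f X Y) := fun X Y ↦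
    (toEuclidean.continuous.comp (hA X)).inner (toEuclidean.continuous.comp (hA Y))
  have hi : ∀ X Y, Integrable (f X Y) (Measure.haar (G := G)) := fun X Y ↦
    (hc X Y).integrable_of_hasCompactSupport (HasCompactSupport.of_compactSpace _)
  refine ⟨LinearMap.mk₂ ℝ (fun X Y ↦ ∫ a, f X Y a ∂(Measure.haar (G := G)))
    (fun X X' Y ↦ ?_) (fun c X Y ↦ ?_) (fun X Y Y' ↦ ?_) (fun c X Y ↦ ?_),
    fun X Y ↦ ?_, fun X hX ↦ ?_, fun b X Y ↦ ?_⟩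
  · rw [← integral_add (hi _ _) (hi _ _)]
    simp only [hf, map_add, inner_add_left]
  · rw [smul_eq_mul, ← integral_const_mul]
    simp only [hf, map_smul, real_inner_smul_left]
  · rw [← integral_add (hi _ _) (hi _ _)]
    simp only [hf, map_add, inner_add_right]
  · rw [smul_eq_mul, ← integral_const_mul]
    simp only [hf, map_smul, real_inner_smul_right]
  · simp only [LinearMap.mk₂_apply, hf, real_inner_comm]
  · refine (hc X X).integral_pos_of_hasCompactSupport_nonneg_nonzero (x := 1)
      (HasCompactSupport.of_compactSpace _) (fun a ↦ real_inner_self_nonneg) ?_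
    simp only [hf, inv_one, AdE_one, ContinuousLinearMap.id_apply]
    rw [inner_self_ne_zero]
    exact fun h ↦ hX (toEuclidean.map_eq_zero_iff.1 h)
  · change ∫ a, f (AdE b X) (AdE b Y) a ∂_ = ∫ a, f X Y a ∂_
    rw [← integral_mul_left_eq_self (f X Y) b⁻¹]
    refine integral_congr_ae (Eventually.of_forall fun a ↦ ?_)
    simp only [hf, mul_inv_rev, inv_inv, AdE_mul, ContinuousLinearMap.comp_apply]

/-- Over a compact group, cocycles with values in the adjoint representation are coboundaries. -/
theorem exists_coboundary [CompactSpace G] {δ : G → E} (hc : Continuous δ)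
    (hδ : ∀ a b, δ (a * b) = δ a + AdE a (δ b)) : ∃ X : E, ∀ a, δ a = X - AdE a X := by
  have : IsTopologicalGroup G := topologicalGroup_of_lieGroup 𝓘(ℝ, E) ∞
  have : CompleteSpace E := FiniteDimensional.complete ℝ E
  let _ : MeasurableSpace G := borel G
  have : BorelSpace G := ⟨rfl⟩
  let μ : Measure G := Measure.haarMeasure ⊤
  have : IsProbabilityMeasure μ := ⟨Measure.haarMeasure_self⟩
  have hi : Integrable δ μ :=
    hc.integrable_of_hasCompactSupport (HasCompactSupport.of_compactSpace _)
  refine ⟨∫ a, δ a ∂μ, fun b ↦ ?_⟩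
  -- With `X = ∫ δ`, integrating `δ(b a) = δ(b) + Ad(b) δ(a)` over `a` gives `X = δ(b) + Ad(b) X`.
  -- The total mass must be one for the constant term.
  have h := integral_mul_left_eq_self (μ := μ) δ b
  simp only [hδ] at h
  rw [integral_add (integrable_const _) ((AdE b).integrable_comp hi), integral_const,
    ContinuousLinearMap.integral_comp_comm _ hi, probReal_univ, one_smul] at h
  exact eq_sub_of_add_eq h

variable [CompleteSpace E]

lemma invariant_form_skew {B : LinearMap.BilinForm ℝ E}
    (hB : ∀ (a : G) X Y, B (AdE a X) (AdE a Y) = B X Y) (X Y Z : E) :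
    B (lieB G X Y) Z = - B Y (lieB G X Z) := by
  obtain ⟨γ, hγ⟩ := exists_isOneParam (G := G) X
  set β := LinearMap.toContinuousBilinearMap B with hβ
  have h2 := (β.hasFDerivAt.comp_hasDerivAt (0 : ℝ) (hγ.hasDerivAt_AdE Y)).clm_apply
    (hγ.hasDerivAt_AdE Z)
  have h3 : (fun t ↦ (β ∘ fun t ↦ AdE (γ t) Y) t (AdE (γ t) Z)) = fun _ ↦ B Y Z :=
    funext fun t ↦ hB _ _ _
  rw [h3] at h2
  have h4 := h2.unique (hasDerivAt_const _ _)
  simp only [Function.comp_apply, hγ.zero, AdE_one, ContinuousLinearMap.id_apply] at h4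
  exact eq_neg_of_add_eq_zero_left h4

/-- Compact groups are unimodular. -/
theorem trace_lieBL_eq_zero [CompactSpace G] (X : E) :
    LinearMap.trace ℝ E (lieBL E G X) = 0 := by
  obtain ⟨B, hs, hpos, hB⟩ := exists_invariant_form (E := E) (G := G)
  have h0 : ∀ Y, B Y Y = 0 → Y = 0 := fun Y hY ↦ by
    by_contra h
    exact (hpos Y h).ne' hY
  exact trace_eq_zero_of_skew (g := B) ⟨fun Y hY ↦ h0 Y (hY Y), fun Y hY ↦ h0 Y (hY Y)⟩
    (invariant_form_skew hB X)

end Compact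

/-! ### Velocities of products and inverses at the identity -/

section Velocity

variable {E : Type*} [NormedAddCommGroup E] [NormedSpace ℝ E]
  {G : Type*} [Group G] [TopologicalSpace G] [ChartedSpace E G] [LieGroup 𝓘(ℝ, E) ∞ G]
  {W : Type*} [NormedAddCommGroup W] [NormedSpace ℝ W]

lemma hasFDerivAt_chart {f : W → G} {w : W} (hf : MDifferentiableAt 𝓘(ℝ, W) 𝓘(ℝ, E) f w)
    (h1 : f w = 1) : HasFDerivAt (fun z ↦ extChartAt 𝓘(ℝ, E) (1 : G) (f z))
      (tderiv (F := W) (F' := E) f w) w := by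
  have hm : MDifferentiableAt 𝓘(ℝ, W) 𝓘(ℝ, E) (fun z ↦ extChartAt 𝓘(ℝ, E) (1 : G) (f z)) w :=
    MDifferentiableAt.comp_of_eq (g := extChartAt 𝓘(ℝ, E) (1 : G)) _
      ((contMDiffAt_chart (1 : G)).mdifferentiableAt (by simp)) hf h1
  have h2 := hm.differentiableAt.hasFDerivAt
  rw [← tderiv_eq_fderiv, tderiv_comp (F := W) (F' := E) (F'' := E)
    (g := extChartAt 𝓘(ℝ, E) (1 : G)) h1
    ((contMDiffAt_chart (1 : G)).mdifferentiableAt (by simp)) hf, tderiv_chart] at h2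
  exact h2

/-- The differential of multiplication at `(1, 1)` is addition, since each of its partial
differentials is the identity. -/
lemma tderiv_mul {f h : W → G} {w : W} (hf : MDifferentiableAt 𝓘(ℝ, W) 𝓘(ℝ, E) f w)
    (hh : MDifferentiableAt 𝓘(ℝ, W) 𝓘(ℝ, E) h w) (hf1 : f w = 1) (hh1 : h w = 1) :
    tderiv (F := W) (F' := E) (fun z ↦ f z * h z) w =
      tderiv (F := W) (F' := E) f w + tderiv (F := W) (F' := E) h w := by
  have hcf := hasFDerivAt_chart hf hf1
  have hch := hasFDerivAt_chart hh hh1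
  have hmul := hasFDerivAt_chart (E := E) (f := fun z ↦ f z * h z) (w := w)
    (((contMDiff_mul 𝓘(ℝ, E) ∞).mdifferentiable (by simp) (f w, h w)).comp w
      (hf.prodMk hh)) (by rw [hf1, hh1, one_mul])
  have hd : DifferentiableAt ℝ (locMul E G) (locOne E G, locOne E G) :=
    contDiffAt_locMul.differentiableAt (by simp)
  have hloc : HasFDerivAt (locMul E G) (fderiv ℝ (locMul E G) (locOne E G, locOne E G))
      (extChartAt 𝓘(ℝ, E) (1 : G) (f w), extChartAt 𝓘(ℝ, E) (1 : G) (h w)) := by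
    rw [hf1, hh1]
    exact hd.hasFDerivAt
  have hcomp := HasFDerivAt.comp (g := locMul E G) w hloc (hcf.prodMk hch)
  have hev : (fun z ↦ extChartAt 𝓘(ℝ, E) (1 : G) (f z * h z)) =ᶠ[𝓝 w]
      fun z ↦ locMul E G (extChartAt 𝓘(ℝ, E) (1 : G) (f z), extChartAt 𝓘(ℝ, E) (1 : G) (h z)) := by
    have hs : ∀ {k : W → G}, MDifferentiableAt 𝓘(ℝ, W) 𝓘(ℝ, E) k w → k w = 1 →
        ∀ᶠ z in 𝓝 w, k z ∈ (extChartAt 𝓘(ℝ, E) (1 : G)).source := fun {k} hk hk1 ↦ by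
      refine hk.continuousAt ?_
      rw [hk1]
      exact extChartAt_source_mem_nhds _
    filter_upwards [hs hf hf1, hs hh hh1] with z h1 h2
    rw [locMul, (extChartAt 𝓘(ℝ, E) (1 : G)).left_inv h1,
      (extChartAt 𝓘(ℝ, E) (1 : G)).left_inv h2]
  rw [hmul.unique (hcomp.congr_of_eventuallyEq hev)]
  ext v
  have e1 := fderiv_partial_fst hd (tderiv (F := W) (F' := E) f w v)
  have e2 := fderiv_partial_snd hd (tderiv (F := W) (F' := E) h w v)
  rw [fderiv_locMul_fst] at e1
  rw [fderiv_locMul_snd] at e2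
  change fderiv ℝ (locMul E G) (locOne E G, locOne E G) (tderiv (F := W) (F' := E) f w v,
    tderiv (F := W) (F' := E) h w v) = tderiv (F := W) (F' := E) f w v +
      tderiv (F := W) (F' := E) h w v
  have e3 : ((tderiv (F := W) (F' := E) f w v, tderiv (F := W) (F' := E) h w v) : E × E) =
      (tderiv (F := W) (F' := E) f w v, 0) + (0, tderiv (F := W) (F' := E) h w v) := by simp
  rw [e3, map_add, ← e1, ← e2]
  rfl

lemma tderiv_inv {f : W → G} {w : W} (hf : MDifferentiableAt 𝓘(ℝ, W) 𝓘(ℝ, E) f w)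
    (hf1 : f w = 1) :
    tderiv (F := W) (F' := E) (fun z ↦ (f z)⁻¹) w = - tderiv (F := W) (F' := E) f w := by
  have hi : MDifferentiableAt 𝓘(ℝ, W) 𝓘(ℝ, E) (fun z ↦ (f z)⁻¹) w :=
    ((contMDiff_inv 𝓘(ℝ, E) ∞).mdifferentiable (by simp) (f w)).comp w hf
  have h := tderiv_mul hf hi hf1 (by rw [hf1, inv_one])
  simp only [mul_inv_cancel] at h
  rw [tderiv_const] at h
  exact eq_neg_of_add_eq_zero_right h.symm

end Velocity

/-! ### Infinitesimal automorphisms of a compact group are inner -/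

section Automorphisms

variable {E : Type*} [NormedAddCommGroup E] [NormedSpace ℝ E]
  {G : Type*} [Group G] [TopologicalSpace G] [ChartedSpace E G] [LieGroup 𝓘(ℝ, E) ∞ G]

/-- A smooth one-parameter family of automorphisms of `G` through the identity. -/
structure IsAutFamily (φ : ℝ → MulAut G) : Prop where
  contMDiff : ContMDiff (𝓘(ℝ, ℝ).prod 𝓘(ℝ, E)) 𝓘(ℝ, E) ∞ (fun p : ℝ × G ↦ φ p.1 p.2)
  zero : φ 0 = 1

variable (E) in
/-- The velocity at `0` of `t ↦ φ_t(a) a⁻¹`. -/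
def autVelocity (φ : ℝ → MulAut G) (a : G) : E :=
  tderiv (F := ℝ) (F' := E) (fun t ↦ φ t a * a⁻¹) 0 1

variable {φ : ℝ → MulAut G} (hφ : IsAutFamily (E := E) φ)

variable (E) in
/-- The map `(t, s) ↦ φ_t(s) s⁻¹` in the chart around `1`. -/
def locAut (φ : ℝ → MulAut G) (p : ℝ × E) : E :=
  extChartAt 𝓘(ℝ, E) (1 : G) (φ p.1 ((extChartAt 𝓘(ℝ, E) (1 : G)).symm p.2) *
    ((extChartAt 𝓘(ℝ, E) (1 : G)).symm p.2)⁻¹)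

include hφ

lemma IsAutFamily.mdifferentiableAt (t : ℝ) (a : G) :
    MDifferentiableAt 𝓘(ℝ, E) 𝓘(ℝ, E) (φ t) a :=
  (hφ.contMDiff.comp (contMDiff_const.prodMk contMDiff_id)).mdifferentiable (by simp) a

lemma IsAutFamily.mdifferentiableAt_curve (a : G) (t : ℝ) :
    MDifferentiableAt 𝓘(ℝ, ℝ) 𝓘(ℝ, E) (fun t ↦ φ t a * a⁻¹) t :=
  ((hφ.contMDiff.comp (contMDiff_id.prodMk contMDiff_const)).mul
    (contMDiff_const (c := a⁻¹))).mdifferentiable (by simp) t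

/-- Differentiate `φ_t(ab)(ab)⁻¹ = (φ_t(a)a⁻¹) · a (φ_t(b)b⁻¹) a⁻¹`. This is the cocycle identity
required by `exists_coboundary`. -/
lemma IsAutFamily.autVelocity_mul (a b : G) :
    autVelocity E φ (a * b) = autVelocity E φ a + AdE a (autVelocity E φ b) := by
  have h0 : ∀ a, φ 0 a * a⁻¹ = 1 := fun a ↦ by simp [hφ.zero]
  have h1 : (fun t ↦ φ t (a * b) * (a * b)⁻¹) =
      fun t ↦ (φ t a * a⁻¹) * (a * (φ t b * b⁻¹) * a⁻¹) := by
    funext t; rw [map_mul]; group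
  have h2 : MDifferentiableAt 𝓘(ℝ, ℝ) 𝓘(ℝ, E) (fun t ↦ a * (φ t b * b⁻¹) * a⁻¹) 0 :=
    (mdifferentiableAt_conj (E := E) a (φ 0 b * b⁻¹)).comp (0 : ℝ)
      (hφ.mdifferentiableAt_curve b 0)
  rw [autVelocity, h1, tderiv_mul (hφ.mdifferentiableAt_curve a 0) h2 (h0 a)
    (by rw [h0]; group), tderiv_comp (F := ℝ) (F' := E) (F'' := E)
    (g := fun x : G ↦ a * x * a⁻¹) (f := fun t ↦ φ t b * b⁻¹) (h0 b) (mdifferentiableAt_conj _ _)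
    (hφ.mdifferentiableAt_curve b 0)]
  rfl

lemma IsAutFamily.contDiffAt_locAut : ContDiffAt ℝ ∞ (locAut E φ) ((0 : ℝ), locOne E G) := by
  have h1 : ContMDiffAt 𝓘(ℝ, ℝ × E) 𝓘(ℝ, E) ∞
      (fun p : ℝ × E ↦ (extChartAt 𝓘(ℝ, E) (1 : G)).symm p.2) ((0 : ℝ), locOne E G) :=
    ContMDiffAt.comp (f := Prod.snd) ((0 : ℝ), locOne E G) contMDiffAt_symm_locOne
      contDiffAt_snd.contMDiffAt
  have h2 : ContMDiffAt 𝓘(ℝ, ℝ × E) 𝓘(ℝ, E) ∞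
      (fun p : ℝ × E ↦ φ p.1 ((extChartAt 𝓘(ℝ, E) (1 : G)).symm p.2)) ((0 : ℝ), locOne E G) :=
    ContMDiffAt.comp (g := fun p : ℝ × G ↦ φ p.1 p.2)
      (f := fun p : ℝ × E ↦ (p.1, (extChartAt 𝓘(ℝ, E) (1 : G)).symm p.2)) ((0 : ℝ), locOne E G)
      hφ.contMDiff.contMDiffAt (contDiffAt_fst.contMDiffAt.prodMk h1)
  exact (ContMDiffAt.comp_of_eq (g := extChartAt 𝓘(ℝ, E) (1 : G)) (contMDiffAt_chart 1)
    (h2.mul h1.inv) (by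
      change φ 0 ((extChartAt 𝓘(ℝ, E) (1 : G)).symm (locOne E G)) *
        ((extChartAt 𝓘(ℝ, E) (1 : G)).symm (locOne E G))⁻¹ = 1
      rw [symm_locOne, map_one, inv_one, mul_one])).contDiffAt

lemma IsAutFamily.fderiv_locAut_fst (s : E) :
    fderiv ℝ (fun t ↦ locAut E φ (t, s)) 0 1 =
      autVelocity E φ ((extChartAt 𝓘(ℝ, E) (1 : G)).symm s) := by
  rw [autVelocity, ← (hasFDerivAt_chart (hφ.mdifferentiableAt_curve _ 0)
    (by simp [hφ.zero])).fderiv]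
  rfl

/-- Product rule for `φ_t(s) s⁻¹` at the identity. Together with `IsAutFamily.fderiv_locAut_fst` it
makes the mixed partial of `locAut` both the `t`-derivative of `dφ_t` and the derivative of the
cocycle at `1`. -/
lemma IsAutFamily.fderiv_locAut_snd (t : ℝ) :
    fderiv ℝ (fun s ↦ locAut E φ (t, s)) (locOne E G) =
      tderiv (F := E) (F' := E) (φ t) 1 - .id ℝ E := by
  have hs : MDifferentiableAt 𝓘(ℝ, E) 𝓘(ℝ, E) (extChartAt 𝓘(ℝ, E) (1 : G)).symm (locOne E G) :=
    contMDiffAt_symm_locOne.mdifferentiableAt (by simp)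
  have hsi : MDifferentiableAt 𝓘(ℝ, E) 𝓘(ℝ, E)
      (fun s ↦ ((extChartAt 𝓘(ℝ, E) (1 : G)).symm s)⁻¹) (locOne E G) :=
    ((contMDiff_inv 𝓘(ℝ, E) ∞).mdifferentiable (by simp) _).comp (locOne E G) hs
  have hp : MDifferentiableAt 𝓘(ℝ, E) 𝓘(ℝ, E)
      (fun s ↦ φ t ((extChartAt 𝓘(ℝ, E) (1 : G)).symm s)) (locOne E G) :=
    (hφ.mdifferentiableAt t _).comp (locOne E G) hs
  have h1 : φ t ((extChartAt 𝓘(ℝ, E) (1 : G)).symm (locOne E G)) = 1 := by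
    rw [symm_locOne, map_one]
  have h2 : ((extChartAt 𝓘(ℝ, E) (1 : G)).symm (locOne E G))⁻¹ = 1 := by
    rw [symm_locOne, inv_one]
  have hm : MDifferentiableAt 𝓘(ℝ, E) 𝓘(ℝ, E) (fun s ↦ φ t ((extChartAt 𝓘(ℝ, E) (1 : G)).symm s) *
      ((extChartAt 𝓘(ℝ, E) (1 : G)).symm s)⁻¹) (locOne E G) :=
    MDifferentiableAt.comp (g := fun p : G × G ↦ p.1 * p.2)
      (f := fun s ↦ (φ t ((extChartAt 𝓘(ℝ, E) (1 : G)).symm s),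
        ((extChartAt 𝓘(ℝ, E) (1 : G)).symm s)⁻¹)) (locOne E G)
      ((contMDiff_mul 𝓘(ℝ, E) ∞).mdifferentiable (by simp) _) (hp.prodMk hsi)
  have h3 := (hasFDerivAt_chart hm (by rw [h1, h2, one_mul])).fderiv
  rw [tderiv_mul hp hsi h1 h2, tderiv_inv hs symm_locOne, tderiv_comp (F := E) (F' := E) (F'' := E)
    (g := φ t) symm_locOne (hφ.mdifferentiableAt t 1) hs, locOne, tderiv_chart_symm] at h3
  rw [sub_eq_add_neg]
  exact h3

/-- Smoothness in the chart gives continuity at `1`, and the cocycle identity carries it to every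
point. -/
lemma IsAutFamily.continuous_autVelocity : Continuous (autVelocity E φ) := by
  have : IsTopologicalGroup G := topologicalGroup_of_lieGroup 𝓘(ℝ, E) ∞
  have h0 : ContinuousAt (fun s ↦ fderiv ℝ (fun t ↦ locAut E φ (t, s)) 0 1) (locOne E G) :=
    ((contDiffAt_fderiv_partial_fst hφ.contDiffAt_locAut).continuousAt).clm_apply
      continuousAt_const
  have h1 : ContinuousAt (autVelocity E φ) 1 := by
    have h := ContinuousAt.comp (f := extChartAt 𝓘(ℝ, E) (1 : G)) (x := (1 : G))
      (h0.congr (Eventually.of_forall hφ.fderiv_locAut_fst)) (contMDiffAt_chart (1 : G)).continuousAt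
    refine h.congr ?_
    filter_upwards [extChartAt_source_mem_nhds (I := 𝓘(ℝ, E)) (1 : G)] with a ha
    exact congrArg (autVelocity E φ) ((extChartAt 𝓘(ℝ, E) (1 : G)).left_inv ha)
  refine continuous_iff_continuousAt.2 fun b ↦ ?_
  have h2 : ContinuousAt (fun a : G ↦ autVelocity E φ (b⁻¹ * a)) b :=
    ContinuousAt.comp (f := fun a ↦ b⁻¹ * a) (g := autVelocity E φ)
      (by rwa [inv_mul_cancel]) (continuous_const_mul _).continuousAt
  have h3 := (continuousAt_const (y := autVelocity E φ b)).add
    ((AdE (E := E) b).continuous.continuousAt.comp h2)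
  refine h3.congr (Eventually.of_forall fun a ↦ ?_)
  change autVelocity E φ b + AdE b (autVelocity E φ (b⁻¹ * a)) = autVelocity E φ a
  rw [← hφ.autVelocity_mul, mul_inv_cancel_left]

/-- For a compact group, the infinitesimal automorphisms given by one-parameter families are
inner. -/
theorem IsAutFamily.exists_inner [CompactSpace G] [FiniteDimensional ℝ E] [CompleteSpace E] :
    ∃ X : E, ∀ Y, HasDerivAt (fun t ↦ tderiv (F := E) (F' := E) (φ t) 1 Y) (lieB G X Y) 0 := by
  obtain ⟨X, hX⟩ := exists_coboundary hφ.continuous_autVelocity hφ.autVelocity_mul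
  refine ⟨X, fun Y ↦ ?_⟩
  have hF := hφ.contDiffAt_locAut
  have h1 : DifferentiableAt ℝ (fun t ↦ fderiv ℝ (fun s ↦ locAut E φ (t, s)) (locOne E G)) 0 :=
    (contDiffAt_fderiv_partial_snd hF).differentiableAt (by simp)
  have hs : HasFDerivAt (fun s ↦ fderiv ℝ (fun t ↦ locAut E φ (t, s)) 0) _ (locOne E G) :=
    ((contDiffAt_fderiv_partial_fst hF).differentiableAt (by simp)).hasFDerivAt
  have h3 := hs.clm_apply (hasFDerivAt_const (1 : ℝ) _)
  obtain ⟨L, hL, hL'⟩ := hasFDerivAt_AdE_comp (E := E) (G := G)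
    (contMDiffAt_symm_locOne.mdifferentiableAt (by simp)) symm_locOne X
  have h4 : HasFDerivAt (fun s ↦ X - AdE ((extChartAt 𝓘(ℝ, E) (1 : G)).symm s) X) (-L)
      (locOne E G) := hL.const_sub X
  have h5 : (fun s ↦ fderiv ℝ (fun t ↦ locAut E φ (t, s)) 0 1) =
      fun s ↦ X - AdE ((extChartAt 𝓘(ℝ, E) (1 : G)).symm s) X :=
    funext fun s ↦ (hφ.fderiv_locAut_fst s).trans (hX _)
  rw [h5] at h3
  -- The coboundary `X - Ad(s) X` has derivative `-[Y, X] = [X, Y]` at the identity; exchanging the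
  -- partials below turns this into the velocity of `dφ_t Y`.
  have h6 := congrArg (fun L : E →L[ℝ] E ↦ L Y) (h3.unique h4)
  have h7 : tderiv (F := E) (F' := E) (extChartAt 𝓘(ℝ, E) (1 : G)).symm (locOne E G) =
      .id ℝ E := tderiv_chart_symm (1 : G)
  have h8 : (-L) Y = lieB G X Y := by
    rw [neg_apply, hL', h7]
    exact lieB_neg_swap X Y
  rw [h8] at h6
  simp only [ContinuousLinearMap.comp_zero, zero_add, ContinuousLinearMap.flip_apply] at h6
  have h9 := (h1.hasFDerivAt.hasDerivAt.clm_apply (hasDerivAt_const (0 : ℝ) Y)).add_const Y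
  rw [map_zero, add_zero, fderiv_fderiv_partial_comm hF, h6] at h9
  refine h9.congr_of_eventuallyEq (Eventually.of_forall fun t ↦ ?_)
  simp only [hφ.fderiv_locAut_snd]
  exact (sub_add_cancel _ _).symm

end Automorphisms

/-! ### Velocities of pullbacks by automorphisms -/

section TrivialVariations

variable {E : Type*} [NormedAddCommGroup E] [NormedSpace ℝ E] [FiniteDimensional ℝ E]
  [CompleteSpace E]
  {F : Type*} [NormedAddCommGroup F] [NormedSpace ℝ F] [FiniteDimensional ℝ F]
  {G : Type*} [Group G] [TopologicalSpace G] [ChartedSpace E G] [LieGroup 𝓘(ℝ, E) ∞ G]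
  {K : Subgroup G} [ChartedSpace F (G ⧸ K)] [IsManifold 𝓘(ℝ, F) ∞ (G ⧸ K)]
  (hM : IsQuotientManifold E F K) {g : Metric F (G ⧸ K)} (hg : IsInvariantMetric g)

include hM

lemma mdifferentiableAt_autMap (φ : autGK (E := E) K) (x : G ⧸ K) :
    MDifferentiableAt 𝓘(ℝ, F) 𝓘(ℝ, F) (autMap φ) x := by
  obtain ⟨a, rfl⟩ := QuotientGroup.mk_surjective x
  obtain ⟨s, hs1, hs2, hs3⟩ := exists_section hM a
  have h1 : MDifferentiableAt 𝓘(ℝ, F) 𝓘(ℝ, F) (fun y ↦ ((φ.1 (s y) : G) : G ⧸ K)) (a : G ⧸ K) :=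
    (mdifferentiableAt_mk hM _).comp _ ((φ.2.1.mdifferentiable (by simp) _).comp _
      (hs2.mdifferentiableAt (by simp)))
  refine h1.congr_of_eventuallyEq ?_
  filter_upwards [hs3] with y hy
  rw [← autMap_mk, hy]

omit [FiniteDimensional ℝ E] [CompleteSpace E] [FiniteDimensional ℝ F] [LieGroup 𝓘(ℝ, E) ∞ G]
  [IsManifold 𝓘(ℝ, F) ∞ (G ⧸ K)] [ChartedSpace F (G ⧸ K)] hM in
lemma autMap_one (φ : autGK (E := E) K) : autMap φ ((1 : G) : G ⧸ K) = ((1 : G) : G ⧸ K) := by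
  rw [autMap_mk, map_one]

lemma tderiv_autMap (φ : autGK (E := E) K) (Y : E) :
    tderiv (F := F) (F' := F) (autMap φ) ((1 : G) : G ⧸ K) (dpi E F K Y) =
      dpi E F K (tderiv (F := E) (F' := E) φ.1 1 Y) := by
  have h1 := tderiv_comp (F := E) (F' := F) (F'' := F) (g := autMap φ)
    (f := (QuotientGroup.mk : G → G ⧸ K)) (x := 1) rfl (mdifferentiableAt_autMap hM φ _)
    (mdifferentiableAt_mk hM 1)
  have h2 := tderiv_comp (F := E) (F' := E) (F'' := F) (g := (QuotientGroup.mk : G → G ⧸ K))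
    (f := φ.1) (x := 1) (map_one φ.1) (mdifferentiableAt_mk hM 1)
    (φ.2.1.mdifferentiable (by simp) 1)
  exact congrArg (fun L : E →L[ℝ] F ↦ L Y) (h1.symm.trans h2)

lemma pullback_autMap_one (φ : autGK (E := E) K) (Y Z : E) :
    formCLM (pullback (autMap φ) g.inner) ((1 : G) : G ⧸ K) (dpi E F K Y) (dpi E F K Z) =
      formCLM g.inner ((1 : G) : G ⧸ K) (dpi E F K (tderiv (F := E) (F' := E) φ.1 1 Y))
        (dpi E F K (tderiv (F := E) (F' := E) φ.1 1 Z)) := by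
  have h : formCLM (pullback (autMap φ) g.inner) ((1 : G) : G ⧸ K) (dpi E F K Y) (dpi E F K Z) =
    formCLM g.inner (autMap φ ((1 : G) : G ⧸ K))
      (tderiv (F := F) (F' := F) (autMap φ) ((1 : G) : G ⧸ K) (dpi E F K Y))
      (tderiv (F := F) (F' := F) (autMap φ) ((1 : G) : G ⧸ K) (dpi E F K Z)) := rfl
  rw [h, tderiv_autMap hM, tderiv_autMap hM, autMap_one]

lemma hasDerivAt_pullback_autMap {φ : ℝ → autGK (E := E) K} (h0 : (φ 0).1 = 1) {X : E}
    (hX : ∀ Y, HasDerivAt (fun t ↦ tderiv (F := E) (F' := E) (φ t).1 1 Y) (lieB G X Y) 0)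
    (Y Z : E) : HasDerivAt (fun t ↦ formCLM (pullback (autMap (φ t)) g.inner) ((1 : G) : G ⧸ K)
        (dpi E F K Y) (dpi E F K Z))
      (formCLM g.inner ((1 : G) : G ⧸ K) (dpi E F K (lieB G X Y)) (dpi E F K Z) +
        formCLM g.inner ((1 : G) : G ⧸ K) (dpi E F K Y) (dpi E F K (lieB G X Z))) 0 := by
  have hd : ∀ Y, HasDerivAt (fun t ↦ dpi E F K (tderiv (F := E) (F' := E) (φ t).1 1 Y))
      (dpi E F K (lieB G X Y)) 0 := fun Y ↦
    (dpi E F K).hasFDerivAt.comp_hasDerivAt (0 : ℝ) (hX Y)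
  have he : ∀ Y, dpi E F K (tderiv (F := E) (F' := E) (φ 0).1 1 Y) = dpi E F K Y := fun Y ↦ by
    rw [h0]
    exact congrArg (fun L : E →L[ℝ] E ↦ dpi E F K (L Y)) (tderiv_id (F := E) (1 : G))
  have h := ((formCLM g.inner ((1 : G) : G ⧸ K)).hasFDerivAt.comp_hasDerivAt (0 : ℝ)
    (hd Y)).clm_apply (hd Z)
  simp only [Function.comp_apply, he] at h
  refine h.congr_of_eventuallyEq (Eventually.of_forall fun t ↦ ?_)
  exact pullback_autMap_one hM (φ t) Y Z

variable {𝔭 : Submodule ℝ (GroupLieAlgebra 𝓘(ℝ, E) G)} (h𝔭 : IsReductive E F K 𝔭)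
  {σ : F →ₗ[ℝ] E} (hσ : IsEquivariantSection K σ) (hσ𝔭 : IsSectionOnto (K := K) 𝔭 σ)

include hg hσ hσ𝔭

lemma trivialVariations_subset [CompactSpace G] {T : invTensors F K}
    (hT : T ∈ trivialVariations (E := E) g) : T ∈ adTensors g h𝔭 := by
  obtain ⟨φ, hφ, hd⟩ := hT
  let ψ : ℝ → autGK (E := E) K := fun t ↦ φ (Multiplicative.ofAdd t)
  have h0 : ψ 0 = 1 := map_one φ
  have hψ : IsAutFamily (E := E) (fun t ↦ (ψ t).1) := ⟨hφ, by rw [h0]; rfl⟩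
  obtain ⟨X, hX⟩ := hψ.exists_inner
  have hT : ∀ Y Z : E, formCLM T.1 ((1 : G) : G ⧸ K) (dpi E F K Y) (dpi E F K Z) =
      formCLM g.inner ((1 : G) : G ⧸ K) (dpi E F K (lieB G X Y)) (dpi E F K Z) +
        formCLM g.inner ((1 : G) : G ⧸ K) (dpi E F K Y) (dpi E F K (lieB G X Z)) := fun Y Z ↦
    HasDerivAt.unique (hd ((1 : G) : G ⧸ K) (dpi E F K Y : F) (dpi E F K Z : F))
      (hasDerivAt_pullback_autMap hM (φ := ψ) (by rw [h0]; rfl) hX Y Z)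
  -- The differentials of automorphisms preserving `K` preserve `𝔨`; hence so does their velocity
  -- `ad X`.
  have hk : ∀ Z, dpi E F K Z = 0 → dpi E F K (lieB G X Z) = 0 := by
    intro Z hZ
    have h1 := (dpi E F K).hasFDerivAt.comp_hasDerivAt (0 : ℝ) (hX Z)
    have h2 : (dpi E F K ∘ fun t ↦ tderiv (F := E) (F' := E) (ψ t).1 1 Z) = fun _ ↦ 0 := by
      funext t
      change dpi E F K (tderiv (F := E) (F' := E) (ψ t).1 1 Z) = 0
      rw [← tderiv_autMap hM, hZ, map_zero]
    rw [h2] at h1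
    exact h1.unique (hasDerivAt_const _ _)
  set X₁ : E := σ (dpi E F K X) with hX₁
  have hX₂ : dpi E F K (X - X₁) = 0 := by rw [map_sub, hX₁, hσ.dpi_apply, sub_self]
  have hadd : ∀ Y, lieB G X Y = lieB G X₁ Y + lieB G (X - X₁) Y := fun Y ↦ by
    rw [← lieBL_apply, ← lieBL_apply, ← lieBL_apply, map_sub, LinearMap.sub_apply, add_sub_cancel]
  -- For the `𝔭`-component `X₁`, the bracket with `𝔨` lies in `𝔨` by `hk`, as `𝔨` is a subalgebra,
  -- and in `𝔭` by reductivity, so it is zero.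
  have hX₀ : ∀ Z, dpi E F K Z = 0 → lieB G Z X₁ = 0 := by
    intro Z hZ
    have h1 := hk Z hZ
    rw [hadd, map_add, dpi_lieB_eq_zero hM hX₂ hZ, add_zero, ← lieB_neg_swap, map_neg,
      neg_eq_zero] at h1
    rw [← lieB_section hM hσ hZ, h1, map_zero]
  -- The velocity contains `ad X₁` in both arguments, which is twice the symmetric part; the
  -- `𝔨`-component of `X` cancels by `invariant_form_lieB`.
  refine ⟨(2 : ℝ) • X₁, Submodule.smul_mem _ _ ((mem_pZero_iff (E := E)).2 ⟨hσ𝔭.mem _, hX₀⟩),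
    (isSymmAdAt_iff (E := E) h𝔭 hσ hσ𝔭 ((2 : ℝ) • X₁) _).2 fun u v ↦ ?_⟩
  have h1 := hT (σ u) (σ v)
  have h2 := invariant_form_lieB hM (formCLM g.inner ((1 : G) : G ⧸ K))
    (fun k hk u v ↦ metric_isotropy hM hg hk u v) hX₂ (σ u) (σ v)
  have h3 : ∀ u, adF K σ ((2 : ℝ) • X₁) u = (2 : ℝ) • dpi E F K (lieB G X₁ (σ u)) := fun u ↦ by
    rw [adF_apply, ← lieBL_apply, map_smul, LinearMap.smul_apply, map_smul]; rfl
  rw [h3, h3]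
  simp only [hadd, map_add, add_apply, hσ.dpi_apply, map_smul, smul_eq_mul, LinearMap.smul_apply,
    formAt_apply] at h1 h2 ⊢
  linarith

omit hσ𝔭 in
/-- An invariant tensor which is the symmetric part of `ad X` is also the symmetric part of `ad X'`
for some `X'` fixed by `Ad(K)`. -/
lemma exists_fixed_symmAd [CompactSpace G] {X : E} {T : invTensors F K}
    (hT : IsSymmAd K g σ X T.1) : ∃ X' : E, (∀ k ∈ K, AdE k X' = X') ∧ IsSymmAd K g σ X' T.1 := by
  obtain ⟨B, hs, hpos, hB⟩ := exists_invariant_form (E := E) (G := G)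
  let q : E → F → F → ℝ := fun Y u v ↦ formAt g.inner ((1 : G) : G ⧸ K) (adF K σ Y u) v +
      formAt g.inner ((1 : G) : G ⧸ K) u (adF K σ Y v)
  have hadd : ∀ Y Y' u, adF K σ (Y + Y') u = adF K σ Y u + adF K σ Y' u := fun Y Y' u ↦ by
    simp only [adF_apply, ← lieBL_apply, map_add, LinearMap.add_apply]
  have hsmul : ∀ (c : ℝ) Y u, adF K σ (c • Y) u = c • adF K σ Y u := fun c Y u ↦ by
    simp only [adF_apply, ← lieBL_apply, map_smul, LinearMap.smul_apply]
  have qadd : ∀ Y Y' u v, q (Y + Y') u v = q Y u v + q Y' u v := fun Y Y' u v ↦ by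
    simp only [q, hadd, map_add, LinearMap.add_apply]; ring
  have qsmul : ∀ (c : ℝ) Y u v, q (c • Y) u v = c * q Y u v := fun c Y u v ↦ by
    simp only [q, hsmul, map_smul, LinearMap.smul_apply, smul_eq_mul]; ring
  have qAd : ∀ k ∈ K, ∀ Y u v, q (AdE k Y) (dact F k ((1 : G) : G ⧸ K) u)
      (dact F k ((1 : G) : G ⧸ K) v) = q Y u v := fun k hk Y u v ↦ by
    simp only [q, adF_AdE hM hσ hk, metric_isotropy hM hg hk]
  have qT : ∀ u v, formAt T.1 ((1 : G) : G ⧸ K) u v = (1 / 2) * q X u v := hT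
  -- The vectors whose `ad_𝔭` has zero symmetric part. `K` may be disconnected, so `X` itself need
  -- not be fixed; its component orthogonal to `N`, for an `Ad`-invariant inner product, will be.
  let N : Submodule ℝ E :=
    { carrier := {Y | ∀ u v, q Y u v = 0}
      zero_mem' := fun u v ↦ by have := qsmul 0 0 u v; rwa [zero_smul, zero_mul] at this
      add_mem' := fun {Y Y'} h h' u v ↦ by rw [qadd, h, h', add_zero]
      smul_mem' := fun c Y h u v ↦ by rw [qsmul, h, mul_zero] }
  have qN : ∀ k ∈ K, ∀ Y, (∀ u v, q Y (dact F k ((1 : G) : G ⧸ K) u)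
      (dact F k ((1 : G) : G ⧸ K) v) = q Y u v) → AdE k Y - Y ∈ N := fun k hk Y hY u v ↦ by
    obtain ⟨u, rfl⟩ := (dactEquiv F hM k).surjective u
    obtain ⟨v, rfl⟩ := (dactEquiv F hM k).surjective v
    have h1 := qadd (AdE k Y - Y) Y (dact F k ((1 : G) : G ⧸ K) u) (dact F k ((1 : G) : G ⧸ K) v)
    rw [sub_add_cancel, qAd k hk, hY] at h1
    simp only [dactEquiv_apply]
    linarith
  have hX : X ∈ N ⊔ B.orthogonal N := by
    rw [sup_orthogonal_eq_top hs hpos]; trivial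
  obtain ⟨n, hn, X', hX', rfl⟩ := Submodule.mem_sup.1 hX
  have qX : ∀ u v, q (n + X') u v = q X' u v := fun u v ↦ by rw [qadd, hn u v, zero_add]
  refine ⟨X', fun k hk ↦ ?_, fun u v ↦ (qT u v).trans (by rw [qX])⟩
  -- Invariance of `T` places this difference in `N`, while `Ad(K)`-stability of `N` and invariance
  -- of `B` place it in the orthogonal complement; it therefore vanishes.
  have h1 : AdE k X' - X' ∈ N := qN k hk X' fun u v ↦ by
    have := invTensors_apply_isotropy T hk u v
    have h1 := qT u v
    have h2 := qT (dact F k ((1 : G) : G ⧸ K) u) (dact F k ((1 : G) : G ⧸ K) v)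
    rw [formAt_apply, qX] at h1 h2
    linarith
  have h2 : AdE k X' - X' ∈ B.orthogonal N := by
    refine Submodule.sub_mem _ (fun Y hY ↦ ?_) hX'
    have hY' : AdE k⁻¹ Y ∈ N := fun u v ↦ by
      have := qAd k hk (AdE k⁻¹ Y) u v
      rw [AdE_apply_inv_apply] at this
      rw [← this]
      exact hY _ _
    have h3 := hB k (AdE k⁻¹ Y) X'
    rw [AdE_apply_inv_apply] at h3
    exact h3.trans (hX' _ hY')
  have h3 := h2 _ h1
  by_contra h
  exact (hpos _ (sub_ne_zero.2 h)).ne' h3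

omit hσ hσ𝔭 hM hg [FiniteDimensional ℝ E] [FiniteDimensional ℝ F]
  [IsManifold 𝓘(ℝ, F) ∞ (G ⧸ K)] [ChartedSpace F (G ⧸ K)] in
-- Conjugation by `k` gives a one-parameter subgroup with initial velocity `Ad(k) X = X`; uniqueness
-- applies.
lemma IsOneParam.commute_of_AdE_eq {γ : ℝ → G} {X : E} (hγ : IsOneParam γ X) {k : G}
    (hk : AdE k X = X) (t : ℝ) : k * γ t * k⁻¹ = γ t := by
  refine congrFun (IsOneParam.unique (γ := fun t ↦ k * γ t * k⁻¹) (X := X) ⟨?_, fun s t ↦ ?_, ?_⟩ hγ) t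
  · exact ((contMDiff_const (c := k)).mul hγ.contMDiff).mul (contMDiff_const (c := k⁻¹))
  · rw [hγ.add]; group
  · rw [tderiv_comp (F := ℝ) (F' := E) (F'' := E) (g := fun b : G ↦ k * b * k⁻¹) (f := γ) hγ.zero
      (mdifferentiableAt_conj _ _) (hγ.mdifferentiableAt 0), ContinuousLinearMap.comp_apply,
      hγ.tderiv_zero]
    exact hk

variable (K) in
omit hσ hσ𝔭 hM hg [FiniteDimensional ℝ E] [CompleteSpace E] [FiniteDimensional ℝ F]
  [IsManifold 𝓘(ℝ, F) ∞ (G ⧸ K)] [ChartedSpace F (G ⧸ K)] in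
/-- Conjugation by a one-parameter subgroup commuting with `K`, as a one-parameter subgroup of
`Aut(G/K)`. -/
def conjFamily {γ : ℝ → G} {X : E} (hγ : IsOneParam γ X) (hK : ∀ k ∈ K, ∀ t, k * γ t * k⁻¹ = γ t) :
    Multiplicative ℝ →* autGK (E := E) K where
  toFun t := ⟨MulAut.conj (γ t.toAdd), (contMDiff_const.mul contMDiff_id).mul contMDiff_const,
    (contMDiff_const.mul contMDiff_id).mul contMDiff_const, fun a ↦ by
      rw [MulAut.conj_apply]
      refine ⟨fun h ↦ ?_, fun h ↦ ?_⟩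
      · have h1 := hK _ h t.toAdd
        rw [mul_inv_eq_iff_eq_mul, inv_mul_cancel_right, mul_right_inj] at h1
        rwa [h1]
      · have h1 := hK _ h t.toAdd
        rw [mul_inv_eq_iff_eq_mul] at h1
        rwa [← h1, mul_inv_cancel_right]⟩
  map_one' := Subtype.ext (by
    change MulAut.conj (γ 0) = 1
    rw [hγ.zero, map_one])
  map_mul' s t := Subtype.ext (by
    change MulAut.conj (γ (s.toAdd + t.toAdd)) = MulAut.conj (γ s.toAdd) * MulAut.conj (γ t.toAdd)
    rw [hγ.add, map_mul])

omit hσ hσ𝔭 in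
-- Since `φ(a x) = φ(a) φ(x)` on `G/K`, the pullback of an invariant metric is invariant again.
-- Velocities therefore need to be computed only at `o`.
lemma pullback_autMap_smul (φ : autGK (E := E) K) (a : G) (u v : F) :
    formCLM (pullback (autMap φ) g.inner) (a : G ⧸ K) (dactEquiv F hM a u) (dactEquiv F hM a v) =
      formCLM (pullback (autMap φ) g.inner) ((1 : G) : G ⧸ K) u v := by
  have h1 : (fun x : G ⧸ K ↦ autMap φ (a • x)) = fun x ↦ φ.1 a • autMap φ x := by
    funext x
    obtain ⟨b, rfl⟩ := QuotientGroup.mk_surjective x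
    rw [MulAction.Quotient.smul_coe, smul_eq_mul, autMap_mk, autMap_mk,
      MulAction.Quotient.smul_coe, smul_eq_mul, map_mul]
  have h2 := tderiv_comp (F := F) (F' := F) (F'' := F) (g := autMap φ) (f := fun x : G ⧸ K ↦ a • x)
    (smul_base a) (mdifferentiableAt_autMap hM φ _) (mdifferentiableAt_smul hM a _)
  rw [h1, tderiv_comp (F := F) (F' := F) (F'' := F) (g := fun x : G ⧸ K ↦ φ.1 a • x)
    (f := autMap φ) rfl (mdifferentiableAt_smul hM _ _) (mdifferentiableAt_autMap hM φ _)] at h2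
  have h3 : ∀ u, tderiv (F := F) (F' := F) (autMap φ) (a : G ⧸ K) (dactEquiv F hM a u) =
      dact F (φ.1 a) (autMap φ ((1 : G) : G ⧸ K))
        (tderiv (F := F) (F' := F) (autMap φ) ((1 : G) : G ⧸ K) u) := fun u ↦
    congrArg (fun L : F →L[ℝ] F ↦ L u) h2.symm
  have h4 : ∀ x u v, formCLM (pullback (autMap φ) g.inner) x u v = formCLM g.inner (autMap φ x)
      (tderiv (F := F) (F' := F) (autMap φ) x u) (tderiv (F := F) (F' := F) (autMap φ) x v) :=
    fun _ _ _ ↦ rfl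
  have h5 : autMap φ (a : G ⧸ K) = φ.1 a • autMap φ ((1 : G) : G ⧸ K) := by
    rw [autMap_one, autMap_mk, smul_base]
  rw [h4, h4, h3, h3, h5]
  exact invTensors_apply (metricInv hg) (φ.1 a) _ _ _

lemma subset_trivialVariations [CompactSpace G] {T : invTensors F K} (hT : T ∈ adTensors g h𝔭) :
    T ∈ trivialVariations (E := E) g := by
  obtain ⟨X, hX, hT⟩ := hT
  obtain ⟨X', hX', hT⟩ := exists_fixed_symmAd hM hg hσ ((isSymmAdAt_iff h𝔭 hσ hσ𝔭 X _).1 hT)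
  -- Half of `X'`, because the derivative of the pullback metric is twice the symmetric part.
  obtain ⟨γ, hγ⟩ := exists_isOneParam (G := G) ((1 / 2 : ℝ) • X')
  have hK : ∀ k ∈ K, ∀ t, k * γ t * k⁻¹ = γ t := fun k hk ↦
    hγ.commute_of_AdE_eq (by rw [map_smul, hX' k hk])
  refine ⟨conjFamily K hγ hK, ?_, fun x u v ↦ ?_⟩
  · exact ((hγ.contMDiff.comp contMDiff_fst).mul contMDiff_snd).mul
      (hγ.contMDiff.comp contMDiff_fst).inv
  · obtain ⟨a, rfl⟩ := QuotientGroup.mk_surjective x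
    have hmain : ∀ u v : F, HasDerivAt (fun t : ℝ ↦ formCLM (pullback (autMap
        (conjFamily K hγ hK (Multiplicative.ofAdd t))) g.inner) (a : G ⧸ K) u v)
        (formAt T.1 (a : G ⧸ K) u v) 0 := by
      intro u v
      obtain ⟨u, rfl⟩ := (dactEquiv F hM a).surjective u
      obtain ⟨v, rfl⟩ := (dactEquiv F hM a).surjective v
      simp only [pullback_autMap_smul hM hg, formAt_dactEquiv]
      have h := hasDerivAt_pullback_autMap hM (g := g)
        (φ := fun t ↦ conjFamily K hγ hK (Multiplicative.ofAdd t))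
        (congrArg Subtype.val (map_one (conjFamily K hγ hK))) hγ.hasDerivAt_AdE (σ u) (σ v)
      rw [hσ.dpi_apply, hσ.dpi_apply] at h
      convert h using 1
      rw [hT]
      simp only [← lieBL_apply, map_smul, LinearMap.smul_apply, smul_eq_mul, smul_apply]
      rw [mul_add]
      rfl
    exact hmain u v

end TrivialVariations

end HomTT

end

/-! ### The theorem -/

open HomTT in
theorem corollary3p6
    {E : Type*} [NormedAddCommGroup E] [NormedSpace ℝ E] [FiniteDimensional ℝ E] [CompleteSpace E]
    {F : Type*} [NormedAddCommGroup F] [NormedSpace ℝ F] [FiniteDimensional ℝ F]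
    {G : Type*} [Group G] [TopologicalSpace G] [ChartedSpace E G] [LieGroup 𝓘(ℝ, E) ∞ G]
    (K : Subgroup G) (hK : IsClosed (K : Set G))
    [ChartedSpace F (G ⧸ K)] [IsManifold 𝓘(ℝ, F) ∞ (G ⧸ K)] [ConnectedSpace (G ⧸ K)]
    (hM : IsQuotientManifold E F K)
    (𝔭 : Submodule ℝ (GroupLieAlgebra 𝓘(ℝ, E) G)) (h𝔭 : IsReductive E F K 𝔭)
    (g : Metric F (G ⧸ K)) (hg : IsInvariantMetric g) :
    (IsConnected (K : Set G) →
      ∀ X ∈ pZero F K 𝔭, ∃ T : invTensors F K, IsSymmAdAt g h𝔭 X T.1) ∧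
    (IsUnimodular E G →
      IsOrthogonalDirectSum (innerG g) ![adTensors g h𝔭, divFree g] ∧
      ∀ T : invTensors F K, T ∈ divFree g ↔ ∀ S ∈ adTensors g h𝔭, innerG g T S = 0) ∧
    (CompactSpace G →
      trivialVariations (E := E) g = (adTensors g h𝔭 : Set (invTensors F K)) ∧
      IsOrthogonalDirectSum (innerG g)
        ![metricLine g hg, Submodule.span ℝ (trivialVariations (E := E) g), ttTensors g]) := by
  obtain ⟨σ, hσ, hσ𝔭⟩ := h𝔭.exists_section hM
  refine ⟨fun hconn X hX ↦ ?_, fun hun ↦ ?_, fun hcomp ↦ ?_⟩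
  · obtain ⟨T, hT⟩ := exists_isSymmAd hM hσ hg (X := X)
      fun k hk ↦ AdE_eq_of_isConnected hM hconn hX.2 hk
    exact ⟨T, (isSymmAdAt_iff h𝔭 hσ hσ𝔭 X _).2 hT⟩
  · have htr : ∀ u, LinearMap.trace ℝ F (adF K σ (σ u)) = 0 := fun u ↦
      trace_adF hM hσ (hun (σ u))
    exact ⟨isOrthogonalDirectSum_divFree hM h𝔭 hg hσ hσ𝔭 htr,
      mem_divFree_iff_orthogonal hM h𝔭 hg hσ hσ𝔭 htr⟩
  · have htr : ∀ u, LinearMap.trace ℝ F (adF K σ (σ u)) = 0 := fun u ↦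
      trace_adF hM hσ (trace_lieBL_eq_zero (σ u))
    have h : trivialVariations (E := E) g = (adTensors g h𝔭 : Set (invTensors F K)) :=
      Set.Subset.antisymm (fun _ ↦ trivialVariations_subset hM hg h𝔭 hσ hσ𝔭)
        (fun _ ↦ subset_trivialVariations hM hg h𝔭 hσ hσ𝔭)
    refine ⟨h, ?_⟩
    -- The set of velocities is already a subspace, so taking its span changes nothing.
    rw [h, Submodule.span_eq]
    exact isOrthogonalDirectSum_ttTensors hM h𝔭 hg hσ hσ𝔭 htr
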